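/- Let $d\ge 1$, $T>0$, $\mathbb{T}^d=\mathbb{R}^d/\mathbb{Z}^d$ with its Lebesgue (Haar) measure, and let $b\in L^1([0,T]\times\mathbb{T}^d;\mathbb{R}^d)$, $b_t=b(t,\cdot)$, be such that for every $t\in[0,T]$ one has $b_t\in W^{1,1}(\mathbb{T}^d;\mathbb{R}^d)$, with distributional gradient $\nabla b_t$. Assume that $$\sup_{t\in[0,T]}\int_{\mathbb{T}^d}\exp\{\beta|\nabla b_t(x)|\}\,dx<\infty\quad\text{for every }\beta>0,\qquad \|\operatorname{div} b\|_{L^\infty([0,T]\times\mathbb{T}^d)}<\infty .$$ Then each $b_t$, $t\in[0,T]$, has a continuous representative (still denoted $b_t$); this representative admits a unique flow, i.e. a unique map $X:[0,T]\times\mathbb{T}^d\to\mathbb{T}^d$ such that for every $x\in\mathbb{T}^d$ the function $s\mapsto b_s(X_s(x))$ is integrable on $[0,T]$ and $$X_t(x)=x+\int_0^t b_s(X_s(x))\,ds \pmod{\mathbb{Z}^d}\qquad\text{for all } t\in[0,T];$$ and for every $t\in[0,T]$ the map $X_t:\mathbb{T}^d\to\mathbb{T}^d$ is bijective, and $X_t$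 and its inverse $(X_t)^{-1}$ belong to $W^{1,p}$ for every $1\le p<\infty$. Here a map $F:\mathbb{T}^d\to\mathbb{T}^d$ is said to belong to $W^{1,p}$ if $F(x)=x+u(x) \pmod{\mathbb{Z}^d}$ for all $x\in\mathbb{T}^d$, for some continuous $u:\mathbb{T}^d\to\mathbb{R}^d$ in the Sobolev space $W^{1,p}(\mathbb{T}^d;\mathbb{R}^d)$. -/

import Mathlib

open MeasureTheory Set
open scoped ENNReal ContDiff

/-- Euclidean space `ℝᵈ`. The torus `ℝᵈ / ℤᵈ` is Mathlib's `UnitAddTorus (Fin d)`, with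
`volume` the Haar probability measure. -/
abbrev Euc (d : ℕ) : Type := EuclideanSpace ℝ (Fin d)

/-- The canonical projection `ℝᵈ → ℝᵈ / ℤᵈ`. -/
def torusProj {d : ℕ} (v : Euc d) : UnitAddTorus (Fin d) := fun i => ((v i : ℝ) : UnitAddCircle)

/-- A function on the torus is `C^∞` if its periodic lift to `ℝᵈ` is. -/
def TorusSmooth {d : ℕ} (φ : UnitAddTorus (Fin d) → ℝ) : Prop :=
  ContDiff ℝ ∞ (fun v : Euc d => φ (torusProj v))

/-- The classical partial derivative `∂ⱼ φ` on the torus (used for smooth `φ` only). -/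
noncomputable def torusPartial {d : ℕ} (j : Fin d) (φ : UnitAddTorus (Fin d) → ℝ)
    (y : UnitAddTorus (Fin d)) : ℝ :=
  deriv (fun s : ℝ => φ (y + Pi.single j (s : UnitAddCircle))) 0

/-- `g ∈ L¹` is the distributional partial derivative `∂ⱼ f` of `f ∈ L¹` on the torus. -/
def HasWeakPartial {d : ℕ} (j : Fin d) (f g : UnitAddTorus (Fin d) → ℝ) : Prop :=
  Integrable f volume ∧ Integrable g volume ∧
    ∀ φ : UnitAddTorus (Fin d) → ℝ, TorusSmooth φ →
      ∫ y, f y * torusPartial j φ y = - ∫ y, g y * φ y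

/-- `G` is the distributional gradient of the vector field `f`: `G y i j = ∂ⱼ fᵢ (y)`. -/
def IsWeakGradient {d : ℕ} (f : UnitAddTorus (Fin d) → Euc d)
    (G : UnitAddTorus (Fin d) → Matrix (Fin d) (Fin d) ℝ) : Prop :=
  ∀ i j : Fin d, HasWeakPartial j (fun y => f y i) (fun y => G y i j)

/-- The Euclidean (Frobenius) norm `|A|` of a matrix. -/
noncomputable def matrixAbs {d : ℕ} (A : Matrix (Fin d) (Fin d) ℝ) : ℝ :=
  Real.sqrt (∑ i, ∑ j, A i j ^ 2)

/-- The Sobolev space `W^{1,p}(𝕋ᵈ; ℝᵈ)`: `f` and its distributional gradient are in `Lᵖ`. -/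
def MemW1p {d : ℕ} (p : ℝ≥0∞) (f : UnitAddTorus (Fin d) → Euc d) : Prop :=
  MemLp f p volume ∧
    ∃ G : UnitAddTorus (Fin d) → Matrix (Fin d) (Fin d) ℝ, IsWeakGradient f G ∧
      ∀ i j : Fin d, MemLp (fun y => G y i j) p volume

/-- `W^{1,p}` regularity of a torus map `F` homotopic to the identity (as flow maps are):
`F` has a continuous lift `v ↦ v + u(v)` to `ℝᵈ` whose periodic part `u`, which is unique up to
a constant in `ℤᵈ`, belongs to `W^{1,p}(𝕋ᵈ; ℝᵈ)`. Equivalently, the lift is in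
`W^{1,p}_loc(ℝᵈ; ℝᵈ)`. -/
def TorusMapMemW1p {d : ℕ} (p : ℝ≥0∞) (F : UnitAddTorus (Fin d) → UnitAddTorus (Fin d)) : Prop :=
  ∃ u : UnitAddTorus (Fin d) → Euc d,
    Continuous u ∧ (∀ y, F y = y + torusProj (u y)) ∧ MemW1p p u

/-- `X` is a flow of `b` on `[0,T]`: for every `x`, the curve `t ↦ X t x` is an absolutely
continuous solution of `∂ₜ X = b(t, X)`, `X(0,x) = x`, written in integral form (`b` is merely
measurable in time). -/
def IsFlow {d : ℕ} (T : ℝ) (b : ℝ → UnitAddTorus (Fin d) → Euc d)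
    (X : ℝ → UnitAddTorus (Fin d) → UnitAddTorus (Fin d)) : Prop :=
  ∀ x, IntegrableOn (fun s => b s (X s x)) (Icc 0 T) volume ∧
    ∀ t ∈ Icc 0 T, X t x = x + torusProj (∫ s in (0 : ℝ)..t, b s (X s x))

/-!
The idea is to bound the derivatives of an Euler scheme for the mollified field in every `Lᵖ`,
uniformly in the scheme, and to pass to the limit. With time step `h = T / n`, each step
`x ↦ x + ∫ b_s` of the scheme compresses volume by at most a factor `exp (O(h))`, because the
divergence is bounded. The derivative of the composition of the `n` steps is at most the product of
`exp ‖∇ ∫ b_s‖` along the scheme; the arithmetic-geometric mean inequality, the bound on the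
compression, and Jensen's inequality reduce its `p`-th moment to an exponential moment of order
`O(p T)` of `∇b`, which is finite because all exponential moments are.

Exponential integrability of order `l` of the gradient also gives the mollified fields the modulus
`|f(x + w) - f(x)| ≤ A |w| + B exp (-l A)` for all large `A`. This yields the continuous
representative. In Gronwall's inequality on `[0, T]` the factor `exp (A T)` is beaten by
`exp (-l A)` as soon as `l > T`, so approximate solutions are uniformly close to each other: the
Euler scheme converges uniformly and the flow is unique. The bounds in `Lᵖ` persist in the weak
limit, and the inverse of the flow map at time `t` is the flow map of the time-reversed field
`-b_{t - s}`, to which the same argument applies.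
-/

open Filter Topology

local notation "𝕋" d:max => UnitAddTorus (Fin d)

section Torus

variable {d : ℕ}

instance isProbabilityMeasure_volume_torus : IsProbabilityMeasure (volume : Measure (𝕋 d)) :=
  ⟨by simp [volume_pi, Measure.pi_univ]⟩

instance isNegInvariant_volume_torus : (volume : Measure (𝕋 d)).IsNegInvariant :=
  Measure.IsAddHaarMeasure.isNegInvariant_of_regular _

@[simp] theorem torusProj_zero : torusProj (0 : Euc d) = 0 := by
  ext; simp [torusProj]

theorem torusProj_add (v w : Euc d) : torusProj (v + w) = torusProj v + torusProj w := by
  ext i; simp [torusProj]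

theorem torusProj_neg (v : Euc d) : torusProj (-v) = -torusProj v := by
  ext i; simp [torusProj]

theorem torusProj_sub (v w : Euc d) : torusProj (v - w) = torusProj v - torusProj w := by
  ext i; simp [torusProj]

theorem torusProj_single (j : Fin d) (s : ℝ) :
    torusProj (EuclideanSpace.single j s) = Pi.single j (s : UnitAddCircle) := by
  ext i
  obtain rfl | h := eq_or_ne i j <;> simp [torusProj, *]

theorem isOpenQuotientMap_torusProj : IsOpenQuotientMap (torusProj : Euc d → 𝕋 d) :=
  (IsOpenQuotientMap.piMap fun _ : Fin d => QuotientAddGroup.isOpenQuotientMap_mk).comp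
    (PiLp.homeomorph 2 (fun _ : Fin d => ℝ)).isOpenQuotientMap

@[fun_prop]
theorem continuous_torusProj : Continuous (torusProj : Euc d → 𝕋 d) :=
  isOpenQuotientMap_torusProj.continuous

theorem torusProj_surjective : Function.Surjective (torusProj : Euc d → 𝕋 d) :=
  isOpenQuotientMap_torusProj.surjective

theorem torusProj_eq_torusProj_iff {v w : Euc d} :
    torusProj v = torusProj w ↔ ∃ k : Fin d → ℤ, ∀ i, v i = w i + k i := by
  simp only [funext_iff, torusProj, ← Classical.skolem (p := fun i (k : ℤ) => v i = w i + k)]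
  refine forall_congr' fun i => ?_
  rw [← sub_eq_zero, ← AddCircle.coe_sub, AddCircle.coe_eq_zero_iff]
  simp only [zsmul_eq_mul, mul_one, eq_sub_iff_add_eq, add_comm, eq_comm]

theorem injOn_torusProj_of_abs_sub_lt {S : Set (Euc d)}
    (hS : ∀ v ∈ S, ∀ w ∈ S, ∀ i, |v i - w i| < 1) : InjOn torusProj S := by
  intro v hv w hw h
  obtain ⟨k, hk⟩ := torusProj_eq_torusProj_iff.1 h
  ext i
  have hki : |(k i : ℝ)| < 1 := by simpa [hk i] using hS v hv w hw i
  have hki0 : k i = 0 := Int.abs_lt_one_iff.1 (by exact_mod_cast hki)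
  simp [hk i, hki0]

theorem norm_le_sum_abs (w : Euc d) : ‖w‖ ≤ ∑ i, |w i| := by
  rw [EuclideanSpace.norm_eq]
  refine Real.sqrt_le_iff.2 ⟨Finset.sum_nonneg fun _ _ => abs_nonneg _, ?_⟩
  simpa using Finset.sum_sq_le_sq_sum_of_nonneg (s := Finset.univ) (f := fun i => |w i|)
    (fun _ _ => abs_nonneg _)

theorem exists_torusProj_eq_norm_le (y : 𝕋 d) :
    ∃ w : Euc d, torusProj w = y ∧ ‖w‖ ≤ d * ‖y‖ := by
  obtain ⟨v, rfl⟩ := torusProj_surjective y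
  refine ⟨WithLp.toLp 2 fun i => v i - round (v i), ?_, (norm_le_sum_abs _).trans ?_⟩
  · exact torusProj_eq_torusProj_iff.2 ⟨fun i => -round (v i), fun i => by simp [sub_eq_add_neg]⟩
  · calc ∑ i, |v i - round (v i)| = ∑ i, ‖torusProj v i‖ :=
          Finset.sum_congr rfl fun i _ => (UnitAddCircle.norm_eq).symm
      _ ≤ ∑ _i : Fin d, ‖torusProj v‖ := Finset.sum_le_sum fun i _ => norm_le_pi_norm _ i
      _ = d * ‖torusProj v‖ := by simp

/-- The half-open unit cube with corner `a`, a fundamental domain for `torusProj`. -/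
def unitCube (a : Fin d → ℝ) : Set (Euc d) := {v | ∀ i, v i ∈ Ioc (a i) (a i + 1)}

theorem unitCube_eq_preimage (a : Fin d → ℝ) :
    unitCube a = WithLp.ofLp ⁻¹' univ.pi fun i => Ioc (a i) (a i + 1) := by
  ext v; simp [unitCube]

theorem measurableSet_unitCube (a : Fin d → ℝ) : MeasurableSet (unitCube a) := by
  rw [unitCube_eq_preimage]
  exact (PiLp.volume_preserving_ofLp (Fin d)).measurable
    (MeasurableSet.univ_pi fun i => measurableSet_Ioc)

theorem injOn_torusProj_unitCube (a : Fin d → ℝ) : InjOn torusProj (unitCube a) :=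
  injOn_torusProj_of_abs_sub_lt fun v hv w hw i => by
    have hvi := hv i
    have hwi := hw i
    rw [abs_sub_lt_iff]
    constructor <;> linarith [hvi.1, hvi.2, hwi.1, hwi.2]

theorem measurePreserving_torusProj (a : Fin d → ℝ) :
    MeasurePreserving torusProj (volume.restrict (unitCube a)) (volume : Measure (𝕋 d)) := by
  have hpi : MeasurePreserving (fun (v : Fin d → ℝ) i => (v i : UnitAddCircle))
      (volume.restrict (univ.pi fun i => Ioc (a i) (a i + 1))) volume := by
    rw [volume_pi, Measure.restrict_pi_pi]
    exact measurePreserving_pi _ _ fun i => UnitAddCircle.measurePreserving_mk (a i)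
  rw [unitCube_eq_preimage]
  exact hpi.comp ((PiLp.volume_preserving_ofLp (Fin d)).restrict_preimage_emb
    (MeasurableEquiv.toLp 2 (Fin d → ℝ)).symm.measurableEmbedding _)

theorem volume_image_torusProj_of_subset_unitCube {a : Fin d → ℝ} {S : Set (Euc d)}
    (hS : MeasurableSet S) (hSa : S ⊆ unitCube a) : volume (torusProj '' S) = volume S := by
  have hinj := injOn_torusProj_unitCube a
  have himage : MeasurableSet (torusProj '' S) :=
    hS.image_of_measurable_injOn continuous_torusProj.measurable (hinj.mono hSa)
  rw [← (measurePreserving_torusProj a).measure_preimage himage.nullMeasurableSet,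
    Measure.restrict_apply (continuous_torusProj.measurable himage),
    hinj.preimage_image_inter hSa]

theorem iUnion_unitCube_intCast : ⋃ k : Fin d → ℤ, unitCube (fun i => (k i : ℝ)) = univ := by
  refine eq_univ_of_forall fun v => mem_iUnion.2 ⟨fun i => ⌈v i⌉ - 1, fun i => ?_⟩
  simp only [mem_Ioc, Int.cast_sub, Int.cast_one]
  constructor <;> linarith [Int.le_ceil (v i), Int.ceil_lt_add_one (v i)]

theorem pairwise_disjoint_unitCube_intCast :
    Pairwise (Function.onFun Disjoint fun k : Fin d → ℤ => unitCube fun i => (k i : ℝ)) := by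
  have eq_ceil {v : Euc d} {k : Fin d → ℤ} (hv : v ∈ unitCube fun i => (k i : ℝ)) (i : Fin d) :
      k i + 1 = ⌈v i⌉ := by
    refine (Int.ceil_eq_iff.2 ?_).symm
    push_cast
    exact ⟨by linarith [(hv i).1], (hv i).2⟩
  refine fun k l hkl => Set.disjoint_left.2 fun v hk hl => hkl (funext fun i => ?_)
  linarith [eq_ceil hk i, eq_ceil hl i]

theorem volume_image_torusProj {S : Set (Euc d)} (hS : MeasurableSet S)
    (hinj : InjOn torusProj S) : volume (torusProj '' S) = volume S := by
  set Q : (Fin d → ℤ) → Set (Euc d) := fun k => S ∩ unitCube fun i => (k i : ℝ)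
  have hSQ : S = ⋃ k, Q k := by rw [← inter_iUnion, iUnion_unitCube_intCast, inter_univ]
  have hQm (k) : MeasurableSet (Q k) := hS.inter (measurableSet_unitCube _)
  have hQd : Pairwise (Function.onFun Disjoint Q) := fun k l hkl =>
    (pairwise_disjoint_unitCube_intCast hkl).mono inter_subset_right inter_subset_right
  have himage (k) : MeasurableSet (torusProj '' Q k) :=
    (hQm k).image_of_measurable_injOn continuous_torusProj.measurable
      (hinj.mono inter_subset_left)
  have himage_disj : Pairwise (Function.onFun Disjoint fun k => torusProj '' Q k) :=
    fun k l hkl => by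
      rw [Function.onFun, Set.disjoint_iff_inter_eq_empty,
        ← hinj.image_inter inter_subset_left inter_subset_left, (hQd hkl).inter_eq, image_empty]
  rw [hSQ, image_iUnion, measure_iUnion himage_disj himage, measure_iUnion hQd hQm]
  exact tsum_congr fun k => volume_image_torusProj_of_subset_unitCube (hQm k) inter_subset_right

theorem map_torusProj_restrict_le {S : Set (Euc d)} (hS : MeasurableSet S)
    (hinj : InjOn torusProj S) : (volume.restrict S).map torusProj ≤ volume := by
  refine Measure.le_iff.2 fun A hA => ?_
  have hpre : MeasurableSet (torusProj ⁻¹' A ∩ S) := (continuous_torusProj.measurable hA).inter hS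
  rw [Measure.map_apply continuous_torusProj.measurable hA,
    Measure.restrict_apply (continuous_torusProj.measurable hA),
    ← volume_image_torusProj hpre (hinj.mono inter_subset_right)]
  exact measure_mono (image_subset_iff.2 inter_subset_left)

theorem setLIntegral_torusProj_le {S : Set (Euc d)} (hS : MeasurableSet S)
    (hinj : InjOn torusProj S) {g : 𝕋 d → ℝ≥0∞} (hg : Measurable g) :
    ∫⁻ v in S, g (torusProj v) ≤ ∫⁻ y, g y := by
  rw [← lintegral_map hg continuous_torusProj.measurable]
  exact lintegral_mono' (map_torusProj_restrict_le hS hinj) le_rfl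

theorem lintegral_unitCube_torusProj (a : Fin d → ℝ) {g : 𝕋 d → ℝ≥0∞} (hg : Measurable g) :
    ∫⁻ v in unitCube a, g (torusProj v) = ∫⁻ y, g y :=
  (measurePreserving_torusProj a).lintegral_comp hg

end Torus

/-- `f` is a `C¹` function on the torus with Fréchet derivative `f'`; the derivative at `y` is that
of `v ↦ f (y + torusProj v)` at the origin of `ℝᵈ`. -/
structure TorusC1 {d : ℕ} {F : Type*} [NormedAddCommGroup F] [NormedSpace ℝ F]
    (f : 𝕋 d → F) (f' : 𝕋 d → Euc d →L[ℝ] F) : Prop where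
  continuous_deriv : Continuous f'
  hasFDerivAt_zero : ∀ y, HasFDerivAt (fun v : Euc d => f (y + torusProj v)) (f' y) 0

namespace TorusC1

variable {d : ℕ} {F : Type*} [NormedAddCommGroup F] [NormedSpace ℝ F]
  {f : 𝕋 d → F} {f' : 𝕋 d → Euc d →L[ℝ] F}

theorem hasFDerivAt (h : TorusC1 f f') (y : 𝕋 d) (v : Euc d) :
    HasFDerivAt (fun w : Euc d => f (y + torusProj w)) (f' (y + torusProj v)) v := by
  have hshift : HasFDerivAt (fun w : Euc d => f (y + torusProj v + torusProj (w - v)))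
      (f' (y + torusProj v)) v := by
    have hzero := h.hasFDerivAt_zero (y + torusProj v)
    rw [← sub_self v] at hzero
    exact HasFDerivAt.comp (f := fun w => w - v) v hzero (hasFDerivAt_sub_const v)
  simpa [torusProj_sub, add_assoc] using hshift

theorem hasFDerivAt_comp_torusProj (h : TorusC1 f f') (v : Euc d) :
    HasFDerivAt (fun w : Euc d => f (torusProj w)) (f' (torusProj v)) v := by
  simpa using h.hasFDerivAt 0 v

theorem continuous (h : TorusC1 f f') : Continuous f :=
  isOpenQuotientMap_torusProj.isQuotientMap.continuous_iff.2 <|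
    continuous_iff_continuousAt.2 fun v => (h.hasFDerivAt_comp_torusProj v).continuousAt

theorem hasDerivAt_add_single {f : 𝕋 d → ℝ} {f' : 𝕋 d → Euc d →L[ℝ] ℝ} (h : TorusC1 f f')
    (j : Fin d) (y : 𝕋 d) (t : ℝ) :
    HasDerivAt (fun s : ℝ => f (y + Pi.single j (s : UnitAddCircle)))
      (f' (y + Pi.single j (t : UnitAddCircle)) (EuclideanSpace.single j 1)) t := by
  have hline : HasDerivAt (fun s : ℝ => EuclideanSpace.single j s)
      (EuclideanSpace.single j (1 : ℝ)) t := by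
    have hsmul := (hasDerivAt_id t).smul_const (EuclideanSpace.single j (1 : ℝ))
    rw [one_smul] at hsmul
    refine hsmul.congr_of_eventuallyEq (Eventually.of_forall fun s => ?_)
    ext i
    simp
  simpa [Function.comp_def, torusProj_single] using
    (h.hasFDerivAt y (EuclideanSpace.single j t)).comp_hasDerivAt t hline

theorem torusPartial_eq {f : 𝕋 d → ℝ} {f' : 𝕋 d → Euc d →L[ℝ] ℝ} (h : TorusC1 f f')
    (j : Fin d) (y : 𝕋 d) : torusPartial j f y = f' y (EuclideanSpace.single j 1) := by
  simpa [torusPartial] using (h.hasDerivAt_add_single j y 0).deriv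

end TorusC1

section Compression

variable {d : ℕ} {W : 𝕋 d → Euc d} {W' : 𝕋 d → Euc d →L[ℝ] Euc d} {r : ℝ}

theorem TorusC1.injective_add_comp_torusProj (hW : TorusC1 W W') (hr1 : r < 1)
    (hr : ∀ y, ‖W' y‖ ≤ r) : Function.Injective fun v : Euc d => v + W (torusProj v) := by
  intro v w hvw
  have hlip : ‖W (torusProj w) - W (torusProj v)‖ ≤ r * ‖w - v‖ :=
    convex_univ.norm_image_sub_le_of_norm_hasFDerivWithin_le
      (fun x _ => (hW.hasFDerivAt_comp_torusProj x).hasFDerivWithinAt) (fun x _ => hr _)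
      (mem_univ v) (mem_univ w)
  have hdiff : v - w = W (torusProj w) - W (torusProj v) :=
    sub_eq_sub_iff_add_eq_add.2 (by simpa [add_comm] using hvw)
  rw [← hdiff, norm_sub_rev w v] at hlip
  exact sub_eq_zero.1 (norm_eq_zero.1 (by nlinarith [norm_nonneg (v - w)]))

theorem injOn_torusProj_image_add_comp_torusProj
    (hinj : Function.Injective fun v : Euc d => v + W (torusProj v)) (a : Fin d → ℝ) :
    InjOn torusProj ((fun v : Euc d => v + W (torusProj v)) '' unitCube a) := by
  rintro _ ⟨v, hv, rfl⟩ _ ⟨w, hw, rfl⟩ h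
  obtain ⟨k, hk⟩ := torusProj_eq_torusProj_iff.1 h
  set κ : Euc d := WithLp.toLp 2 fun i => (k i : ℝ)
  have hw_shift : torusProj (w + κ) = torusProj w :=
    torusProj_eq_torusProj_iff.2 ⟨k, fun i => by simp [κ]⟩
  have hv_eq : v = w + κ := hinj <| by
    ext i
    simp only [hw_shift, hk i, PiLp.add_apply, κ]
    ring
  rw [injOn_torusProj_unitCube a hv hw (by rw [hv_eq, hw_shift])]

theorem TorusC1.lintegral_comp_add_torusProj_le (hW : TorusC1 W W') (hr1 : r < 1)
    (hr : ∀ y, ‖W' y‖ ≤ r) {c : ℝ} (hc : 0 < c)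
    (hdet : ∀ y, c ≤ (ContinuousLinearMap.id ℝ (Euc d) + W' y).det)
    {g : 𝕋 d → ℝ≥0∞} (hg : Measurable g) :
    ∫⁻ y, g (y + torusProj (W y)) ≤ ENNReal.ofReal c⁻¹ * ∫⁻ y, g y := by
  set Φ : Euc d → Euc d := fun v => v + W (torusProj v) with hΦ
  have hΦ' (v) : HasFDerivAt Φ (ContinuousLinearMap.id ℝ (Euc d) + W' (torusProj v)) v :=
    (hasFDerivAt_id v).add (hW.hasFDerivAt_comp_torusProj v)
  have hΦ_inj : Function.Injective Φ := hW.injective_add_comp_torusProj hr1 hr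
  have hQ := measurableSet_unitCube (0 : Fin d → ℝ)
  have hΦQ : MeasurableSet (Φ '' unitCube 0) :=
    hQ.image_of_continuousOn_injOn (fun v _ => (hΦ' v).continuousAt.continuousWithinAt)
      hΦ_inj.injOn
  have hW_cont := hW.continuous
  have hg_comp : Measurable fun y => g (y + torusProj (W y)) :=
    hg.comp (by fun_prop : Continuous fun y => y + torusProj (W y)).measurable
  rw [ENNReal.ofReal_inv_of_pos hc, ← ENNReal.div_eq_inv_mul,
    ENNReal.le_div_iff_mul_le (by simp [hc]) (by simp), mul_comm]
  calc ENNReal.ofReal c * ∫⁻ y, g (y + torusProj (W y))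
      = ∫⁻ v in unitCube 0, ENNReal.ofReal c * g (torusProj (Φ v)) := by
        simp only [hΦ, torusProj_add]
        rw [← lintegral_unitCube_torusProj 0 hg_comp]
        exact (lintegral_const_mul _ (hg_comp.comp continuous_torusProj.measurable)).symm
    _ ≤ ∫⁻ v in unitCube 0, ENNReal.ofReal
          |(ContinuousLinearMap.id ℝ (Euc d) + W' (torusProj v)).det| * g (torusProj (Φ v)) := by
        gcongr with v
        exact (hdet _).trans (le_abs_self _)
    _ = ∫⁻ v in Φ '' unitCube 0, g (torusProj v) :=
        (lintegral_image_eq_lintegral_abs_det_fderiv_mul volume hQ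
          (fun v _ => (hΦ' v).hasFDerivWithinAt) hΦ_inj.injOn fun v => g (torusProj v)).symm
    _ ≤ ∫⁻ y, g y :=
        setLIntegral_torusProj_le hΦQ (injOn_torusProj_image_add_comp_torusProj hΦ_inj 0) hg

end Compression

section CompactSpace

variable {X : Type*} [TopologicalSpace X] [CompactSpace X]
  {E F G : Type*} [NormedAddCommGroup E] [NormedAddCommGroup F] [NormedAddCommGroup G]

theorem exists_forall_norm_le_of_continuous {f : X → E} (hf : Continuous f) :
    ∃ C, ∀ x, ‖f x‖ ≤ C := by
  simpa using isCompact_univ.exists_bound_of_continuousOn hf.continuousOn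

variable [MeasurableSpace X] [OpensMeasurableSpace X] {μ : Measure X}

theorem integrable_of_continuous [IsFiniteMeasureOnCompacts μ] {f : X → E}
    (hf : Continuous f) : Integrable f μ :=
  hf.integrable_of_hasCompactSupport (HasCompactSupport.of_compactSpace f)

variable [SecondCountableTopology X] [NormedSpace ℝ E] [NormedSpace ℝ F] [NormedSpace ℝ G]

theorem integrable_bilin_of_continuous_left (B : E →L[ℝ] F →L[ℝ] G) {k : X → E}
    (hk : Continuous k) {f : X → F} (hf : Integrable f μ) :
    Integrable (fun x => B (k x) (f x)) μ := by
  obtain ⟨C, hC⟩ := exists_forall_norm_le_of_continuous hk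
  exact B.integrable_of_bilin_of_bdd_left C hk.aestronglyMeasurable (ae_of_all _ hC) hf

theorem integrable_smul_of_continuous_left {k : X → ℝ} (hk : Continuous k) {f : X → F}
    (hf : Integrable f μ) : Integrable (fun x => k x • f x) μ :=
  integrable_bilin_of_continuous_left (.lsmul ℝ ℝ) hk hf

end CompactSpace

section SmoothFunctions

variable {d : ℕ} {F : Type*} [NormedAddCommGroup F] [NormedSpace ℝ F]

/-- The Fréchet derivative of a function on the torus. -/
noncomputable def torusFDeriv (f : 𝕋 d → F) (y : 𝕋 d) : Euc d →L[ℝ] F :=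
  fderiv ℝ (fun v : Euc d => f (y + torusProj v)) 0

theorem TorusSmooth.torusC1 {φ : 𝕋 d → ℝ} (h : TorusSmooth φ) : TorusC1 φ (torusFDeriv φ) := by
  have hderiv (w : Euc d) : HasFDerivAt (fun v : Euc d => φ (torusProj w + torusProj v))
      (fderiv ℝ (fun v : Euc d => φ (torusProj v)) w) 0 := by
    have hw := ((h.differentiable (by simp)) w).hasFDerivAt
    rw [← add_zero w] at hw
    simpa [Function.comp_def, torusProj_add] using
      HasFDerivAt.comp (f := fun v => w + v) 0 hw ((hasFDerivAt_id 0).const_add w)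
  constructor
  · rw [isOpenQuotientMap_torusProj.isQuotientMap.continuous_iff]
    have hlift : torusFDeriv φ ∘ torusProj = fderiv ℝ (fun v : Euc d => φ (torusProj v)) :=
      funext fun w => (hderiv w).fderiv
    rw [hlift]
    exact h.continuous_fderiv (by simp)
  · intro y
    obtain ⟨w, rfl⟩ := torusProj_surjective y
    exact (hderiv w).differentiableAt.hasFDerivAt

theorem TorusSmooth.comp_sub_left {φ : 𝕋 d → ℝ} (h : TorusSmooth φ) (x : 𝕋 d) :
    TorusSmooth fun y => φ (x - y) := by
  obtain ⟨w, rfl⟩ := torusProj_surjective x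
  simpa only [TorusSmooth, Function.comp_def, torusProj_sub] using
    ContDiff.comp h (contDiff_const.sub contDiff_id : ContDiff ℝ ∞ fun v : Euc d => w - v)

theorem TorusSmooth.torusPartial_comp_sub_left {K : 𝕋 d → ℝ} (hK : TorusSmooth K) (x y : 𝕋 d)
    (j : Fin d) : torusPartial j (fun y => K (x - y)) y =
      -torusFDeriv K (x - y) (EuclideanSpace.single j 1) := by
  have hline := (hK.torusC1.hasDerivAt_add_single j (x - y) (-0)).scomp 0 (hasDerivAt_neg (0 : ℝ))
  have hfun : (fun s : ℝ => K (x - (y + Pi.single j (s : UnitAddCircle)))) =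
      (fun s : ℝ => K (x - y + Pi.single j (s : UnitAddCircle))) ∘ Neg.neg := by
    ext s
    rw [Function.comp_apply, AddCircle.coe_neg, Pi.single_neg, ← sub_eq_add_neg,
      sub_add_eq_sub_sub]
  rw [torusPartial, hfun, hline.deriv]
  simp

end SmoothFunctions

section Mollifier

variable {d : ℕ}

/-- The function `∏ᵢ (1 + cos (2 π yᵢ)) / 2` on the torus, whose strict maximum is at the origin;
its normalized powers concentrate there. -/
noncomputable def cosBump (y : 𝕋 d) : ℝ :=
  ∏ i, (1 + ((AddCircle.toCircle (y i) : Circle) : ℂ).re) / 2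

theorem cosBump_torusProj (v : Euc d) :
    cosBump (torusProj v) = ∏ i, (1 + Real.cos (2 * Real.pi * v i)) / 2 := by
  refine Finset.prod_congr rfl fun i _ => ?_
  rw [torusProj, AddCircle.toCircle_apply_mk, Circle.coe_exp, Complex.exp_ofReal_mul_I_re, div_one]

@[fun_prop]
theorem continuous_cosBump : Continuous (cosBump (d := d)) := by
  have := AddCircle.continuous_toCircle (T := (1 : ℝ))
  unfold cosBump
  fun_prop

@[simp] theorem cosBump_zero : cosBump (0 : 𝕋 d) = 1 := by
  simp [cosBump]

theorem one_add_re_div_two_mem_Icc (z : Circle) : (1 + (z : ℂ).re) / 2 ∈ Icc (0 : ℝ) 1 := by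
  have hz := Complex.abs_re_le_norm (z : ℂ)
  rw [Circle.norm_coe, abs_le] at hz
  constructor <;> linarith [hz.1, hz.2]

theorem one_add_re_div_two_lt_one {z : Circle} (hz : z ≠ 1) : (1 + (z : ℂ).re) / 2 < 1 := by
  refine (one_add_re_div_two_mem_Icc z).2.lt_of_ne fun h => hz ?_
  have hre : (z : ℂ).re = 1 := by linarith
  have him : (z : ℂ).im = 0 := by
    have hnorm := Circle.normSq_coe z
    rw [Complex.normSq_apply, hre] at hnorm
    exact mul_self_eq_zero.1 (by linarith)
  exact Circle.ext (Complex.ext hre him)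

theorem cosBump_nonneg (y : 𝕋 d) : 0 ≤ cosBump y :=
  Finset.prod_nonneg fun _ _ => (one_add_re_div_two_mem_Icc _).1

theorem cosBump_lt_one {y : 𝕋 d} (hy : y ≠ 0) : cosBump y < 1 := by
  obtain ⟨i, hi⟩ := Function.ne_iff.1 hy
  have hcircle : AddCircle.toCircle (y i) ≠ 1 := fun h =>
    hi (AddCircle.injective_toCircle one_ne_zero (h.trans AddCircle.toCircle_zero.symm))
  rw [cosBump, ← Finset.mul_prod_erase _ _ (Finset.mem_univ i)]
  refine (mul_le_of_le_one_right (one_add_re_div_two_mem_Icc _).1 ?_).trans_lt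
    (one_add_re_div_two_lt_one hcircle)
  exact Finset.prod_le_one (fun _ _ => (one_add_re_div_two_mem_Icc _).1)
    fun _ _ => (one_add_re_div_two_mem_Icc _).2

theorem integral_cosBump_pow_pos (N : ℕ) : 0 < ∫ y : 𝕋 d, cosBump y ^ N :=
  (continuous_cosBump.pow N).integral_pos_of_hasCompactSupport_nonneg_nonzero
    (HasCompactSupport.of_compactSpace _) (fun y => pow_nonneg (cosBump_nonneg y) N)
    (x := 0) (by simp)

/-- The mollifiers on the torus: the normalized powers of `cosBump`. -/
noncomputable def mollifier (N : ℕ) (y : 𝕋 d) : ℝ :=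
  (∫ z : 𝕋 d, cosBump z ^ N)⁻¹ * cosBump y ^ N

@[fun_prop]
theorem continuous_mollifier (N : ℕ) : Continuous (mollifier (d := d) N) :=
  continuous_const.mul (continuous_cosBump.pow N)

theorem mollifier_nonneg (N : ℕ) (y : 𝕋 d) : 0 ≤ mollifier N y :=
  mul_nonneg (inv_nonneg.2 (integral_cosBump_pow_pos N).le) (pow_nonneg (cosBump_nonneg y) N)

theorem integral_mollifier (N : ℕ) : ∫ y : 𝕋 d, mollifier N y = 1 := by
  simp only [mollifier]
  rw [integral_const_mul, inv_mul_cancel₀ (integral_cosBump_pow_pos N).ne']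

theorem torusSmooth_mollifier (N : ℕ) : TorusSmooth (mollifier (d := d) N) := by
  unfold TorusSmooth mollifier
  simp only [cosBump_torusProj]
  fun_prop

theorem tendsto_integral_mollifier_mul {g : 𝕋 d → ℝ} (hg : Continuous g) :
    Tendsto (fun N => ∫ y, mollifier N y * g y) atTop (𝓝 (g 0)) := by
  have hpeak := tendsto_setIntegral_pow_smul_of_unique_maximum_of_isCompact_of_continuousOn
    (μ := (volume : Measure (𝕋 d))) (s := univ) (x₀ := 0) (g := g) isCompact_univ
    continuous_cosBump.continuousOn (fun y _ hy => by simpa using cosBump_lt_one hy)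
    (fun y _ => cosBump_nonneg y) (by simp) (by simp) hg.continuousOn
  refine hpeak.congr fun N => ?_
  simp only [Measure.restrict_univ, smul_eq_mul, mollifier, mul_assoc, integral_const_mul]

end Mollifier

section Convolution

variable {d : ℕ} {F : Type*} [NormedAddCommGroup F] [NormedSpace ℝ F] {K : 𝕋 d → ℝ} {f : 𝕋 d → F}

/-- The convolution `K * f` on the torus. -/
noncomputable def torusConv (K : 𝕋 d → ℝ) (f : 𝕋 d → F) (x : 𝕋 d) : F := ∫ y, K (x - y) • f y

/-- The convolution `∇K * f` on the torus, which is the derivative of `K * f`. -/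
noncomputable def torusConvDeriv (K : 𝕋 d → ℝ) (f : 𝕋 d → F) (x : 𝕋 d) : Euc d →L[ℝ] F :=
  ∫ y, (torusFDeriv K (x - y)).smulRight (f y)

theorem integrable_comp_sub_left_smul (hK : Continuous K) (hf : Integrable f) (x : 𝕋 d) :
    Integrable fun y => K (x - y) • f y :=
  integrable_smul_of_continuous_left (by fun_prop) hf

theorem integrable_torusFDeriv_smulRight (hK : Continuous (torusFDeriv K)) (hf : Integrable f)
    (x : 𝕋 d) : Integrable fun y => (torusFDeriv K (x - y)).smulRight (f y) :=
  integrable_bilin_of_continuous_left (ContinuousLinearMap.smulRightL ℝ (Euc d) F)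
    (by fun_prop) hf

theorem norm_torusConv_le {C : ℝ} (hC : ∀ y, ‖K y‖ ≤ C) (hf : Integrable f) (x : 𝕋 d) :
    ‖torusConv K f x‖ ≤ C * ∫ y, ‖f y‖ := by
  rw [← integral_const_mul]
  refine norm_integral_le_of_norm_le (hf.norm.const_mul C) (ae_of_all _ fun y => ?_)
  rw [norm_smul]
  exact mul_le_mul_of_nonneg_right (hC _) (norm_nonneg _)

theorem torusC1_torusConv (hK : TorusC1 K (torusFDeriv K)) (hf : Integrable f) :
    TorusC1 (torusConv K f) (torusConvDeriv K f) := by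
  have hK_cont := hK.continuous
  have hK'_cont := hK.continuous_deriv
  obtain ⟨C, hC⟩ := exists_forall_norm_le_of_continuous hK.continuous_deriv
  have hbound (z y) : ‖(torusFDeriv K z).smulRight (f y)‖ ≤ C * ‖f y‖ := by
    rw [ContinuousLinearMap.norm_smulRight_apply]
    exact mul_le_mul_of_nonneg_right (hC _) (norm_nonneg _)
  constructor
  · refine continuous_of_dominated (F := fun x y => (torusFDeriv K (x - y)).smulRight (f y))
      (fun x => (integrable_torusFDeriv_smulRight hK'_cont hf x).1)
      (fun x => ae_of_all _ fun y => hbound _ y) (hf.norm.const_mul C) (ae_of_all _ fun y => ?_)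
    exact ((ContinuousLinearMap.smulRightL ℝ (Euc d) F).flip (f y)).continuous.comp
      (by fun_prop : Continuous fun x => torusFDeriv K (x - y))
  · intro x
    have hderiv := hasFDerivAt_integral_of_dominated_of_fderiv_le (𝕜 := ℝ) (μ := volume)
      (F := fun (v : Euc d) y => K (x + torusProj v - y) • f y)
      (F' := fun (v : Euc d) y => (torusFDeriv K (x + torusProj v - y)).smulRight (f y))
      (x₀ := 0) (bound := fun y => C * ‖f y‖) (s := univ) univ_mem
      (Eventually.of_forall fun v => (integrable_comp_sub_left_smul hK_cont hf _).1)
      (integrable_comp_sub_left_smul hK_cont hf _)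
      (integrable_torusFDeriv_smulRight hK'_cont hf _).1
      (ae_of_all _ fun y v _ => hbound _ y) (hf.norm.const_mul C)
      (ae_of_all _ fun y v _ => by
        simpa only [sub_add_eq_add_sub] using (hK.hasFDerivAt (x - y) v).smul_const (f y))
    simpa [torusConv, torusConvDeriv] using hderiv

theorem torusConvDeriv_apply (hK : Continuous (torusFDeriv K)) (hf : Integrable f) (x : 𝕋 d)
    (e : Euc d) : torusConvDeriv K f x e = ∫ y, torusFDeriv K (x - y) e • f y := by
  rw [torusConvDeriv, ContinuousLinearMap.integral_apply (integrable_torusFDeriv_smulRight hK hf x)]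
  simp

end Convolution

section WeakGradient

variable {d : ℕ}

theorem integral_apply_of_integrable {α : Type*} [MeasurableSpace α] {μ : Measure α}
    {f : α → Euc d} (hf : Integrable f μ) (i : Fin d) : (∫ y, f y ∂μ) i = ∫ y, f y i ∂μ := by
  simpa using ((EuclideanSpace.proj i : Euc d →L[ℝ] ℝ).integral_comp_comm hf).symm

variable {f : 𝕋 d → Euc d} {G : 𝕋 d → Matrix (Fin d) (Fin d) ℝ}

theorem IsWeakGradient.integrable (h : IsWeakGradient f G) : Integrable f :=
  Integrable.of_eval_piLp fun i => (h i i).1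

theorem IsWeakGradient.torusConvDeriv_single_apply (h : IsWeakGradient f G) {K : 𝕋 d → ℝ}
    (hK : TorusSmooth K) (x : 𝕋 d) (i j : Fin d) :
    torusConvDeriv K f x (EuclideanSpace.single j 1) i = torusConv K (fun y => G y i j) x := by
  have hK'_cont := hK.torusC1.continuous_deriv
  have hparts := (h i j).2.2 _ (hK.comp_sub_left x)
  simp only [hK.torusPartial_comp_sub_left, mul_neg, integral_neg, neg_inj] at hparts
  rw [torusConvDeriv_apply hK'_cont h.integrable, integral_apply_of_integrable
    (integrable_smul_of_continuous_left (by fun_prop) h.integrable)]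
  simpa [torusConv, mul_comm] using hparts

end WeakGradient

/-! ### Bounds on mollified fields -/

section Jensen

theorem exp_integral_mul_le {α : Type*} [MeasurableSpace α] {μ : Measure α} {k g : α → ℝ}
    (hk_nonneg : ∀ y, 0 ≤ k y) (hk : Integrable k μ) (hk_one : ∫ y, k y ∂μ = 1)
    (hkg : Integrable (fun y => k y * g y) μ)
    (hkexp : Integrable (fun y => k y * Real.exp (g y)) μ) :
    Real.exp (∫ y, k y * g y ∂μ) ≤ ∫ y, k y * Real.exp (g y) ∂μ := by
  set m := ∫ y, k y * g y ∂μ with hm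
  -- The tangent line of `exp` at `m` lies below the graph and integrates to `exp m`.
  have htangent (y) : Real.exp m * ((1 - m) * k y + k y * g y) ≤ k y * Real.exp (g y) := by
    have hexp : Real.exp m * (g y - m + 1) ≤ Real.exp (g y) := by
      simpa [← Real.exp_add] using
        mul_le_mul_of_nonneg_left (Real.add_one_le_exp (g y - m)) (Real.exp_pos m).le
    linarith [mul_le_mul_of_nonneg_left hexp (hk_nonneg y)]
  calc Real.exp m = ∫ y, Real.exp m * ((1 - m) * k y + k y * g y) ∂μ := by
        rw [integral_const_mul, integral_add (hk.const_mul _) hkg, integral_const_mul, hk_one,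
          ← hm]
        ring
    _ ≤ ∫ y, k y * Real.exp (g y) ∂μ :=
        integral_mono (((hk.const_mul _).add hkg).const_mul _) hkexp htangent

theorem exp_sum_range_le_average {n : ℕ} (hn : 0 < n) (a : ℕ → ℝ) :
    Real.exp (∑ k ∈ Finset.range n, a k) ≤
      ∑ k ∈ Finset.range n, (n : ℝ)⁻¹ * Real.exp (n * a k) := by
  have hn' : (n : ℝ) ≠ 0 := by positivity
  have h := convexOn_exp.map_sum_le (t := Finset.range n) (w := fun _ => (n : ℝ)⁻¹)
    (p := fun k => n * a k) (fun _ _ => by positivity) (by simp [hn']) (fun _ _ => mem_univ _)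
  simpa [hn'] using h

end Jensen

section Density

variable {d : ℕ} {K : 𝕋 d → ℝ}

/-- `K` is a continuous probability density on the torus, used as a convolution kernel. -/
structure TorusDensity (K : 𝕋 d → ℝ) : Prop where
  continuous : Continuous K
  nonneg (y : 𝕋 d) : 0 ≤ K y
  integral_eq_one : ∫ y, K y = 1

theorem torusDensity_mollifier (N : ℕ) : TorusDensity (mollifier (d := d) N) where
  continuous := continuous_mollifier N
  nonneg := mollifier_nonneg N
  integral_eq_one := integral_mollifier N

theorem TorusDensity.comp_sub_left (hK : TorusDensity K) (x : 𝕋 d) :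
    TorusDensity fun y => K (x - y) where
  continuous := hK.continuous.comp (continuous_const.sub continuous_id)
  nonneg _ := hK.nonneg _
  integral_eq_one := by rw [integral_sub_left_eq_self K volume x, hK.integral_eq_one]

theorem TorusDensity.norm_torusConv_le {F : Type*} [NormedAddCommGroup F] [NormedSpace ℝ F]
    (hK : TorusDensity K) {f : 𝕋 d → F} {g : 𝕋 d → ℝ} (hg : Integrable g)
    (hfg : ∀ᵐ y, ‖f y‖ ≤ g y) (x : 𝕋 d) : ‖torusConv K f x‖ ≤ torusConv K g x := by
  refine norm_integral_le_of_norm_le (integrable_comp_sub_left_smul hK.continuous hg x) ?_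
  filter_upwards [hfg] with y hy
  rw [norm_smul, Real.norm_of_nonneg (hK.nonneg _)]
  exact mul_le_mul_of_nonneg_left hy (hK.nonneg _)

theorem TorusDensity.torusConv_const {F : Type*} [NormedAddCommGroup F] [NormedSpace ℝ F]
    [CompleteSpace F] (hK : TorusDensity K) (c : F) (x : 𝕋 d) :
    torusConv K (fun _ => c) x = c := by
  rw [torusConv, integral_smul_const, (hK.comp_sub_left x).integral_eq_one, one_smul]

theorem TorusDensity.exp_torusConv_le (hK : TorusDensity K) {g : 𝕋 d → ℝ} (hg : Integrable g)
    (hexp : Integrable fun y => Real.exp (g y)) (x : 𝕋 d) :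
    Real.exp (torusConv K g x) ≤ torusConv K (fun y => Real.exp (g y)) x :=
  exp_integral_mul_le (hK.comp_sub_left x).nonneg
    (integrable_of_continuous (hK.comp_sub_left x).continuous)
    (hK.comp_sub_left x).integral_eq_one
    (integrable_comp_sub_left_smul hK.continuous hg x)
    (integrable_comp_sub_left_smul hK.continuous hexp x)

theorem TorusDensity.lintegral_torusConv (hK : TorusDensity K) {g : 𝕋 d → ℝ}
    (hg_nonneg : ∀ y, 0 ≤ g y) (hg : Integrable g) :
    ∫⁻ x, ENNReal.ofReal (torusConv K g x) = ∫⁻ y, ENNReal.ofReal (g y) := by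
  have hK_cont := hK.continuous
  calc ∫⁻ x, ENNReal.ofReal (torusConv K g x)
      = ∫⁻ x, ∫⁻ y, ENNReal.ofReal (K (x - y)) * ENNReal.ofReal (g y) := by
        refine lintegral_congr fun x => ?_
        rw [torusConv, ofReal_integral_eq_lintegral_ofReal
          (integrable_comp_sub_left_smul hK_cont hg x)
          (ae_of_all _ fun y => smul_nonneg (hK.nonneg _) (hg_nonneg y))]
        exact lintegral_congr fun y => ENNReal.ofReal_mul (hK.nonneg _)
    _ = ∫⁻ y, ∫⁻ x, ENNReal.ofReal (K (x - y)) * ENNReal.ofReal (g y) :=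
        lintegral_lintegral_swap
          ((by fun_prop : Continuous fun p : 𝕋 d × 𝕋 d => K (p.1 - p.2)).measurable
            |>.ennreal_ofReal.aemeasurable.mul hg.1.aemeasurable.comp_snd.ennreal_ofReal)
    _ = ∫⁻ y, ENNReal.ofReal (g y) := by
        refine lintegral_congr fun y => ?_
        rw [lintegral_mul_const _ (by fun_prop),
          lintegral_sub_right_eq_self (fun x => ENNReal.ofReal (K x)),
          ← ofReal_integral_eq_lintegral_ofReal (integrable_of_continuous hK_cont)
            (ae_of_all _ hK.nonneg), hK.integral_eq_one, ENNReal.ofReal_one, one_mul]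

end Density

section MatrixAbs

variable {d : ℕ}

theorem matrixAbs_nonneg (A : Matrix (Fin d) (Fin d) ℝ) : 0 ≤ matrixAbs A := Real.sqrt_nonneg _

theorem matrixAbs_neg (A : Matrix (Fin d) (Fin d) ℝ) : matrixAbs (-A) = matrixAbs A := by
  simp [matrixAbs]

theorem abs_apply_le_matrixAbs (A : Matrix (Fin d) (Fin d) ℝ) (i j : Fin d) :
    |A i j| ≤ matrixAbs A := by
  refine Real.abs_le_sqrt ?_
  calc A i j ^ 2 ≤ ∑ j, A i j ^ 2 :=
        Finset.single_le_sum (f := fun j => A i j ^ 2) (fun _ _ => sq_nonneg _) (Finset.mem_univ j)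
    _ ≤ ∑ i, ∑ j, A i j ^ 2 := Finset.single_le_sum (f := fun i => ∑ j, A i j ^ 2)
        (fun _ _ => Finset.sum_nonneg fun _ _ => sq_nonneg _) (Finset.mem_univ i)

theorem matrixAbs_le_sum_abs (A : Matrix (Fin d) (Fin d) ℝ) :
    matrixAbs A ≤ ∑ i, ∑ j, |A i j| := by
  have hrow_nonneg (i) : 0 ≤ ∑ j, |A i j| := Finset.sum_nonneg fun _ _ => abs_nonneg _
  refine Real.sqrt_le_iff.2 ⟨Finset.sum_nonneg fun i _ => hrow_nonneg i, ?_⟩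
  have hrow (i) : ∑ j, A i j ^ 2 ≤ (∑ j, |A i j|) ^ 2 := by
    simpa using Finset.sum_sq_le_sq_sum_of_nonneg (s := Finset.univ) (f := fun j => |A i j|)
      (fun _ _ => abs_nonneg _)
  exact (Finset.sum_le_sum fun i _ => hrow i).trans
    (Finset.sum_sq_le_sq_sum_of_nonneg fun i _ => hrow_nonneg i)

theorem IsWeakGradient.integrable_matrixAbs {f : 𝕋 d → Euc d}
    {G : 𝕋 d → Matrix (Fin d) (Fin d) ℝ} (h : IsWeakGradient f G) :
    Integrable fun y => matrixAbs (G y) := by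
  have hsum : Integrable fun y => ∑ i, ∑ j, |G y i j| :=
    integrable_finsetSum _ fun i _ => integrable_finsetSum _ fun j _ => (h i j).2.1.abs
  refine hsum.mono' ?_ (ae_of_all _ fun y => ?_)
  · exact (Real.continuous_sqrt.measurable.comp_aemeasurable <|
      Finset.aemeasurable_fun_sum _ fun i _ => Finset.aemeasurable_fun_sum _ fun j _ =>
        (h i j).2.1.aemeasurable.pow_const 2).aestronglyMeasurable
  · rw [Real.norm_of_nonneg (matrixAbs_nonneg _)]
    exact matrixAbs_le_sum_abs _

theorem opNorm_le_of_abs_single_apply_le {A : Euc d →L[ℝ] Euc d} {m : ℝ}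
    (hm : ∀ i j, |A (EuclideanSpace.single j 1) i| ≤ m) : ‖A‖ ≤ (d : ℝ) ^ 2 * m := by
  rcases Nat.eq_zero_or_pos d with rfl | hd
  · simp [Subsingleton.elim A 0]
  have hm_nonneg : 0 ≤ m := (abs_nonneg _).trans (hm ⟨0, hd⟩ ⟨0, hd⟩)
  have hcol (j) : ‖A (EuclideanSpace.single j 1)‖ ≤ d * m :=
    (norm_le_sum_abs _).trans ((Finset.sum_le_sum fun i _ => hm i j).trans (by simp))
  refine A.opNorm_le_bound (by positivity) fun v => ?_
  have hv : A v = ∑ j, v j • A (EuclideanSpace.single j 1) := by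
    conv_lhs => rw [← (EuclideanSpace.basisFun (Fin d) ℝ).sum_repr v]
    simp
  calc ‖A v‖ ≤ ∑ j, ‖v j • A (EuclideanSpace.single j 1)‖ := hv ▸ norm_sum_le _ _
    _ ≤ ∑ _j : Fin d, ‖v‖ * (d * m) := by
        refine Finset.sum_le_sum fun j _ => ?_
        rw [norm_smul]
        exact mul_le_mul (PiLp.norm_apply_le v j) (hcol j) (norm_nonneg _) (norm_nonneg _)
    _ = d ^ 2 * m * ‖v‖ := by simp; ring

end MatrixAbs

section MollifiedGradient

variable {d : ℕ} {K : 𝕋 d → ℝ} {f : 𝕋 d → Euc d} {G : 𝕋 d → Matrix (Fin d) (Fin d) ℝ}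

theorem IsWeakGradient.norm_torusConvDeriv_le (h : IsWeakGradient f G) (hK : TorusDensity K)
    (hK_smooth : TorusSmooth K) (x : 𝕋 d) :
    ‖torusConvDeriv K f x‖ ≤ (d : ℝ) ^ 2 * torusConv K (fun y => matrixAbs (G y)) x := by
  refine opNorm_le_of_abs_single_apply_le fun i j => ?_
  rw [h.torusConvDeriv_single_apply hK_smooth]
  exact hK.norm_torusConv_le (f := fun y => G y i j) h.integrable_matrixAbs
    (ae_of_all _ fun y => abs_apply_le_matrixAbs _ i j) x

theorem integrable_of_lintegral_ofReal_ne_top {α : Type*} [MeasurableSpace α] {μ : Measure α}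
    {g : α → ℝ} (hg_nonneg : ∀ y, 0 ≤ g y) (hg : AEStronglyMeasurable g μ)
    (hfin : ∫⁻ y, ENNReal.ofReal (g y) ∂μ ≠ ⊤) : Integrable g μ :=
  ⟨hg, (hasFiniteIntegral_iff_ofReal (ae_of_all _ hg_nonneg)).2 hfin.lt_top⟩

theorem IsWeakGradient.lintegral_exp_norm_torusConvDeriv_le (h : IsWeakGradient f G)
    (hK : TorusDensity K) (hK_smooth : TorusSmooth K) {β : ℝ} (hβ : 0 ≤ β)
    (hfin : ∫⁻ y, ENNReal.ofReal (Real.exp (β * (d : ℝ) ^ 2 * matrixAbs (G y))) ≠ ⊤) :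
    ∫⁻ x, ENNReal.ofReal (Real.exp (β * ‖torusConvDeriv K f x‖)) ≤
      ∫⁻ y, ENNReal.ofReal (Real.exp (β * (d : ℝ) ^ 2 * matrixAbs (G y))) := by
  have hg := h.integrable_matrixAbs.const_mul (β * (d : ℝ) ^ 2)
  have hexp := integrable_of_lintegral_ofReal_ne_top (fun _ => (Real.exp_pos _).le)
    (Real.continuous_exp.comp_aestronglyMeasurable hg.1) hfin
  rw [← hK.lintegral_torusConv (fun _ => (Real.exp_pos _).le) hexp]
  refine lintegral_mono fun x => ENNReal.ofReal_le_ofReal ?_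
  refine (Real.exp_le_exp.2 ?_).trans (hK.exp_torusConv_le hg hexp x)
  calc β * ‖torusConvDeriv K f x‖
      ≤ β * ((d : ℝ) ^ 2 * torusConv K (fun y => matrixAbs (G y)) x) :=
        mul_le_mul_of_nonneg_left (h.norm_torusConvDeriv_le hK hK_smooth x) hβ
    _ = torusConv K (fun y => β * (d : ℝ) ^ 2 * matrixAbs (G y)) x := by
        simp only [torusConv, smul_eq_mul, ← integral_const_mul]
        congr 1 with y
        ring

theorem trace_eq_sum_single_apply (A : Euc d →L[ℝ] Euc d) :
    LinearMap.trace ℝ (Euc d) A = ∑ i, A (EuclideanSpace.single i 1) i := by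
  rw [LinearMap.trace_eq_matrix_trace ℝ (EuclideanSpace.basisFun (Fin d) ℝ).toBasis]
  simp [Matrix.trace, LinearMap.toMatrix_apply]

theorem IsWeakGradient.trace_torusConvDeriv (h : IsWeakGradient f G) (hK : TorusSmooth K)
    (x : 𝕋 d) :
    LinearMap.trace ℝ (Euc d) (torusConvDeriv K f x) = torusConv K (fun y => (G y).trace) x := by
  simp only [trace_eq_sum_single_apply, h.torusConvDeriv_single_apply hK, torusConv,
    Matrix.trace, Matrix.diag_apply, Finset.smul_sum]
  rw [integral_finsetSum _ fun i _ =>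
    integrable_comp_sub_left_smul hK.torusC1.continuous (h i i).2.1 x]

theorem IsWeakGradient.abs_trace_torusConvDeriv_le (h : IsWeakGradient f G)
    (hK : TorusDensity K) (hK_smooth : TorusSmooth K) {L : ℝ} (hL : ∀ᵐ y, |(G y).trace| ≤ L)
    (x : 𝕋 d) : |LinearMap.trace ℝ (Euc d) (torusConvDeriv K f x)| ≤ L := by
  rw [h.trace_torusConvDeriv hK_smooth, ← hK.torusConv_const L x]
  exact hK.norm_torusConv_le (f := fun y => (G y).trace) (integrable_const L) hL x

end MollifiedGradient

section Determinant

variable {E : Type*} [NormedAddCommGroup E] [NormedSpace ℝ E] [FiniteDimensional ℝ E]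

theorem det_id_add_eq (A : E →L[ℝ] E) : (ContinuousLinearMap.id ℝ E + A).det =
    (1 + LinearMap.toMatrix (Module.finBasis ℝ E) (Module.finBasis ℝ E) A).det := by
  rw [ContinuousLinearMap.det, ← LinearMap.det_toMatrix (Module.finBasis ℝ E)]
  simp

theorem differentiable_det_id_add :
    Differentiable ℝ fun A : E →L[ℝ] E => (ContinuousLinearMap.id ℝ E + A).det := by
  have hentry (i j) : Differentiable ℝ fun A : E →L[ℝ] E =>
      LinearMap.toMatrix (Module.finBasis ℝ E) (Module.finBasis ℝ E) A i j := by
    simp only [LinearMap.toMatrix_apply]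
    exact ((Module.finBasis ℝ E).coord i).toContinuousLinearMap.differentiable.comp
      (by fun_prop : Differentiable ℝ fun A : E →L[ℝ] E => A (Module.finBasis ℝ E j))
  simp only [det_id_add_eq, Matrix.det_apply', Matrix.add_apply]
  fun_prop

theorem hasDerivAt_det_id_add_smul (A : E →L[ℝ] E) :
    HasDerivAt (fun r : ℝ => (ContinuousLinearMap.id ℝ E + r • A).det)
      (LinearMap.trace ℝ E A) 0 := by
  set M := LinearMap.toMatrix (Module.finBasis ℝ E) (Module.finBasis ℝ E) A with hM
  set p : Polynomial ℝ :=
    (1 + (Polynomial.X : Polynomial ℝ) • M.map ⇑Polynomial.C).det.divX.divX with hp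
  have hexpand (r : ℝ) : (ContinuousLinearMap.id ℝ E + r • A).det =
      1 + M.trace * r + p.eval r * r ^ 2 := by
    rw [det_id_add_eq, hp, ← Matrix.det_one_add_smul, hM]
    simp
  rw [LinearMap.trace_eq_matrix_trace ℝ (Module.finBasis ℝ E), ← hM, funext hexpand]
  simpa using! (((hasDerivAt_id (0 : ℝ)).const_mul M.trace).const_add 1).add
    ((p.hasDerivAt 0).mul ((hasDerivAt_id (0 : ℝ)).pow 2))

theorem fderiv_det_id_add_zero (A : E →L[ℝ] E) :
    fderiv ℝ (fun A : E →L[ℝ] E => (ContinuousLinearMap.id ℝ E + A).det) 0 A =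
      LinearMap.trace ℝ E A := by
  have hline := (differentiable_det_id_add (E := E) ((0 : ℝ) • A)).hasFDerivAt.comp_hasDerivAt 0
    ((hasDerivAt_id (0 : ℝ)).smul_const A)
  simpa using! hline.unique (hasDerivAt_det_id_add_smul A)

theorem exists_one_add_trace_sub_le_det_id_add {ε : ℝ} (hε : 0 < ε) :
    ∃ δ > 0, ∀ A : E →L[ℝ] E, ‖A‖ ≤ δ →
      1 + LinearMap.trace ℝ E A - ε * ‖A‖ ≤ (ContinuousLinearMap.id ℝ E + A).det := by
  have hlittleO := (differentiable_det_id_add (E := E) 0).hasFDerivAt.isLittleO.def hε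
  obtain ⟨δ, hδ, hball⟩ := Metric.eventually_nhds_iff_ball.1 hlittleO
  refine ⟨δ / 2, by positivity, fun A hA => ?_⟩
  have hA' := hball A (by rw [mem_ball_zero_iff]; linarith)
  simp only [sub_zero, fderiv_det_id_add_zero, Real.norm_eq_abs, add_zero] at hA'
  have hid : (ContinuousLinearMap.id ℝ E).det = 1 := by simp [ContinuousLinearMap.det]
  linarith [(abs_le.1 hA').1]

end Determinant

/-! ### The log-Lipschitz modulus of continuity -/

section Modulus

open scoped Pointwise

variable {d : ℕ} {F : Type*} [NormedAddCommGroup F] [NormedSpace ℝ F]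

/-- `f` has modulus of continuity `r ↦ A r + ε`. -/
def HasAffineModulus (A ε : ℝ) (f : 𝕋 d → F) : Prop :=
  ∀ x w, ‖f (x + torusProj w) - f x‖ ≤ A * ‖w‖ + ε

theorem TorusC1.norm_sub_comp_le [CompleteSpace F] {f : 𝕋 d → F} {f' : 𝕋 d → Euc d →L[ℝ] F}
    (hf : TorusC1 f f') (x : 𝕋 d) (z : Euc d) : ‖f x - f (x + torusProj z)‖ ≤
      ‖z‖ * ∫ s in Ioc (0 : ℝ) 1, ‖f' (x + torusProj (s • z))‖ := by
  have hf'_cont := hf.continuous_deriv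
  have hderiv (s : ℝ) : HasDerivAt (fun s : ℝ => f (x + torusProj (s • z)))
      (f' (x + torusProj (s • z)) z) s := by
    simpa using! (hf.hasFDerivAt x (s • z)).comp_hasDerivAt s ((hasDerivAt_id s).smul_const z)
  have hftc := intervalIntegral.integral_eq_sub_of_hasDerivAt (a := 0) (b := 1)
    (fun s _ => hderiv s) (Continuous.intervalIntegrable (by fun_prop) _ _)
  simp only [one_smul, zero_smul, torusProj_zero, add_zero] at hftc
  rw [norm_sub_rev, ← hftc, ← integral_const_mul, intervalIntegral.integral_of_le zero_le_one]
  refine norm_integral_le_of_norm_le ?_ (ae_of_all _ fun s => ?_)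
  · exact (by fun_prop :
      Continuous fun s : ℝ => ‖z‖ * ‖f' (x + torusProj (s • z))‖).integrableOn_Ioc
  · rw [mul_comm]
    exact ContinuousLinearMap.le_opNorm _ _

theorem le_add_inv_mul_exp {β : ℝ} (hβ : 0 < β) (a g : ℝ) :
    g ≤ a + β⁻¹ * (Real.exp (-(β * a)) * Real.exp (β * g)) := by
  have hexp := Real.add_one_le_exp (-(β * a) + β * g)
  have hdiff : g - a ≤ β⁻¹ * Real.exp (-(β * a) + β * g) := by
    rw [le_inv_mul_iff₀ hβ]
    linarith
  rw [← Real.exp_add]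
  linarith

theorem injOn_torusProj_smul {Q : Set (Euc d)} (hQ : ∀ v ∈ Q, ∀ w ∈ Q, ∀ i, |v i - w i| < 1)
    {s : ℝ} (hs : s ∈ Ioc (0 : ℝ) 1) : InjOn torusProj (s • Q) := by
  refine injOn_torusProj_of_abs_sub_lt ?_
  rintro _ ⟨v, hv, rfl⟩ _ ⟨w, hw, rfl⟩ i
  simp only [PiLp.smul_apply, smul_eq_mul]
  rw [← mul_sub, abs_mul, abs_of_pos hs.1]
  exact (mul_le_of_le_one_left (abs_nonneg _) hs.2).trans_lt (hQ v hv w hw i)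

theorem setIntegral_torusProj_smul_le {g : 𝕋 d → ℝ} (hg : Continuous g) (hg_nonneg : ∀ y, 0 ≤ g y)
    {Q : Set (Euc d)} (hQm : MeasurableSet Q) (hQ : ∀ v ∈ Q, ∀ w ∈ Q, ∀ i, |v i - w i| < 1)
    {s : ℝ} (hs : s ∈ Ioc (0 : ℝ) 1) (x : 𝕋 d) :
    ∫ z in Q, g (x + torusProj (s • z)) ≤ (s ^ d)⁻¹ * ∫ y, g y := by
  rw [Measure.setIntegral_comp_smul_of_pos volume (fun z => g (x + torusProj z)) Q hs.1,
    finrank_euclideanSpace, Fintype.card_fin, smul_eq_mul]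
  refine mul_le_mul_of_nonneg_left ?_ (inv_nonneg.2 (pow_nonneg hs.1.le _))
  rw [← integral_add_left_eq_self g x,
    integral_eq_lintegral_of_nonneg_ae (ae_of_all _ fun z => hg_nonneg _) (by fun_prop),
    integral_eq_lintegral_of_nonneg_ae (ae_of_all _ fun y => hg_nonneg _) (by fun_prop)]
  refine ENNReal.toReal_mono ?_ (setLIntegral_torusProj_le (hQm.const_smul_of_ne_zero hs.1.ne')
    (injOn_torusProj_smul hQ hs) (g := fun y => ENNReal.ofReal (g (x + y))) (by fun_prop))
  exact (integrable_of_continuous (f := fun y => g (x + y)) (by fun_prop)).lintegral_lt_top.ne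

theorem integrable_restrict_of_continuous_comp {α : Type*} [TopologicalSpace α]
    [MeasurableSpace α] [OpensMeasurableSpace α] [SecondCountableTopology α] {μ : Measure α}
    [IsFiniteMeasure μ] {X E : Type*} [TopologicalSpace X] [CompactSpace X]
    [NormedAddCommGroup E] {g : X → E} (hg : Continuous g) {p : α → X} (hp : Continuous p) :
    Integrable (fun a => g (p a)) μ := by
  obtain ⟨C, hC⟩ := exists_forall_norm_le_of_continuous hg
  exact .of_bound (hg.comp hp).aestronglyMeasurable C (ae_of_all _ fun a => hC _)

variable {f : 𝕋 d → F} {f' : 𝕋 d → Euc d →L[ℝ] F} {β C : ℝ} {Q : Set (Euc d)}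

theorem setIntegral_norm_torusProj_smul_le (hf' : Continuous f') (hβ : 0 < β)
    (hC : ∫ y, Real.exp (β * ‖f' y‖) ≤ C) (hQm : MeasurableSet Q)
    (hQ : ∀ v ∈ Q, ∀ w ∈ Q, ∀ i, |v i - w i| < 1) (hV : 0 < volume.real Q) {s : ℝ}
    (hs : s ∈ Ioc (0 : ℝ) 1) (x : 𝕋 d) : ∫ z in Q, ‖f' (x + torusProj (s • z))‖ ≤
      volume.real Q / β * (C - Real.log (volume.real Q) - d * Real.log s) := by
  set V := volume.real Q
  have : IsFiniteMeasure (volume.restrict Q) :=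
    ⟨by simpa using (ENNReal.toReal_pos_iff.1 hV).2⟩
  have hs_pow : 0 < s ^ d := pow_pos hs.1 d
  -- The value of `a` in `le_add_inv_mul_exp` that balances the volumes of `Q` and `s • Q`.
  set a := -(Real.log V + d * Real.log s) / β with ha
  have hexp_a : Real.exp (-(β * a)) = V * s ^ d := by
    rw [ha, mul_div_cancel₀ _ hβ.ne', neg_neg, Real.exp_add, Real.exp_log hV, Real.exp_nat_mul,
      Real.exp_log hs.1]
  have hint : Integrable (fun z => Real.exp (β * ‖f' (x + torusProj (s • z))‖))
      (volume.restrict Q) :=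
    integrable_restrict_of_continuous_comp (g := fun y => Real.exp (β * ‖f' y‖)) (by fun_prop)
      (by fun_prop : Continuous fun z : Euc d => x + torusProj (s • z))
  calc ∫ z in Q, ‖f' (x + torusProj (s • z))‖
      ≤ ∫ z in Q, (a + β⁻¹ * (Real.exp (-(β * a)) *
          Real.exp (β * ‖f' (x + torusProj (s • z))‖))) :=
        integral_mono (integrable_restrict_of_continuous_comp (g := fun y => ‖f' y‖)
            (by fun_prop) (by fun_prop : Continuous fun z : Euc d => x + torusProj (s • z)))
          ((integrable_const a).add ((hint.const_mul _).const_mul _))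
          fun z => le_add_inv_mul_exp hβ a _
    _ = V * a + β⁻¹ * (V * s ^ d * ∫ z in Q, Real.exp (β * ‖f' (x + torusProj (s • z))‖)) := by
        rw [integral_add (integrable_const a) ((hint.const_mul _).const_mul _),
          integral_const_mul, integral_const_mul, setIntegral_const, hexp_a, smul_eq_mul]
    _ ≤ V * a + β⁻¹ * (V * s ^ d * ((s ^ d)⁻¹ * C)) := by
        gcongr
        exact (setIntegral_torusProj_smul_le (g := fun y => Real.exp (β * ‖f' y‖)) (by fun_prop)
          (fun y => (Real.exp_pos _).le) hQm hQ hs x).trans (by gcongr)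
    _ = V / β * (C - Real.log V - d * Real.log s) := by
        rw [ha]
        field_simp
        ring

theorem integrableOn_sub_mul_log (a c : ℝ) :
    IntegrableOn (fun s => a - c * Real.log s) (Ioc (0 : ℝ) 1) :=
  (integrable_const a).sub (((intervalIntegrable_iff_integrableOn_Ioc_of_le zero_le_one).1
    intervalIntegral.intervalIntegrable_log').const_mul c)

theorem integral_sub_mul_log (a c : ℝ) :
    ∫ s in Ioc (0 : ℝ) 1, (a - c * Real.log s) = a + c := by
  rw [← intervalIntegral.integral_of_le zero_le_one, intervalIntegral.integral_sub (by simp)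
    (intervalIntegral.intervalIntegrable_log'.const_mul c), intervalIntegral.integral_const_mul,
    integral_log]
  simp

theorem TorusC1.norm_sub_setAverage_le [CompleteSpace F] (hf : TorusC1 f f') (hβ : 0 < β)
    (hC : ∫ y, Real.exp (β * ‖f' y‖) ≤ C) (hQm : MeasurableSet Q)
    (hQ : ∀ v ∈ Q, ∀ w ∈ Q, ∀ i, |v i - w i| < 1) {R : ℝ} (hQR : ∀ z ∈ Q, ‖z‖ ≤ R)
    (hV : 0 < volume.real Q) (x : 𝕋 d) : ‖f x - ⨍ z in Q, f (x + torusProj z)‖ ≤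
      R * ((d + C - Real.log (volume.real Q)) / β) := by
  have hf_cont := hf.continuous
  have hf'_cont := hf.continuous_deriv
  have hR : 0 ≤ R := by
    obtain ⟨z, hz⟩ := nonempty_of_measure_ne_zero (ENNReal.toReal_pos_iff.1 hV).1.ne'
    exact (norm_nonneg z).trans (hQR z hz)
  set V := volume.real Q
  have : IsFiniteMeasure (volume.restrict Q) :=
    ⟨by simpa using (ENNReal.toReal_pos_iff.1 hV).2⟩
  have hint : Integrable (fun p : Euc d × ℝ => ‖f' (x + torusProj (p.2 • p.1))‖)
      ((volume.restrict Q).prod (volume.restrict (Ioc (0 : ℝ) 1))) :=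
    integrable_restrict_of_continuous_comp (g := fun y => ‖f' y‖) (by fun_prop)
      (by fun_prop : Continuous fun p : Euc d × ℝ => x + torusProj (p.2 • p.1))
  have hmain : ‖∫ z in Q, (f x - f (x + torusProj z))‖ ≤
      R * (V / β * (C - Real.log V + d)) := by
    calc ‖∫ z in Q, (f x - f (x + torusProj z))‖
        ≤ ∫ z in Q, R * ∫ s in Ioc (0 : ℝ) 1, ‖f' (x + torusProj (s • z))‖ := by
          refine norm_integral_le_of_norm_le (hint.integral_prod_left.const_mul R) ?_
          refine (ae_restrict_iff' hQm).2 (ae_of_all _ fun z hz => ?_)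
          exact (hf.norm_sub_comp_le x z).trans (mul_le_mul_of_nonneg_right (hQR z hz)
            (integral_nonneg fun _ => norm_nonneg _))
      _ = R * ∫ s in Ioc (0 : ℝ) 1, ∫ z in Q, ‖f' (x + torusProj (s • z))‖ := by
          rw [integral_const_mul, integral_integral_swap hint]
      _ ≤ R * ∫ s in Ioc (0 : ℝ) 1, V / β * (C - Real.log V - d * Real.log s) :=
          mul_le_mul_of_nonneg_left (setIntegral_mono_on hint.integral_prod_right
            ((integrableOn_sub_mul_log _ _).const_mul _) measurableSet_Ioc fun s hs =>
              setIntegral_norm_torusProj_smul_le hf'_cont hβ hC hQm hQ hV hs x) hR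
      _ = R * (V / β * (C - Real.log V + d)) := by
          rw [integral_const_mul, integral_sub_mul_log]
  have haverage : f x - ⨍ z in Q, f (x + torusProj z) =
      V⁻¹ • ∫ z in Q, (f x - f (x + torusProj z)) := by
    rw [setAverage_eq, integral_sub (integrable_const _)
      (integrable_restrict_of_continuous_comp hf_cont (by fun_prop)), setIntegral_const, smul_sub,
      inv_smul_smul₀ hV.ne']
  rw [haverage, norm_smul, Real.norm_of_nonneg (inv_nonneg.2 hV.le), inv_mul_le_iff₀ hV]
  refine hmain.trans (le_of_eq ?_)
  ring

theorem volume_real_unitCube (a : Fin d → ℝ) : volume.real (unitCube a) = 1 := by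
  rw [← measureReal_restrict_apply_univ, ← preimage_univ (f := torusProj (d := d)), measureReal_def,
    (measurePreserving_torusProj a).measure_preimage nullMeasurableSet_univ]
  simp

theorem TorusC1.norm_sub_integral_le [CompleteSpace F] (hf : TorusC1 f f') (hβ : 0 < β)
    (hC : ∫ y, Real.exp (β * ‖f' y‖) ≤ C) (x : 𝕋 d) :
    ‖f x - ∫ y, f y‖ ≤ d * ((d + C) / β) := by
  have hf_cont := hf.continuous
  have hQR (z : Euc d) (hz : z ∈ unitCube (0 : Fin d → ℝ)) : ‖z‖ ≤ d := by
    refine (norm_le_sum_abs z).trans ?_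
    calc ∑ i, |z i| ≤ ∑ _i : Fin d, (1 : ℝ) := Finset.sum_le_sum fun i _ => by
          have hzi := hz i
          simp only [Pi.zero_apply, zero_add, mem_Ioc] at hzi
          rw [abs_of_pos hzi.1]
          exact hzi.2
      _ = d := by simp
  have haverage : ⨍ z in unitCube (0 : Fin d → ℝ), f (x + torusProj z) = ∫ y, f y := by
    rw [setAverage_eq, volume_real_unitCube, inv_one, one_smul, ← integral_add_left_eq_self f x,
      ← (measurePreserving_torusProj 0).map_eq, integral_map (by fun_prop) (by fun_prop)]
  have hmain := hf.norm_sub_setAverage_le hβ hC (measurableSet_unitCube 0)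
    (fun v hv w hw i => by
      have hvi := hv i
      have hwi := hw i
      rw [abs_sub_lt_iff]
      constructor <;> linarith [hvi.1, hvi.2, hwi.1, hwi.2])
    hQR (by rw [volume_real_unitCube]; exact one_pos) x
  simpa [haverage, volume_real_unitCube] using hmain

theorem TorusC1.norm_sub_le_of_integral_exp_le [CompleteSpace F] (hf : TorusC1 f f') (hβ : 0 < β)
    (hC : ∫ y, Real.exp (β * ‖f' y‖) ≤ C) (x y : 𝕋 d) :
    ‖f x - f y‖ ≤ 2 * (d * ((d + C) / β)) := by
  have htriangle := norm_sub_le_norm_sub_add_norm_sub (f x) (∫ y, f y) (f y)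
  rw [norm_sub_rev (∫ y, f y)] at htriangle
  linarith [hf.norm_sub_integral_le hβ hC x, hf.norm_sub_integral_le hβ hC y]

theorem setIntegral_ball_comp_add (g : Euc d → F) (c w : Euc d) (r : ℝ) :
    ∫ z in Metric.ball (c - w) r, g (w + z) = ∫ z in Metric.ball c r, g z := by
  have hpreimage : (fun z => w + z) ⁻¹' Metric.ball c r = Metric.ball (c - w) r :=
    preimage_add_ball c w r
  rw [← hpreimage]
  exact (measurePreserving_add_left volume w).setIntegral_preimage_emb
    (measurableEmbedding_addLeft w) g (Metric.ball c r)

theorem volume_real_ball_euc (c : Euc d) {r : ℝ} (hr : 0 < r) :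
    volume.real (Metric.ball c r) = r ^ d * volume.real (Metric.ball (0 : Euc d) 1) := by
  rw [measureReal_def, Measure.addHaar_ball_of_pos volume c hr, finrank_euclideanSpace,
    Fintype.card_fin, ENNReal.toReal_mul, ENNReal.toReal_ofReal (by positivity), measureReal_def]

/-- The scale-free constant in the logarithmic modulus of continuity. -/
noncomputable def logModulusConst (d : ℕ) (C : ℝ) : ℝ :=
  d * Real.log 2 - Real.log (volume.real (Metric.ball (0 : Euc d) 1)) + d + C

theorem TorusC1.norm_sub_ball_average_le [CompleteSpace F] (hf : TorusC1 f f') (hβ : 0 < β)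
    (hC : ∫ y, Real.exp (β * ‖f' y‖) ≤ C) (x : 𝕋 d) {r : ℝ} (hr : 0 < r) (hr1 : r < 1)
    {c : Euc d} (hc : ‖c‖ = r / 2) : ‖f x - ⨍ z in Metric.ball c (r / 2), f (x + torusProj z)‖ ≤
      r * ((d * -Real.log r + logModulusConst d C) / β) := by
  have hball_pos : 0 < volume.real (Metric.ball (0 : Euc d) 1) :=
    ENNReal.toReal_pos (Metric.measure_ball_pos volume _ one_pos).ne' measure_ball_lt_top.ne
  have hvol := volume_real_ball_euc c (half_pos hr)
  have hmain := hf.norm_sub_setAverage_le hβ hC (R := r) (Q := Metric.ball c (r / 2))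
    measurableSet_ball
    (fun v hv w hw i => by
      have hdist := dist_triangle_right v w c
      rw [Metric.mem_ball] at hv hw
      rw [dist_eq_norm] at hdist
      exact (PiLp.norm_apply_le (v - w) i).trans_lt (by linarith))
    (fun z hz => by
      rw [mem_ball_iff_norm] at hz
      linarith [norm_le_norm_add_norm_sub' z c])
    (by rw [hvol]; positivity) x
  refine hmain.trans (le_of_eq ?_)
  rw [hvol, Real.log_mul (by positivity) hball_pos.ne', Real.log_pow,
    Real.log_div hr.ne' two_ne_zero, logModulusConst]
  ring

theorem TorusC1.norm_sub_le_of_norm_lt_one [CompleteSpace F] (hf : TorusC1 f f') (hβ : 0 < β)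
    (hC : ∫ y, Real.exp (β * ‖f' y‖) ≤ C) (x : 𝕋 d) {w : Euc d} (hw0 : w ≠ 0) (hw : ‖w‖ < 1) :
    ‖f (x + torusProj w) - f x‖ ≤
      2 * ‖w‖ * ((d * -Real.log ‖w‖ + logModulusConst d C) / β) := by
  have hr := norm_pos_iff.2 hw0
  set c := (2⁻¹ : ℝ) • w with hc
  have hc_norm : ‖c‖ = ‖w‖ / 2 := by
    rw [hc, norm_smul, Real.norm_of_nonneg (by norm_num), inv_mul_eq_div]
  have hcw_norm : ‖c - w‖ = ‖w‖ / 2 := by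
    rw [show c - w = -c by rw [hc]; module, norm_neg, hc_norm]
  -- Both endpoints are compared with the same average, over the ball centred halfway.
  have hsame : ⨍ z in Metric.ball (c - w) (‖w‖ / 2), f (x + torusProj w + torusProj z) =
      ⨍ z in Metric.ball c (‖w‖ / 2), f (x + torusProj z) := by
    simp only [setAverage_eq, volume_real_ball_euc _ (half_pos hr), add_assoc, ← torusProj_add]
    rw [setIntegral_ball_comp_add (fun z => f (x + torusProj z))]
  have hx := hf.norm_sub_ball_average_le hβ hC x hr hw hc_norm
  have hxw := hf.norm_sub_ball_average_le hβ hC (x + torusProj w) hr hw hcw_norm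
  rw [hsame] at hxw
  have htriangle := norm_sub_le_norm_sub_add_norm_sub (f (x + torusProj w))
    (⨍ z in Metric.ball c (‖w‖ / 2), f (x + torusProj z)) (f x)
  rw [norm_sub_rev (⨍ z in _, _)] at htriangle
  linarith

theorem mul_neg_log_le {r : ℝ} (hr : 0 < r) (a : ℝ) :
    r * -Real.log r ≤ r * a + Real.exp (-a) := by
  have hlog := Real.log_le_sub_one_of_pos (div_pos (Real.exp_pos (-a)) hr)
  rw [Real.log_div (Real.exp_pos _).ne' hr.ne', Real.log_exp] at hlog
  have hmul := mul_le_mul_of_nonneg_left hlog hr.le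
  have hcancel : r * (Real.exp (-a) / r - 1) = Real.exp (-a) - r := by field_simp
  linarith

theorem exists_hasAffineModulus [CompleteSpace F] {l : ℝ} (hl : 0 < l) {C : ℝ} (hC : 0 ≤ C) :
    ∃ B A₀ : ℝ, 0 ≤ B ∧ 0 ≤ A₀ ∧ ∀ (f : 𝕋 d → F) (f' : 𝕋 d → Euc d →L[ℝ] F), TorusC1 f f' →
      ∫ y, Real.exp (2 * d * l * ‖f' y‖) ≤ C →
        ∀ A, A₀ ≤ A → HasAffineModulus A (B * Real.exp (-(l * A))) f := by
  set β : ℝ := 2 * d * l with hβ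
  set c : ℝ := 2 * logModulusConst d C / β with hc
  refine ⟨l⁻¹ * Real.exp (l * c), 2 * (d * ((d + C) / β)), by positivity, by positivity,
    fun f f' hf hexp A hA x w => ?_⟩
  have hA_nonneg : 0 ≤ A := le_trans (by positivity) hA
  have hε : 0 ≤ l⁻¹ * Real.exp (l * c) * Real.exp (-(l * A)) := by positivity
  rcases eq_or_ne w 0 with rfl | hw0
  · simpa using hε
  have hd : (d : ℝ) ≠ 0 := by
    rintro h
    obtain rfl : d = 0 := by exact_mod_cast h
    exact hw0 (Subsingleton.elim _ _)
  have hβ_pos : 0 < β := by positivity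
  rcases lt_or_ge ‖w‖ 1 with hw | hw
  · have hlog := mul_neg_log_le (norm_pos_iff.2 hw0) (l * (A - c))
    have hexp_split : Real.exp (-(l * (A - c))) = Real.exp (l * c) * Real.exp (-(l * A)) := by
      rw [← Real.exp_add]
      ring_nf
    calc ‖f (x + torusProj w) - f x‖
        ≤ 2 * ‖w‖ * ((d * -Real.log ‖w‖ + logModulusConst d C) / β) :=
          hf.norm_sub_le_of_norm_lt_one hβ_pos hexp x hw0 hw
      _ = l⁻¹ * (‖w‖ * -Real.log ‖w‖) + ‖w‖ * c := by
          rw [hc, hβ]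
          field_simp
      _ ≤ l⁻¹ * (‖w‖ * (l * (A - c)) + Real.exp (-(l * (A - c)))) + ‖w‖ * c := by gcongr
      _ = A * ‖w‖ + l⁻¹ * Real.exp (l * c) * Real.exp (-(l * A)) := by
          rw [hexp_split]
          field_simp
          ring
  · have hfar := hf.norm_sub_le_of_integral_exp_le hβ_pos hexp (x + torusProj w) x
    linarith [le_mul_of_one_le_right hA_nonneg hw]

end Modulus

/-! ### The continuous representative -/

section ConvolutionAlgebra

variable {d : ℕ} {F : Type*} [NormedAddCommGroup F] [NormedSpace ℝ F] {K K₁ K₂ : 𝕋 d → ℝ}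
  {f g : 𝕋 d → F}

theorem torusConv_eq_integral_comp_sub (K : 𝕋 d → ℝ) (f : 𝕋 d → F) (x : 𝕋 d) :
    torusConv K f x = ∫ z, K z • f (x - z) := by
  rw [torusConv, ← integral_sub_left_eq_self (fun z => K z • f (x - z)) volume x]
  simp only [sub_sub_cancel]

theorem torusConv_sub (hK : Continuous K) (hf : Integrable f) (hg : Integrable g) (x : 𝕋 d) :
    torusConv K (fun y => f y - g y) x = torusConv K f x - torusConv K g x := by
  simp only [torusConv, smul_sub]
  exact integral_sub (integrable_comp_sub_left_smul hK hf x) (integrable_comp_sub_left_smul hK hg x)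

theorem torusConv_neg (K : 𝕋 d → ℝ) (f : 𝕋 d → F) (x : 𝕋 d) :
    torusConv K (fun y => -f y) x = -torusConv K f x := by
  simp only [torusConv, smul_neg, integral_neg]

theorem integrable_prod_smul_of_continuous {k : 𝕋 d × 𝕋 d → ℝ} (hk : Continuous k)
    (hf : Integrable f) : Integrable (fun p => k p • f p.2) (volume.prod volume) :=
  integrable_smul_of_continuous_left hk (hf.comp_snd _)

theorem torusConv_torusConv_apply [CompleteSpace F] (h₁ : Continuous K₁) (h₂ : Continuous K₂)
    (hf : Integrable f) (x : 𝕋 d) :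
    torusConv K₁ (torusConv K₂ f) x = ∫ z, torusConv K₁ K₂ (x - z) • f z := by
  have hswap := integral_integral_swap
    (f := fun y z => (K₁ (x - y) * K₂ (y - z)) • f z) (integrable_prod_smul_of_continuous
      (k := fun p => K₁ (x - p.1) * K₂ (p.1 - p.2)) (by fun_prop) hf)
  simp only [mul_smul, integral_smul] at hswap
  refine hswap.trans (integral_congr_ae (ae_of_all _ fun z => ?_))
  simp only [smul_smul, integral_smul_const]
  rw [torusConv, ← integral_sub_right_eq_self (fun y => K₁ (x - z - y) • K₂ y) z]
  simp only [sub_sub_sub_cancel_right, smul_eq_mul]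

theorem torusConv_comm (K₁ K₂ : 𝕋 d → ℝ) : torusConv K₁ K₂ = torusConv K₂ K₁ := by
  ext x
  rw [torusConv_eq_integral_comp_sub, torusConv]
  simp only [smul_eq_mul, mul_comm]

theorem torusConv_left_comm [CompleteSpace F] (h₁ : Continuous K₁) (h₂ : Continuous K₂)
    (hf : Integrable f) : torusConv K₁ (torusConv K₂ f) = torusConv K₂ (torusConv K₁ f) := by
  ext1 x
  rw [torusConv_torusConv_apply h₁ h₂ hf, torusConv_torusConv_apply h₂ h₁ hf, torusConv_comm]

theorem TorusDensity.integral_norm_torusConv_le (hK : TorusDensity K) (hf : Integrable f) :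
    ∫ x, ‖torusConv K f x‖ ≤ ∫ y, ‖f y‖ := by
  have hK_cont := hK.continuous
  have hprod := integrable_prod_smul_of_continuous (k := fun p => K (p.1 - p.2))
    (by fun_prop) hf.norm
  calc ∫ x, ‖torusConv K f x‖ ≤ ∫ x, ∫ y, K (x - y) • ‖f y‖ :=
        integral_mono_of_nonneg (ae_of_all _ fun _ => norm_nonneg _) hprod.integral_prod_left
          (ae_of_all _ (hK.norm_torusConv_le hf.norm (ae_of_all _ fun _ => le_rfl)))
    _ = ∫ y, ∫ x, K (x - y) • ‖f y‖ := integral_integral_swap hprod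
    _ = ∫ y, ‖f y‖ := by
        simp only [integral_smul_const, integral_sub_right_eq_self K, hK.integral_eq_one, one_smul]

theorem continuous_torusConv_mollifier (N : ℕ) (hf : Integrable f) :
    Continuous (torusConv (mollifier N) f) :=
  (torusC1_torusConv (torusSmooth_mollifier N).torusC1 hf).continuous

theorem TorusDensity.integral_norm_torusConv_sub_le (hK : TorusDensity K)
    (hKf : Integrable (torusConv K f)) (hKg : Integrable (torusConv K g)) (hf : Integrable f)
    (hg : Integrable g) : ∫ x, ‖torusConv K f x - f x‖ ≤
      2 * (∫ x, ‖f x - g x‖) + ∫ x, ‖torusConv K g x - g x‖ := by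
  have hKfg : Integrable fun x => ‖torusConv K (fun y => f y - g y) x‖ := by
    simpa only [torusConv_sub hK.continuous hf hg, Pi.sub_apply] using (hKf.sub hKg).norm
  have hpoint (x : 𝕋 d) : ‖torusConv K f x - f x‖ ≤ ‖f x - g x‖ +
      ‖torusConv K (fun y => f y - g y) x‖ + ‖torusConv K g x - g x‖ := by
    rw [torusConv_sub hK.continuous hf hg]
    calc ‖torusConv K f x - f x‖ = ‖-(f x - g x) + (torusConv K f x - torusConv K g x) +
          (torusConv K g x - g x)‖ := by abel_nf
      _ ≤ _ := norm_add₃_le.trans_eq (by rw [norm_neg])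
  have hmono := integral_mono (hKf.sub hf).norm
    (((hf.sub hg).norm.add hKfg).add (hKg.sub hg).norm) hpoint
  have hcontract : ∫ x, ‖torusConv K (fun y => f y - g y) x‖ ≤ ∫ x, ‖f x - g x‖ :=
    hK.integral_norm_torusConv_le (hf.sub hg)
  calc ∫ x, ‖torusConv K f x - f x‖
      ≤ (∫ x, ‖f x - g x‖) + (∫ x, ‖torusConv K (fun y => f y - g y) x‖) +
          ∫ x, ‖torusConv K g x - g x‖ :=
        hmono.trans_eq ((integral_add ((hf.sub hg).norm.add hKfg) (hKg.sub hg).norm).trans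
          (congrArg (· + _) (integral_add (hf.sub hg).norm hKfg)))
    _ ≤ 2 * (∫ x, ‖f x - g x‖) + ∫ x, ‖torusConv K g x - g x‖ := by linarith

end ConvolutionAlgebra

section MollifierLimit

variable {d : ℕ} {F : Type*} [NormedAddCommGroup F] [NormedSpace ℝ F] [CompleteSpace F]
  {K : 𝕋 d → ℝ} {f g : 𝕋 d → F}

theorem TorusDensity.norm_torusConv_sub_le (hK : TorusDensity K) (hg : Continuous g) (x : 𝕋 d) :
    ‖torusConv K g x - g x‖ ≤ ∫ z, K z • ‖g (x - z) - g x‖ := by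
  rw [← torusConv_eq_integral_comp_sub K (fun y => ‖g y - g x‖)]
  have hsub := torusConv_sub hK.continuous (integrable_of_continuous hg) (integrable_const (g x)) x
  rw [hK.torusConv_const] at hsub
  rw [← hsub]
  exact hK.norm_torusConv_le (integrable_of_continuous (by fun_prop))
    (ae_of_all _ fun _ => le_rfl) x

theorem tendsto_torusConv_mollifier (hg : Continuous g) (x : 𝕋 d) :
    Tendsto (fun N => torusConv (mollifier N) g x) atTop (𝓝 (g x)) := by
  rw [tendsto_iff_norm_sub_tendsto_zero]
  have hlim := tendsto_integral_mollifier_mul (g := fun z => ‖g (x - z) - g x‖) (by fun_prop)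
  simp only [sub_zero, sub_self, norm_zero] at hlim
  exact squeeze_zero (fun _ => norm_nonneg _)
    (fun N => (torusDensity_mollifier N).norm_torusConv_sub_le hg x) hlim

theorem tendsto_integral_norm_torusConv_sub_of_continuous (hg : Continuous g) :
    Tendsto (fun N => ∫ x, ‖torusConv (mollifier N) g x - g x‖) atTop (𝓝 0) := by
  obtain ⟨M, hM⟩ := exists_forall_norm_le_of_continuous hg
  have hbound (N : ℕ) (x : 𝕋 d) : ‖torusConv (mollifier N) g x - g x‖ ≤ M + M := by
    refine (norm_sub_le _ _).trans (add_le_add ?_ (hM x))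
    rw [← (torusDensity_mollifier N).torusConv_const M x]
    exact (torusDensity_mollifier N).norm_torusConv_le (integrable_const _) (ae_of_all _ hM) x
  have hlim := tendsto_integral_of_dominated_convergence (μ := volume)
    (F := fun N x => ‖torusConv (mollifier N) g x - g x‖) (f := fun _ => 0) (fun _ => M + M)
    (fun N => ((continuous_torusConv_mollifier N (integrable_of_continuous hg)).sub
      hg).norm.aestronglyMeasurable) (integrable_const _)
    (fun N => ae_of_all _ fun x => by simpa only [norm_norm] using hbound N x)
    (ae_of_all _ fun x => by
      simpa using ((tendsto_torusConv_mollifier hg x).sub_const (g x)).norm)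
  simpa using hlim

theorem tendsto_integral_norm_torusConv_sub (hf : Integrable f) :
    Tendsto (fun N => ∫ x, ‖torusConv (mollifier N) f x - f x‖) atTop (𝓝 0) := by
  refine tendsto_order.2 ⟨fun a ha => Eventually.of_forall fun N =>
    ha.trans_le (integral_nonneg fun _ => norm_nonneg _), fun ε hε => ?_⟩
  obtain ⟨g, -, hfg, hg, hg_int⟩ := hf.exists_hasCompactSupport_integral_sub_le
    (show (0 : ℝ) < ε / 4 by positivity)
  filter_upwards [(tendsto_integral_norm_torusConv_sub_of_continuous hg).eventually
    (gt_mem_nhds (half_pos hε))] with N hN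
  have hsplit := (torusDensity_mollifier N).integral_norm_torusConv_sub_le
    (integrable_of_continuous (continuous_torusConv_mollifier N hf))
    (integrable_of_continuous (continuous_torusConv_mollifier N hg_int)) hf hg_int
  linarith

/-- The first moment of the mollifier; the factor `d` accounts for comparing the distance of the
torus with the Euclidean norm of a lift. -/
noncomputable def mollifierMoment (d N : ℕ) : ℝ := ∫ y : 𝕋 d, mollifier N y * (d * ‖y‖)

theorem tendsto_mollifierMoment : Tendsto (mollifierMoment d) atTop (𝓝 0) := by
  have hlim := tendsto_integral_mollifier_mul (d := d) (g := fun z => d * ‖z‖) (by fun_prop)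
  rwa [norm_zero, mul_zero] at hlim

theorem HasAffineModulus.norm_torusConv_mollifier_sub_le {A ε : ℝ} (h : HasAffineModulus A ε g)
    (hg : Continuous g) (hA : 0 ≤ A) (N : ℕ) (x : 𝕋 d) :
    ‖torusConv (mollifier N) g x - g x‖ ≤ A * mollifierMoment d N + ε := by
  have hpoint (z : 𝕋 d) : ‖g (x - z) - g x‖ ≤ A * (d * ‖z‖) + ε := by
    obtain ⟨w, hw, hw_norm⟩ := exists_torusProj_eq_norm_le (-z)
    rw [norm_neg] at hw_norm
    calc ‖g (x - z) - g x‖ = ‖g (x + torusProj w) - g x‖ := by rw [hw, ← sub_eq_add_neg x]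
      _ ≤ A * ‖w‖ + ε := h x w
      _ ≤ A * (d * ‖z‖) + ε := by gcongr
  calc ‖torusConv (mollifier N) g x - g x‖ ≤ ∫ z, mollifier N z • ‖g (x - z) - g x‖ :=
        (torusDensity_mollifier N).norm_torusConv_sub_le hg x
    _ ≤ ∫ z : 𝕋 d, (A * (mollifier N z * (d * ‖z‖)) + mollifier N z * ε) := by
        refine integral_mono (integrable_of_continuous (by fun_prop))
          (integrable_of_continuous (by fun_prop)) fun z => ?_
        linarith [mul_le_mul_of_nonneg_left (hpoint z) (mollifier_nonneg N z),
          smul_eq_mul (mollifier N z) ‖g (x - z) - g x‖]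
    _ = A * mollifierMoment d N + ε := by
        rw [integral_add (integrable_of_continuous (by fun_prop))
          (integrable_of_continuous (by fun_prop)), integral_const_mul, integral_mul_const,
          integral_mollifier, one_mul, mollifierMoment]

end MollifierLimit

section ContinuousRepresentative

variable {d : ℕ} {F : Type*} [NormedAddCommGroup F] [NormedSpace ℝ F]

/-- The pointwise limit of the mollifications of `f`. -/
noncomputable def contRep (f : 𝕋 d → F) (x : 𝕋 d) : F :=
  limUnder atTop fun N => torusConv (mollifier N) f x

/-- All mollifications of `f` have the modulus of continuity `r ↦ A r + B exp (-l A)`, for every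
`A ≥ A₀`. Minimizing over `A`, this is a log-Lipschitz modulus. -/
structure HasMollifiedModulus (l B A₀ : ℝ) (f : 𝕋 d → F) : Prop where
  integrable : Integrable f
  rate_pos : 0 < l
  threshold_nonneg : 0 ≤ A₀
  hasAffineModulus_torusConv (N : ℕ) (A : ℝ) (hA : A₀ ≤ A) :
    HasAffineModulus A (B * Real.exp (-(l * A))) (torusConv (mollifier N) f)

theorem tendsto_mul_exp_neg_mul {l : ℝ} (hl : 0 < l) (B : ℝ) :
    Tendsto (fun A : ℝ => B * Real.exp (-(l * A))) atTop (𝓝 0) := by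
  simpa using (Real.tendsto_exp_neg_atTop_nhds_zero.comp
    (tendsto_id.const_mul_atTop hl)).const_mul B

theorem exists_ge_mul_exp_neg_mul_le {l : ℝ} (hl : 0 < l) (B A₀ : ℝ) {ε : ℝ} (hε : 0 < ε) :
    ∃ A, A₀ ≤ A ∧ B * Real.exp (-(l * A)) ≤ ε :=
  ((eventually_ge_atTop A₀).and
    ((tendsto_mul_exp_neg_mul hl B).eventually (ge_mem_nhds hε))).exists

variable [CompleteSpace F] {l B A₀ : ℝ} {f : 𝕋 d → F}

theorem HasMollifiedModulus.norm_torusConv_sub_torusConv_le (h : HasMollifiedModulus l B A₀ f)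
    (N M : ℕ) {A : ℝ} (hA : A₀ ≤ A) (x : 𝕋 d) :
    ‖torusConv (mollifier N) f x - torusConv (mollifier M) f x‖ ≤
      A * (mollifierMoment d N + mollifierMoment d M) + 2 * (B * Real.exp (-(l * A))) := by
  have hA_nonneg := h.threshold_nonneg.trans hA
  have hM := (h.hasAffineModulus_torusConv N A hA).norm_torusConv_mollifier_sub_le
    (continuous_torusConv_mollifier N h.integrable) hA_nonneg M x
  have hN := (h.hasAffineModulus_torusConv M A hA).norm_torusConv_mollifier_sub_le
    (continuous_torusConv_mollifier M h.integrable) hA_nonneg N x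
  rw [torusConv_left_comm (continuous_mollifier M) (continuous_mollifier N) h.integrable,
    norm_sub_rev] at hM
  linarith [norm_sub_le_norm_sub_add_norm_sub (torusConv (mollifier N) f x)
    (torusConv (mollifier N) (torusConv (mollifier M) f) x) (torusConv (mollifier M) f x)]

theorem HasMollifiedModulus.tendsto_torusConv (h : HasMollifiedModulus l B A₀ f) (x : 𝕋 d) :
    Tendsto (fun N => torusConv (mollifier N) f x) atTop (𝓝 (contRep f x)) := by
  refine CauchySeq.tendsto_limUnder (Metric.cauchySeq_iff'.2 fun ε hε => ?_)
  obtain ⟨A, hA, hAε⟩ := exists_ge_mul_exp_neg_mul_le h.rate_pos B A₀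
    (show 0 < ε / 6 by positivity)
  have hmoment : Tendsto (fun N => 2 * A * mollifierMoment d N) atTop (𝓝 0) := by
    simpa using tendsto_mollifierMoment.const_mul (2 * A)
  obtain ⟨N, hN⟩ := eventually_atTop.1
    (hmoment.eventually (gt_mem_nhds (show 0 < ε / 6 by positivity)))
  refine ⟨N, fun n hn => ?_⟩
  rw [dist_eq_norm]
  linarith [h.norm_torusConv_sub_torusConv_le n N hA x, hN n hn, hN N le_rfl]

theorem HasMollifiedModulus.norm_torusConv_sub_contRep_le (h : HasMollifiedModulus l B A₀ f)
    (N : ℕ) {A : ℝ} (hA : A₀ ≤ A) (x : 𝕋 d) : ‖torusConv (mollifier N) f x - contRep f x‖ ≤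
      A * mollifierMoment d N + 2 * (B * Real.exp (-(l * A))) := by
  have hbound : Tendsto (fun M => A * (mollifierMoment d N + mollifierMoment d M) +
      2 * (B * Real.exp (-(l * A)))) atTop
      (𝓝 (A * mollifierMoment d N + 2 * (B * Real.exp (-(l * A))))) := by
    simpa using ((tendsto_mollifierMoment.const_add (mollifierMoment d N)).const_mul A).add_const _
  exact le_of_tendsto_of_tendsto' ((h.tendsto_torusConv x).const_sub _).norm hbound
    fun M => h.norm_torusConv_sub_torusConv_le N M hA x

theorem HasMollifiedModulus.hasAffineModulus_contRep (h : HasMollifiedModulus l B A₀ f) {A : ℝ}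
    (hA : A₀ ≤ A) : HasAffineModulus A (B * Real.exp (-(l * A))) (contRep f) := fun x w =>
  le_of_tendsto' ((h.tendsto_torusConv (x + torusProj w)).sub (h.tendsto_torusConv x)).norm
    fun N => h.hasAffineModulus_torusConv N A hA x w

variable (F) in
theorem exists_forall_norm_torusConv_sub_contRep_le (hl : 0 < l) (B A₀ : ℝ) {ε : ℝ}
    (hε : 0 < ε) : ∃ N₀, ∀ N ≥ N₀, ∀ f : 𝕋 d → F, HasMollifiedModulus l B A₀ f →
      ∀ x, ‖torusConv (mollifier N) f x - contRep f x‖ ≤ ε := by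
  obtain ⟨A, hA, hAε⟩ := exists_ge_mul_exp_neg_mul_le hl B A₀ (show 0 < ε / 4 by positivity)
  have hmoment : Tendsto (fun N => A * mollifierMoment d N) atTop (𝓝 0) := by
    simpa using tendsto_mollifierMoment.const_mul A
  obtain ⟨N₀, hN₀⟩ := eventually_atTop.1 (hmoment.eventually (gt_mem_nhds (half_pos hε)))
  exact ⟨N₀, fun N hN f hf x => by linarith [hf.norm_torusConv_sub_contRep_le N hA x, hN₀ N hN]⟩

theorem HasMollifiedModulus.tendstoUniformly_torusConv (h : HasMollifiedModulus l B A₀ f) :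
    TendstoUniformly (fun N => torusConv (mollifier N) f) (contRep f) atTop := by
  refine Metric.tendstoUniformly_iff.2 fun ε hε => ?_
  obtain ⟨N₀, hN₀⟩ := exists_forall_norm_torusConv_sub_contRep_le (d := d) F h.rate_pos B A₀
    (half_pos hε)
  filter_upwards [eventually_ge_atTop N₀] with N hN x
  rw [dist_comm, dist_eq_norm]
  linarith [hN₀ N hN f h x]

theorem HasMollifiedModulus.continuous_contRep (h : HasMollifiedModulus l B A₀ f) :
    Continuous (contRep f) :=
  h.tendstoUniformly_torusConv.continuous
    (Frequently.of_forall fun N => continuous_torusConv_mollifier N h.integrable)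

theorem HasMollifiedModulus.contRep_ae_eq (h : HasMollifiedModulus l B A₀ f) :
    contRep f =ᵐ[volume] f := by
  have hconv_int (N : ℕ) : Integrable (torusConv (mollifier N) f) :=
    integrable_of_continuous (continuous_torusConv_mollifier N h.integrable)
  have hL1 : Tendsto (fun N => eLpNorm (torusConv (mollifier N) f - f) 1 volume) atTop (𝓝 0) := by
    have hlim := ENNReal.tendsto_ofReal (tendsto_integral_norm_torusConv_sub h.integrable)
    rw [ENNReal.ofReal_zero] at hlim
    refine hlim.congr fun N => ?_
    rw [eLpNorm_one_eq_lintegral_enorm,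
      ← ofReal_integral_norm_eq_lintegral_enorm ((hconv_int N).sub h.integrable)]
    rfl
  obtain ⟨ns, hns, hae⟩ := (tendstoInMeasure_of_tendsto_eLpNorm one_ne_zero
    (fun N => (hconv_int N).1) h.integrable.1 hL1).exists_seq_tendsto_ae
  filter_upwards [hae] with x hx
  exact tendsto_nhds_unique ((h.tendsto_torusConv x).comp hns.tendsto_atTop) hx

theorem HasMollifiedModulus.contRep_neg (h : HasMollifiedModulus l B A₀ f) (x : 𝕋 d) :
    contRep (fun y => -f y) x = -contRep f x := by
  refine Tendsto.limUnder_eq ?_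
  simp only [torusConv_neg]
  exact (h.tendsto_torusConv x).neg

end ContinuousRepresentative

/-! ### Fields with exponentially integrable gradient -/

section ExpField

variable {d : ℕ}

/-- A time-dependent field on `[0, T]` with weak gradient `D`, exponential moments of `|D|` bounded
by `C`, and divergence bounded by `L`. -/
structure ExpField (T L : ℝ) (C : ℝ → NNReal) (b : ℝ → 𝕋 d → Euc d)
    (D : ℝ → 𝕋 d → Matrix (Fin d) (Fin d) ℝ) : Prop where
  integrable : Integrable (fun z : ℝ × 𝕋 d => b z.1 z.2) ((volume.restrict (Icc 0 T)).prod volume)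
  isWeakGradient (t : ℝ) (ht : t ∈ Icc 0 T) : IsWeakGradient (b t) (D t)
  lintegral_exp_le (β : ℝ) (hβ : 0 ≤ β) (t : ℝ) (ht : t ∈ Icc 0 T) :
    ∫⁻ x, ENNReal.ofReal (Real.exp (β * matrixAbs (D t x))) ≤ C β
  abs_trace_le : ∀ᵐ t ∂volume.restrict (Icc 0 T), ∀ᵐ x, |(D t x).trace| ≤ L

variable {T L : ℝ} {C : ℝ → NNReal} {b : ℝ → 𝕋 d → Euc d}
  {D : ℝ → 𝕋 d → Matrix (Fin d) (Fin d) ℝ} {t : ℝ}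

theorem ExpField.integrable_apply (H : ExpField T L C b D) (ht : t ∈ Icc 0 T) :
    Integrable (b t) :=
  (H.isWeakGradient t ht).integrable

theorem ExpField.lintegral_exp_norm_torusConvDeriv_le (H : ExpField T L C b D)
    (ht : t ∈ Icc 0 T) (N : ℕ) {β : ℝ} (hβ : 0 ≤ β) :
    ∫⁻ x, ENNReal.ofReal (Real.exp (β * ‖torusConvDeriv (mollifier N) (b t) x‖)) ≤
      C (β * (d : ℝ) ^ 2) :=
  have hmoment := H.lintegral_exp_le (β * (d : ℝ) ^ 2) (by positivity) t ht
  ((H.isWeakGradient t ht).lintegral_exp_norm_torusConvDeriv_le (torusDensity_mollifier N)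
    (torusSmooth_mollifier N) hβ (hmoment.trans_lt ENNReal.coe_lt_top).ne).trans hmoment

theorem ExpField.exists_hasMollifiedModulus (H : ExpField T L C b D) {l : ℝ} (hl : 0 < l) :
    ∃ B A₀, 0 ≤ B ∧ 0 ≤ A₀ ∧ ∀ t ∈ Icc 0 T, HasMollifiedModulus l B A₀ (b t) := by
  obtain ⟨B, A₀, hB, hA₀, hmodulus⟩ := exists_hasAffineModulus (d := d) (F := Euc d) hl
    (C (2 * d * l * (d : ℝ) ^ 2)).coe_nonneg
  refine ⟨B, A₀, hB, hA₀, fun t ht => ⟨H.integrable_apply ht, hl, hA₀, fun N A hA => ?_⟩⟩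
  have hC1 := torusC1_torusConv (torusSmooth_mollifier N).torusC1 (H.integrable_apply ht)
  have hcont := hC1.continuous_deriv
  refine hmodulus _ _ hC1 ?_ A hA
  rw [integral_eq_lintegral_of_nonneg_ae (ae_of_all _ fun _ => (Real.exp_pos _).le)
    (by fun_prop)]
  exact ENNReal.toReal_le_coe_of_le_coe
    (H.lintegral_exp_norm_torusConvDeriv_le ht N (by positivity))

theorem ExpField.continuous_contRep (H : ExpField T L C b D) (ht : t ∈ Icc 0 T) :
    Continuous (contRep (b t)) :=
  have ⟨_, _, _, _, hmodulus⟩ := H.exists_hasMollifiedModulus one_pos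
  (hmodulus t ht).continuous_contRep

theorem ExpField.contRep_ae_eq (H : ExpField T L C b D) (ht : t ∈ Icc 0 T) :
    contRep (b t) =ᵐ[volume] b t :=
  have ⟨_, _, _, _, hmodulus⟩ := H.exists_hasMollifiedModulus one_pos
  (hmodulus t ht).contRep_ae_eq

theorem ExpField.contRep_neg (H : ExpField T L C b D) (ht : t ∈ Icc 0 T) (x : 𝕋 d) :
    contRep (fun y => -b t y) x = -contRep (b t) x :=
  have ⟨_, _, _, _, hmodulus⟩ := H.exists_hasMollifiedModulus one_pos
  (hmodulus t ht).contRep_neg x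

theorem ExpField.exists_norm_torusConv_sub_contRep_le (H : ExpField T L C b D) {ε : ℝ}
    (hε : 0 < ε) : ∃ N₀, ∀ N ≥ N₀, ∀ t ∈ Icc 0 T, ∀ x,
      ‖torusConv (mollifier N) (b t) x - contRep (b t) x‖ ≤ ε := by
  obtain ⟨B, A₀, -, -, hmodulus⟩ := H.exists_hasMollifiedModulus one_pos
  obtain ⟨N₀, hN₀⟩ := exists_forall_norm_torusConv_sub_contRep_le (d := d) (Euc d) one_pos B A₀ hε
  exact ⟨N₀, fun N hN t ht => hN₀ N hN (b t) (hmodulus t ht)⟩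

theorem ExpField.exists_norm_contRep_le (H : ExpField T L C b D) :
    ∃ M, ∀ t ∈ Icc 0 T, ∀ x, ‖contRep (b t) x‖ ≤ M * (∫ y, ‖b t y‖) + 1 := by
  obtain ⟨N, hN⟩ := H.exists_norm_torusConv_sub_contRep_le one_pos
  obtain ⟨M, hM⟩ := exists_forall_norm_le_of_continuous (continuous_mollifier (d := d) N)
  exact ⟨M, fun t ht x => (norm_le_norm_add_norm_sub _ _).trans
    (add_le_add (norm_torusConv_le hM (H.integrable_apply ht) x) (hN N le_rfl t ht x))⟩

theorem ExpField.integrableOn_integral_norm (H : ExpField T L C b D) :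
    IntegrableOn (fun s => ∫ y, ‖b s y‖) (Icc 0 T) :=
  H.integrable.norm.integral_prod_left

theorem ExpField.integrableOn_integral_smul (H : ExpField T L C b D) {k : Euc d × 𝕋 d → ℝ}
    (hk : Continuous k) {M : ℝ} (hM : ∀ p, ‖k p‖ ≤ M) {w : ℝ → Euc d}
    (hw : AEStronglyMeasurable w (volume.restrict (Icc 0 T))) :
    IntegrableOn (fun s => ∫ y, k (w s, y) • b s y) (Icc 0 T) := by
  have hmeas : AEStronglyMeasurable (fun z : ℝ × 𝕋 d => k (w z.1, z.2))
      ((volume.restrict (Icc 0 T)).prod volume) :=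
    hk.comp_aestronglyMeasurable (hw.comp_fst.prodMk aestronglyMeasurable_id.comp_snd)
  exact (H.integrable.bdd_smul M hmeas (ae_of_all _ fun _ => hM _)).integral_prod_left

theorem ExpField.integrableOn_torusConv (H : ExpField T L C b D) (N : ℕ) (x : 𝕋 d)
    {w : ℝ → Euc d} (hw : AEStronglyMeasurable w (volume.restrict (Icc 0 T))) :
    IntegrableOn (fun s => torusConv (mollifier N) (b s) (x + torusProj (w s))) (Icc 0 T) := by
  obtain ⟨M, hM⟩ := exists_forall_norm_le_of_continuous (continuous_mollifier (d := d) N)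
  exact H.integrableOn_integral_smul (k := fun p => mollifier N (x + torusProj p.1 - p.2))
    (by fun_prop) (fun _ => hM _) hw

theorem ExpField.integrableOn_contRep (H : ExpField T L C b D) (x : 𝕋 d) {w : ℝ → Euc d}
    (hw : AEStronglyMeasurable w (volume.restrict (Icc 0 T))) :
    IntegrableOn (fun s => contRep (b s) (x + torusProj (w s))) (Icc 0 T) := by
  obtain ⟨M, hM⟩ := H.exists_norm_contRep_le
  obtain ⟨B, A₀, -, -, hmodulus⟩ := H.exists_hasMollifiedModulus one_pos
  refine ((H.integrableOn_integral_norm.const_mul M).add (integrable_const 1)).mono' ?_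
    ((ae_restrict_mem measurableSet_Icc).mono fun s hs => hM s hs _)
  exact aestronglyMeasurable_of_tendsto_ae atTop
    (fun N => (H.integrableOn_torusConv N x hw).aestronglyMeasurable)
    ((ae_restrict_mem measurableSet_Icc).mono fun s hs => (hmodulus s hs).tendsto_torusConv _)

theorem intervalIntegrable_of_integrableOn_Icc {F : Type*} [NormedAddCommGroup F] {g : ℝ → F}
    {a : ℝ} (hg : IntegrableOn g (Icc 0 T)) (ha : a ∈ Icc 0 T) (ht : t ∈ Icc 0 T) :
    IntervalIntegrable g volume a t :=
  (hg.mono_set (uIcc_subset_Icc ha ht)).intervalIntegrable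

theorem continuousOn_integral_of_integrableOn_Icc {F : Type*} [NormedAddCommGroup F]
    [NormedSpace ℝ F] {g : ℝ → F} (hg : IntegrableOn g (Icc 0 T)) :
    ContinuousOn (fun t => ∫ s in (0 : ℝ)..t, g s) (Icc 0 T) := by
  rcases lt_or_ge T 0 with hT | hT
  · simp [Icc_eq_empty hT.not_ge]
  · rw [← uIcc_of_le hT] at hg ⊢
    exact intervalIntegral.continuousOn_primitive_interval hg

theorem exists_norm_integral_le_of_abs_sub_le {F : Type*} [NormedAddCommGroup F]
    [NormedSpace ℝ F] {g : ℝ → F} (hg : IntegrableOn g (Icc 0 T)) {η : ℝ} (hη : 0 < η) :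
    ∃ δ > 0, ∀ a ∈ Icc 0 T, ∀ t ∈ Icc 0 T, |t - a| ≤ δ → ‖∫ s in a..t, g s‖ ≤ η := by
  have huniform := isCompact_Icc.uniformContinuousOn_of_continuous
    (continuousOn_integral_of_integrableOn_Icc hg)
  obtain ⟨δ, hδ, hclose⟩ := Metric.uniformContinuousOn_iff_le.1 huniform η hη
  refine ⟨δ, hδ, fun a ha t ht hat => ?_⟩
  have h0 : (0 : ℝ) ∈ Icc 0 T := ⟨le_rfl, ha.1.trans ha.2⟩
  rw [← intervalIntegral.integral_interval_sub_left
    (intervalIntegrable_of_integrableOn_Icc hg h0 ht)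
    (intervalIntegrable_of_integrableOn_Icc hg h0 ha), ← dist_eq_norm]
  exact hclose t ht a ha hat

theorem ExpField.intervalIntegrable_contRep (H : ExpField T L C b D) (x : 𝕋 d) {w : ℝ → Euc d}
    (hw : ContinuousOn w (Icc 0 T)) {s : ℝ} (hs : s ∈ Icc 0 T) (ht : t ∈ Icc 0 T) :
    IntervalIntegrable (fun s => contRep (b s) (x + torusProj (w s))) volume s t :=
  intervalIntegrable_of_integrableOn_Icc
    (H.integrableOn_contRep x (hw.aestronglyMeasurable measurableSet_Icc)) hs ht

end ExpField

section ApproximateSolution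

variable {d : ℕ}

/-- `x + w` solves `∂ₜ X = c(t, X)`, `X(0) = x` on `[0, T]` up to an error `e`, in integral form. -/
structure IsApproxSol (T : ℝ) (c : ℝ → 𝕋 d → Euc d) (e : ℝ) (x : 𝕋 d) (w : ℝ → Euc d) : Prop where
  continuousOn : ContinuousOn w (Icc 0 T)
  norm_sub_integral_le (t : ℝ) (ht : t ∈ Icc 0 T) :
    ‖w t - ∫ s in (0 : ℝ)..t, c s (x + torusProj (w s))‖ ≤ e

theorem IsApproxSol.mono {T e e' : ℝ} {c : ℝ → 𝕋 d → Euc d} {x : 𝕋 d} {w : ℝ → Euc d}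
    (h : IsApproxSol T c e x w) (he : e ≤ e') : IsApproxSol T c e' x w :=
  ⟨h.continuousOn, fun t ht => (h.norm_sub_integral_le t ht).trans he⟩

theorem le_mul_exp_of_le_add_mul_integral {T A c : ℝ} {u : ℝ → ℝ} (hA : 0 ≤ A)
    (hu : ContinuousOn u (Icc 0 T))
    (h : ∀ t ∈ Icc 0 T, u t ≤ c + A * ∫ s in (0 : ℝ)..t, u s) {t : ℝ} (ht : t ∈ Icc 0 T) :
    u t ≤ c * Real.exp (A * t) := by
  have h0 : (0 : ℝ) ∈ Icc 0 T := ⟨le_rfl, ht.1.trans ht.2⟩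
  have hint {s : ℝ} (hs : s ∈ Icc 0 T) : IntervalIntegrable u volume 0 s :=
    intervalIntegrable_of_integrableOn_Icc hu.integrableOn_Icc h0 hs
  set U : ℝ → ℝ := fun t => c + A * ∫ s in (0 : ℝ)..t, u s with hU
  have hU_cont : ContinuousOn U (Icc 0 T) := by
    have hprim := continuousOn_integral_of_integrableOn_Icc hu.integrableOn_Icc
    exact continuousOn_const.add (continuousOn_const.mul hprim)
  have hU_deriv (s : ℝ) (hs : s ∈ Ico 0 T) : HasDerivWithinAt U (A * u s) (Ici s) s := by
    have hnhds : 𝓝[>] s ≤ 𝓝[Icc 0 T] s :=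
      nhdsWithin_le_of_mem (mem_of_superset (Icc_mem_nhdsGT_of_mem hs) subset_rfl)
    exact ((intervalIntegral.integral_hasDerivWithinAt_right (t := Ioi s)
      (hint (Ico_subset_Icc_self hs))
      ((hu.stronglyMeasurableAtFilter_nhdsWithin measurableSet_Icc s).filter_mono hnhds)
      ((hu s (Ico_subset_Icc_self hs)).mono_left hnhds)).const_mul A).const_add c
  have hgronwall := le_gronwallBound_of_liminf_deriv_right_le (δ := c) (K := A) (ε := 0) hU_cont
    (fun s hs r hr => (hU_deriv s hs).liminf_right_slope_le hr) (by simp [hU])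
    (fun s hs => by
      rw [add_zero]
      exact mul_le_mul_of_nonneg_left (h s (Ico_subset_Icc_self hs)) hA) t ht
  rw [gronwallBound_ε0, sub_zero] at hgronwall
  exact (h t ht).trans hgronwall

variable {T L : ℝ} {C : ℝ → NNReal} {b : ℝ → 𝕋 d → Euc d}
  {D : ℝ → 𝕋 d → Matrix (Fin d) (Fin d) ℝ} {x : 𝕋 d} {t : ℝ}

theorem ExpField.norm_integral_contRep_sub_le (H : ExpField T L C b D) {l B A₀ A : ℝ}
    (hmodulus : ∀ s ∈ Icc 0 T, HasMollifiedModulus l B A₀ (b s)) (hA : A₀ ≤ A)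
    {w₁ w₂ : ℝ → Euc d} (h₁ : ContinuousOn w₁ (Icc 0 T)) (h₂ : ContinuousOn w₂ (Icc 0 T))
    (ht : t ∈ Icc 0 T) :
    ‖(∫ s in (0 : ℝ)..t, contRep (b s) (x + torusProj (w₁ s))) -
        ∫ s in (0 : ℝ)..t, contRep (b s) (x + torusProj (w₂ s))‖ ≤
      A * (∫ s in (0 : ℝ)..t, ‖w₁ s - w₂ s‖) + t * (B * Real.exp (-(l * A))) := by
  have h0 : (0 : ℝ) ∈ Icc 0 T := ⟨le_rfl, ht.1.trans ht.2⟩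
  have hdist : IntervalIntegrable (fun s => A * ‖w₁ s - w₂ s‖) volume 0 t :=
    (intervalIntegrable_of_integrableOn_Icc (h₁.sub h₂).norm.integrableOn_Icc h0 ht).const_mul A
  have hpoint (s : ℝ) (hs : s ∈ Ioc 0 t) :
      ‖contRep (b s) (x + torusProj (w₁ s)) - contRep (b s) (x + torusProj (w₂ s))‖ ≤
        A * ‖w₁ s - w₂ s‖ + B * Real.exp (-(l * A)) := by
    have hmod := (hmodulus s ⟨hs.1.le, hs.2.trans ht.2⟩).hasAffineModulus_contRep hA
      (x + torusProj (w₂ s)) (w₁ s - w₂ s)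
    rwa [add_assoc, ← torusProj_add, add_sub_cancel] at hmod
  rw [← intervalIntegral.integral_sub (H.intervalIntegrable_contRep x h₁ h0 ht)
    (H.intervalIntegrable_contRep x h₂ h0 ht)]
  refine (intervalIntegral.norm_integral_le_of_norm_le ht.1 (ae_of_all _ hpoint)
    (hdist.add intervalIntegrable_const)).trans_eq ?_
  rw [intervalIntegral.integral_add hdist intervalIntegrable_const,
    intervalIntegral.integral_const_mul, intervalIntegral.integral_const, sub_zero, smul_eq_mul]

theorem ExpField.norm_sub_le_of_isApproxSol (H : ExpField T L C b D) {l B A₀ A e : ℝ}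
    (hmodulus : ∀ s ∈ Icc 0 T, HasMollifiedModulus l B A₀ (b s)) (hB : 0 ≤ B) (hA₀ : 0 ≤ A₀)
    (hA : A₀ ≤ A) {w₁ w₂ : ℝ → Euc d} (h₁ : IsApproxSol T (fun s => contRep (b s)) e x w₁)
    (h₂ : IsApproxSol T (fun s => contRep (b s)) e x w₂) (ht : t ∈ Icc 0 T) :
    ‖w₁ t - w₂ t‖ ≤ (2 * e + T * (B * Real.exp (-(l * A)))) * Real.exp (A * t) := by
  refine le_mul_exp_of_le_add_mul_integral (u := fun t => ‖w₁ t - w₂ t‖) (hA₀.trans hA)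
    (h₁.continuousOn.sub h₂.continuousOn).norm (fun t ht => ?_) ht
  have hint := H.norm_integral_contRep_sub_le (x := x) hmodulus hA h₁.continuousOn
    h₂.continuousOn ht
  have htime : t * (B * Real.exp (-(l * A))) ≤ T * (B * Real.exp (-(l * A))) :=
    mul_le_mul_of_nonneg_right ht.2 (by positivity)
  set I₁ := ∫ s in (0 : ℝ)..t, contRep (b s) (x + torusProj (w₁ s))
  set I₂ := ∫ s in (0 : ℝ)..t, contRep (b s) (x + torusProj (w₂ s))
  calc ‖w₁ t - w₂ t‖ = ‖(w₁ t - I₁) + (I₁ - I₂) + -(w₂ t - I₂)‖ := by abel_nf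
    _ ≤ ‖w₁ t - I₁‖ + ‖I₁ - I₂‖ + ‖w₂ t - I₂‖ := norm_add₃_le.trans_eq (by rw [norm_neg])
    _ ≤ 2 * e + T * (B * Real.exp (-(l * A))) + A * ∫ s in (0 : ℝ)..t, ‖w₁ s - w₂ s‖ := by
        linarith [h₁.norm_sub_integral_le t ht, h₂.norm_sub_integral_le t ht]

/- The rate `l = T + 1` of the modulus beats the Gronwall factor `exp (A T)`, so that `A` can be
chosen first, and the admissible error `e` afterwards. -/
theorem ExpField.exists_forall_isApproxSol_norm_sub_le (H : ExpField T L C b D) (hT : 0 ≤ T)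
    {ε : ℝ} (hε : 0 < ε) :
    ∃ e > 0, ∀ x w₁ w₂, IsApproxSol T (fun s => contRep (b s)) e x w₁ →
      IsApproxSol T (fun s => contRep (b s)) e x w₂ → ∀ t ∈ Icc 0 T, ‖w₁ t - w₂ t‖ ≤ ε := by
  obtain ⟨B, A₀, hB, hA₀, hmodulus⟩ :=
    H.exists_hasMollifiedModulus (show 0 < T + 1 by positivity)
  obtain ⟨A, hA, hAε⟩ := exists_ge_mul_exp_neg_mul_le one_pos (T * B) A₀ (half_pos hε)
  have hA_nonneg := hA₀.trans hA
  refine ⟨ε / 4 * Real.exp (-(A * T)), by positivity, fun x w₁ w₂ h₁ h₂ t ht => ?_⟩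
  have hcancel : Real.exp (-(A * T)) * Real.exp (A * T) = 1 := by rw [← Real.exp_add]; simp
  have hrate : Real.exp (-((T + 1) * A)) * Real.exp (A * T) = Real.exp (-(1 * A)) := by
    rw [← Real.exp_add]; congr 1; ring
  calc ‖w₁ t - w₂ t‖
      ≤ (2 * (ε / 4 * Real.exp (-(A * T))) + T * (B * Real.exp (-((T + 1) * A)))) *
          Real.exp (A * t) := H.norm_sub_le_of_isApproxSol hmodulus hB hA₀ hA h₁ h₂ ht
    _ ≤ (2 * (ε / 4 * Real.exp (-(A * T))) + T * (B * Real.exp (-((T + 1) * A)))) *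
          Real.exp (A * T) := by gcongr; exact ht.2
    _ = ε / 2 + T * B * Real.exp (-(1 * A)) := by
        rw [← hrate]
        linear_combination (ε / 2) * hcancel
    _ ≤ ε := by linarith

theorem ExpField.eq_of_isApproxSol_zero (H : ExpField T L C b D) {w₁ w₂ : ℝ → Euc d}
    (h₁ : IsApproxSol T (fun s => contRep (b s)) 0 x w₁)
    (h₂ : IsApproxSol T (fun s => contRep (b s)) 0 x w₂) (ht : t ∈ Icc 0 T) : w₁ t = w₂ t := by
  refine sub_eq_zero.1 (norm_le_zero_iff.1 (le_of_forall_pos_le_add fun ε hε => ?_))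
  obtain ⟨e, he, hstable⟩ := H.exists_forall_isApproxSol_norm_sub_le (ht.1.trans ht.2) hε
  rw [zero_add]
  exact hstable x w₁ w₂ (h₁.mono he.le) (h₂.mono he.le) t ht

theorem ExpField.tendsto_integral_contRep (H : ExpField T L C b D) {w : ℕ → ℝ → Euc d}
    {v : ℝ → Euc d} (hw : ∀ᶠ j in atTop, ContinuousOn (w j) (Icc 0 T))
    (hwv : ∀ s ∈ Icc 0 T, Tendsto (w · s) atTop (𝓝 (v s))) (ht : t ∈ Icc 0 T) :
    Tendsto (fun j => ∫ s in (0 : ℝ)..t, contRep (b s) (x + torusProj (w j s))) atTop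
      (𝓝 (∫ s in (0 : ℝ)..t, contRep (b s) (x + torusProj (v s)))) := by
  have h0 : (0 : ℝ) ∈ Icc 0 T := ⟨le_rfl, ht.1.trans ht.2⟩
  have hmem (s : ℝ) (hs : s ∈ uIoc 0 t) : s ∈ Icc 0 T :=
    uIcc_subset_Icc h0 ht (uIoc_subset_uIcc hs)
  obtain ⟨M, hM⟩ := H.exists_norm_contRep_le
  refine intervalIntegral.tendsto_integral_filter_of_dominated_convergence
    (fun s => M * (∫ y, ‖b s y‖) + 1) ?_
    (Eventually.of_forall fun j => ae_of_all _ fun s hs => hM s (hmem s hs) _)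
    (((intervalIntegrable_of_integrableOn_Icc H.integrableOn_integral_norm h0 ht).const_mul M).add
      intervalIntegrable_const) (ae_of_all _ fun s hs => ?_)
  · exact hw.mono fun j hj => (H.intervalIntegrable_contRep x hj h0 ht).def'.aestronglyMeasurable
  · have hpath : Tendsto (fun j => x + torusProj (w j s)) atTop (𝓝 (x + torusProj (v s))) :=
      ((continuous_torusProj.tendsto _).comp (hwv s (hmem s hs))).const_add x
    exact ((H.continuous_contRep (hmem s hs)).tendsto _).comp hpath

theorem ExpField.isApproxSol_zero_of_tendstoUniformlyOn (H : ExpField T L C b D)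
    {w : ℕ → ℝ → Euc d} {v : ℝ → Euc d}
    (hw : ∀ e > 0, ∀ᶠ j in atTop, IsApproxSol T (fun s => contRep (b s)) e x (w j))
    (hwv : TendstoUniformlyOn w v atTop (Icc 0 T)) :
    IsApproxSol T (fun s => contRep (b s)) 0 x v := by
  have hw_cont := (hw 1 one_pos).mono fun j hj => hj.continuousOn
  refine ⟨hwv.continuousOn hw_cont.frequently, fun t ht => ?_⟩
  have hlim := ((hwv.tendsto_at ht).sub (H.tendsto_integral_contRep (x := x) hw_cont
    (fun s hs => hwv.tendsto_at hs) ht)).norm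
  refine le_of_forall_pos_le_add fun e he => ?_
  rw [zero_add]
  exact le_of_tendsto hlim ((hw e he).mono fun j hj => hj.norm_sub_integral_le t ht)

theorem ExpField.exists_tendstoUniformlyOn (H : ExpField T L C b D) (hT : 0 ≤ T)
    {w : ℕ → 𝕋 d → ℝ → Euc d}
    (hw : ∀ e > 0, ∀ᶠ j in atTop, ∀ x, IsApproxSol T (fun s => contRep (b s)) e x (w j x)) :
    ∃ v : 𝕋 d → ℝ → Euc d, (∀ x, IsApproxSol T (fun s => contRep (b s)) 0 x (v x)) ∧
      TendstoUniformlyOn (fun j p => w j p.1 p.2) (fun p => v p.1 p.2) atTop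
        (univ ×ˢ Icc 0 T) := by
  have hcauchy : UniformCauchySeqOn (fun j (p : 𝕋 d × ℝ) => w j p.1 p.2) atTop
      (univ ×ˢ Icc 0 T) := by
    refine Metric.uniformCauchySeqOn_iff.2 fun ε hε => ?_
    obtain ⟨e, he, hstable⟩ := H.exists_forall_isApproxSol_norm_sub_le hT (half_pos hε)
    obtain ⟨J, hJ⟩ := eventually_atTop.1 (hw e he)
    refine ⟨J, fun j hj k hk p hp => ?_⟩
    rw [dist_eq_norm]
    linarith [hstable p.1 _ _ (hJ j hj p.1) (hJ k hk p.1) p.2 hp.2]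
  have hlim := hcauchy.tendstoUniformlyOn_of_tendsto
    (f := fun p => limUnder atTop fun j => w j p.1 p.2)
    fun p hp => (hcauchy.cauchySeq hp).tendsto_limUnder
  refine ⟨fun x t => limUnder atTop fun j => w j x t, fun x => ?_, hlim⟩
  exact H.isApproxSol_zero_of_tendstoUniformlyOn (fun e he => (hw e he).mono fun j hj => hj x)
    ((hlim.comp fun t => (x, t)).mono fun t ht => ⟨trivial, ht⟩)

end ApproximateSolution

section Composition

variable {d : ℕ}

/-- The displacement of the composition of the maps `x ↦ x + W 0 x, …, x ↦ x + W (k - 1) x`. -/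
noncomputable def compDisp (W : ℕ → 𝕋 d → Euc d) : ℕ → 𝕋 d → Euc d
  | 0 => fun _ => 0
  | k + 1 => fun x => compDisp W k x + W k (x + torusProj (compDisp W k x))

/-- The derivative of `compDisp`, in terms of the derivatives `W'` of the displacements `W`. -/
noncomputable def compDispDeriv (W : ℕ → 𝕋 d → Euc d) (W' : ℕ → 𝕋 d → Euc d →L[ℝ] Euc d) :
    ℕ → 𝕋 d → Euc d →L[ℝ] Euc d
  | 0 => fun _ => 0
  | k + 1 => fun x => compDispDeriv W W' k x + (W' k (x + torusProj (compDisp W k x))).comp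
      (ContinuousLinearMap.id ℝ (Euc d) + compDispDeriv W W' k x)

variable {W : ℕ → 𝕋 d → Euc d} {W' : ℕ → 𝕋 d → Euc d →L[ℝ] Euc d} {n : ℕ}

theorem torusC1_compDisp (hW : ∀ k < n, TorusC1 (W k) (W' k)) {k : ℕ} (hk : k ≤ n) :
    TorusC1 (compDisp W k) (compDispDeriv W W' k) := by
  induction k with
  | zero => exact ⟨continuous_const, fun _ => hasFDerivAt_const (0 : Euc d) _⟩
  | succ k ih =>
    have hV := ih (Nat.le_of_succ_le hk)
    have hWk := hW k hk
    have hV_cont := hV.continuous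
    have hV'_cont := hV.continuous_deriv
    have hW'_cont := hWk.continuous_deriv
    refine ⟨by simp only [compDispDeriv]; fun_prop, fun y => ?_⟩
    have hinner : HasFDerivAt (fun v : Euc d => v + compDisp W k (y + torusProj v))
        (ContinuousLinearMap.id ℝ (Euc d) + compDispDeriv W W' k y) 0 :=
      (hasFDerivAt_id _).add (hV.hasFDerivAt_zero y)
    have houter := (hWk.hasFDerivAt y (0 + compDisp W k (y + torusProj 0))).comp (0 : Euc d) hinner
    rw [torusProj_zero, add_zero, zero_add] at houter
    simpa only [compDisp, compDispDeriv, Function.comp_def, torusProj_add, ← add_assoc] using!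
      (hV.hasFDerivAt_zero y).add houter

theorem one_add_norm_compDispDeriv_le (W : ℕ → 𝕋 d → Euc d) (W' : ℕ → 𝕋 d → Euc d →L[ℝ] Euc d)
    (k : ℕ) (x : 𝕋 d) : 1 + ‖compDispDeriv W W' k x‖ ≤
      Real.exp (∑ j ∈ Finset.range k, ‖W' j (x + torusProj (compDisp W j x))‖) := by
  induction k with
  | zero => simp [compDispDeriv]
  | succ k ih =>
    rw [Finset.sum_range_succ, Real.exp_add, compDispDeriv]
    set A := W' k (x + torusProj (compDisp W k x))
    set V := compDispDeriv W W' k x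
    have hcomp : ‖A.comp (ContinuousLinearMap.id ℝ (Euc d) + V)‖ ≤ ‖A‖ * (1 + ‖V‖) :=
      (ContinuousLinearMap.opNorm_comp_le _ _).trans (mul_le_mul_of_nonneg_left
        ((norm_add_le _ _).trans (add_le_add_left ContinuousLinearMap.norm_id_le _))
        (norm_nonneg _))
    calc 1 + ‖V + A.comp (ContinuousLinearMap.id ℝ (Euc d) + V)‖
        ≤ (1 + ‖V‖) * (‖A‖ + 1) := by
          linarith [norm_add_le V (A.comp (ContinuousLinearMap.id ℝ (Euc d) + V))]
      _ ≤ _ := mul_le_mul ih (Real.add_one_le_exp _) (by positivity) (Real.exp_pos _).le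

theorem norm_compDispDeriv_pow_le_average (W : ℕ → 𝕋 d → Euc d)
    (W' : ℕ → 𝕋 d → Euc d →L[ℝ] Euc d) (hn : 0 < n) (p : ℕ) (x : 𝕋 d) :
    ‖compDispDeriv W W' n x‖ ^ p ≤ ∑ k ∈ Finset.range n,
      (n : ℝ)⁻¹ * Real.exp (n * p * ‖W' k (x + torusProj (compDisp W k x))‖) := by
  have hnorm : ‖compDispDeriv W W' n x‖ ≤
      Real.exp (∑ j ∈ Finset.range n, ‖W' j (x + torusProj (compDisp W j x))‖) := by
    linarith [one_add_norm_compDispDeriv_le W W' n x]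
  calc ‖compDispDeriv W W' n x‖ ^ p
      ≤ Real.exp (∑ k ∈ Finset.range n, p * ‖W' k (x + torusProj (compDisp W k x))‖) := by
        rw [← Finset.mul_sum, mul_comm, Real.exp_mul, Real.rpow_natCast]
        exact pow_le_pow_left₀ (norm_nonneg _) hnorm p
    _ ≤ _ := by simpa only [mul_assoc] using exp_sum_range_le_average hn _

theorem lintegral_comp_compDisp_le (hW : ∀ k < n, Continuous (W k)) {q : ℝ≥0∞}
    (hq : ∀ k < n, ∀ g : 𝕋 d → ℝ≥0∞, Measurable g →
      ∫⁻ x, g (x + torusProj (W k x)) ≤ q * ∫⁻ x, g x) {k : ℕ} (hk : k ≤ n)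
    {g : 𝕋 d → ℝ≥0∞} (hg : Measurable g) :
    ∫⁻ x, g (x + torusProj (compDisp W k x)) ≤ q ^ k * ∫⁻ x, g x := by
  induction k generalizing g with
  | zero => simp [compDisp]
  | succ k ih =>
    have hWk := hW k hk
    have hstep : Continuous fun y => y + torusProj (W k y) := by fun_prop
    calc ∫⁻ x, g (x + torusProj (compDisp W (k + 1) x))
        = ∫⁻ x, g (x + torusProj (compDisp W k x) +
            torusProj (W k (x + torusProj (compDisp W k x)))) := by
          simp only [compDisp, torusProj_add, add_assoc]
      _ ≤ q ^ k * ∫⁻ y, g (y + torusProj (W k y)) :=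
          ih (Nat.le_of_succ_le hk) (hg.comp hstep.measurable)
      _ ≤ q ^ k * (q * ∫⁻ x, g x) := by gcongr; exact hq k hk g hg
      _ = q ^ (k + 1) * ∫⁻ x, g x := by rw [pow_succ, mul_assoc]

theorem lintegral_norm_compDispDeriv_pow_le_average (hn : 0 < n)
    (hW : ∀ k < n, TorusC1 (W k) (W' k)) (p : ℕ) :
    ∫⁻ x, ENNReal.ofReal (‖compDispDeriv W W' n x‖ ^ p) ≤ ∑ k ∈ Finset.range n, (n : ℝ≥0∞)⁻¹ *
      ∫⁻ x, ENNReal.ofReal (Real.exp (n * p * ‖W' k (x + torusProj (compDisp W k x))‖)) := by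
  have hmeas (k) (hk : k < n) : Measurable fun x =>
      ENNReal.ofReal (Real.exp (n * p * ‖W' k (x + torusProj (compDisp W k x))‖)) := by
    have hV_cont := (torusC1_compDisp hW hk.le).continuous
    have hW'_cont := (hW k hk).continuous_deriv
    fun_prop
  calc ∫⁻ x, ENNReal.ofReal (‖compDispDeriv W W' n x‖ ^ p)
      ≤ ∫⁻ x, ∑ k ∈ Finset.range n, (n : ℝ≥0∞)⁻¹ *
          ENNReal.ofReal (Real.exp (n * p * ‖W' k (x + torusProj (compDisp W k x))‖)) := by
        refine lintegral_mono fun x => (ENNReal.ofReal_le_ofReal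
          (norm_compDispDeriv_pow_le_average W W' hn p x)).trans_eq ?_
        rw [ENNReal.ofReal_sum_of_nonneg fun _ _ => by positivity]
        refine Finset.sum_congr rfl fun _ _ => ?_
        rw [ENNReal.ofReal_mul (by positivity), ENNReal.ofReal_inv_of_pos (by positivity),
          ENNReal.ofReal_natCast]
    _ = _ := by
        rw [lintegral_finsetSum' _ fun k hk =>
          ((hmeas k (Finset.mem_range.1 hk)).const_mul _).aemeasurable]
        exact Finset.sum_congr rfl fun k hk =>
          lintegral_const_mul _ (hmeas k (Finset.mem_range.1 hk))

theorem lintegral_norm_compDispDeriv_pow_le (hn : 0 < n) (hW : ∀ k < n, TorusC1 (W k) (W' k))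
    {q M : ℝ≥0∞} (hq_one : 1 ≤ q)
    (hq : ∀ k < n, ∀ g : 𝕋 d → ℝ≥0∞, Measurable g →
      ∫⁻ x, g (x + torusProj (W k x)) ≤ q * ∫⁻ x, g x) {p : ℕ}
    (hM : ∀ k < n, ∫⁻ x, ENNReal.ofReal (Real.exp (n * p * ‖W' k x‖)) ≤ M) :
    ∫⁻ x, ENNReal.ofReal (‖compDispDeriv W W' n x‖ ^ p) ≤ q ^ n * M := by
  refine (lintegral_norm_compDispDeriv_pow_le_average hn hW p).trans ?_
  calc ∑ k ∈ Finset.range n, (n : ℝ≥0∞)⁻¹ *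
        ∫⁻ x, ENNReal.ofReal (Real.exp (n * p * ‖W' k (x + torusProj (compDisp W k x))‖))
      ≤ ∑ _k ∈ Finset.range n, (n : ℝ≥0∞)⁻¹ * (q ^ n * M) := by
        refine Finset.sum_le_sum fun k hk => ?_
        have hkn := Finset.mem_range.1 hk
        have hW'_cont := (hW k hkn).continuous_deriv
        gcongr
        exact (lintegral_comp_compDisp_le (fun k hk => (hW k hk).continuous) hq hkn.le
          (g := fun y => ENNReal.ofReal (Real.exp (n * p * ‖W' k y‖))) (by fun_prop)).trans
          (mul_le_mul' (pow_le_pow_right₀ hq_one hkn.le) (hM k hkn))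
    _ = q ^ n * M := by
        rw [Finset.sum_const, Finset.card_range, nsmul_eq_mul, ← mul_assoc,
          ENNReal.mul_inv_cancel (by simp [hn.ne']) (by simp), one_mul]

end Composition

/-! ### Time averages of mollified fields -/

section TimeIntegral

variable {d : ℕ}

section Bilinear

variable {E F G : Type*} [NormedAddCommGroup E] [NormedSpace ℝ E] [NormedAddCommGroup F]
  [NormedSpace ℝ F] [NormedAddCommGroup G] [NormedSpace ℝ G] {ν : Measure ℝ}
  {k : 𝕋 d → E} {g : ℝ → 𝕋 d → F}

theorem integrable_prod_bilin_of_continuous_left (B : E →L[ℝ] F →L[ℝ] G) (hk : Continuous k)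
    (hg : Integrable (fun z : ℝ × 𝕋 d => g z.1 z.2) (ν.prod volume)) :
    Integrable (fun z : ℝ × 𝕋 d => B (k z.2) (g z.1 z.2)) (ν.prod volume) := by
  obtain ⟨C, hC⟩ := exists_forall_norm_le_of_continuous hk
  exact B.integrable_of_bilin_of_bdd_left C (hk.comp continuous_snd).aestronglyMeasurable
    (ae_of_all _ fun z => hC z.2) hg

theorem integral_bilin_integral_swap [SFinite ν] [CompleteSpace F] [CompleteSpace G]
    (B : E →L[ℝ] F →L[ℝ] G) (hk : Continuous k)
    (hg : Integrable (fun z : ℝ × 𝕋 d => g z.1 z.2) (ν.prod volume)) :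
    ∫ y, B (k y) (∫ s, g s y ∂ν) = ∫ s, (∫ y, B (k y) (g s y)) ∂ν := by
  rw [integral_integral_swap (integrable_prod_bilin_of_continuous_left B hk hg)]
  refine integral_congr_ae (hg.prod_left_ae.mono fun y hy => ?_)
  exact ((B (k y)).integral_comp_comm hy).symm

end Bilinear

theorem exp_norm_average_le_laverage {α E : Type*} [MeasurableSpace α] {μ : Measure α}
    [IsFiniteMeasure μ] [NeZero μ] [NormedAddCommGroup E] [NormedSpace ℝ E] [CompleteSpace E]
    {φ : α → E} (hφ : Integrable φ μ) {β : ℝ} (hβ : 0 ≤ β) :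
    ENNReal.ofReal (Real.exp (β * ‖⨍ x, φ x ∂μ‖)) ≤
      ⨍⁻ x, ENNReal.ofReal (Real.exp (β * ‖φ x‖)) ∂μ := by
  rw [laverage_eq]
  by_cases hfin : ∫⁻ x, ENNReal.ofReal (Real.exp (β * ‖φ x‖)) ∂μ = ⊤
  · simp [hfin, ENNReal.top_div_of_ne_top]
  have hexp : Integrable (fun x => Real.exp (β * ‖φ x‖)) μ :=
    integrable_of_lintegral_ofReal_ne_top (fun _ => (Real.exp_pos _).le)
      (Real.continuous_exp.comp_aestronglyMeasurable (hφ.norm.const_mul β).1) hfin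
  have hconvex : ConvexOn ℝ univ fun v : E => Real.exp (β * ‖v‖) :=
    ⟨convex_univ, fun v _ w _ a c ha hc hac => (Real.exp_le_exp.2 ((convexOn_norm convex_univ).smul
      hβ |>.2 (mem_univ v) (mem_univ w) ha hc hac)).trans
        (convexOn_exp.2 (mem_univ _) (mem_univ _) ha hc hac)⟩
  rw [← ofReal_average hexp (ae_of_all _ fun _ => (Real.exp_pos _).le)]
  exact ENNReal.ofReal_le_ofReal (hconvex.map_average_le (by fun_prop) isClosed_univ
    (ae_of_all _ fun _ => mem_univ _) hφ hexp)

/-- The time integral of a field over `S`. -/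
noncomputable def timeIntegral (b : ℝ → 𝕋 d → Euc d) (S : Set ℝ) (y : 𝕋 d) : Euc d :=
  ∫ s in S, b s y

variable {T L : ℝ} {C : ℝ → NNReal} {b : ℝ → 𝕋 d → Euc d}
  {D : ℝ → 𝕋 d → Matrix (Fin d) (Fin d) ℝ} {S : Set ℝ}

theorem ExpField.integrable_restrict (H : ExpField T L C b D) (hS : S ⊆ Icc 0 T) :
    Integrable (fun z : ℝ × 𝕋 d => b z.1 z.2) ((volume.restrict S).prod volume) :=
  H.integrable.mono_measure (Measure.prod_mono (Measure.restrict_mono hS le_rfl) le_rfl)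

theorem ExpField.integrable_timeIntegral (H : ExpField T L C b D) (hS : S ⊆ Icc 0 T) :
    Integrable (timeIntegral b S) :=
  (H.integrable_restrict hS).integral_prod_right

theorem ExpField.torusConv_timeIntegral (H : ExpField T L C b D) (hS : S ⊆ Icc 0 T) (N : ℕ)
    (x : 𝕋 d) :
    torusConv (mollifier N) (timeIntegral b S) x = ∫ s in S, torusConv (mollifier N) (b s) x :=
  integral_bilin_integral_swap (.lsmul ℝ ℝ)
    (by fun_prop : Continuous fun y => mollifier N (x - y)) (H.integrable_restrict hS)

theorem ExpField.torusConvDeriv_timeIntegral (H : ExpField T L C b D) (hS : S ⊆ Icc 0 T) (N : ℕ)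
    (x : 𝕋 d) : torusConvDeriv (mollifier N) (timeIntegral b S) x =
      ∫ s in S, torusConvDeriv (mollifier N) (b s) x :=
  have hK' := (torusSmooth_mollifier (d := d) N).torusC1.continuous_deriv
  integral_bilin_integral_swap (ContinuousLinearMap.smulRightL ℝ (Euc d) (Euc d))
    (hK'.comp (continuous_const.sub continuous_id)) (H.integrable_restrict hS)

theorem ExpField.integrableOn_torusConvDeriv (H : ExpField T L C b D) (hS : S ⊆ Icc 0 T) (N : ℕ)
    (x : 𝕋 d) : IntegrableOn (fun s => torusConvDeriv (mollifier N) (b s) x) S :=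
  have hK' := (torusSmooth_mollifier (d := d) N).torusC1.continuous_deriv
  (integrable_prod_bilin_of_continuous_left (ContinuousLinearMap.smulRightL ℝ (Euc d) (Euc d))
    (hK'.comp (continuous_const.sub continuous_id)) (H.integrable_restrict hS)).integral_prod_left

theorem ExpField.exists_norm_torusConvDeriv_le (H : ExpField T L C b D) (N : ℕ) :
    ∃ R, 0 ≤ R ∧ ∀ t ∈ Icc 0 T, ∀ x, ‖torusConvDeriv (mollifier N) (b t) x‖ ≤ R := by
  obtain ⟨M, hM⟩ := exists_forall_norm_le_of_continuous (continuous_mollifier (d := d) N)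
  have hM_nonneg := (norm_nonneg _).trans (hM 0)
  refine ⟨(d : ℝ) ^ 2 * (M * C 1), by positivity, fun t ht x => ?_⟩
  have hweak := H.isWeakGradient t ht
  have hgradient : ∫ y, matrixAbs (D t y) ≤ C 1 := by
    rw [integral_eq_lintegral_of_nonneg_ae (ae_of_all _ fun y => matrixAbs_nonneg _)
      hweak.integrable_matrixAbs.1]
    refine ENNReal.toReal_le_coe_of_le_coe ((lintegral_mono fun y => ?_).trans
      (H.lintegral_exp_le 1 zero_le_one t ht))
    rw [one_mul]
    exact ENNReal.ofReal_le_ofReal (by linarith [Real.add_one_le_exp (matrixAbs (D t y))])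
  refine (hweak.norm_torusConvDeriv_le (torusDensity_mollifier N) (torusSmooth_mollifier N)
    x).trans ?_
  gcongr
  calc torusConv (mollifier N) (fun y => matrixAbs (D t y)) x
      ≤ M * ∫ y, ‖matrixAbs (D t y)‖ :=
        (Real.le_norm_self _).trans (norm_torusConv_le hM hweak.integrable_matrixAbs x)
    _ = M * ∫ y, matrixAbs (D t y) := by
        simp only [Real.norm_of_nonneg (matrixAbs_nonneg _)]
    _ ≤ M * C 1 := by gcongr

theorem ExpField.norm_torusConvDeriv_timeIntegral_le (H : ExpField T L C b D)
    (hS : S ⊆ Icc 0 T) {N : ℕ} {R : ℝ}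
    (hR : ∀ t ∈ Icc 0 T, ∀ x, ‖torusConvDeriv (mollifier N) (b t) x‖ ≤ R) (x : 𝕋 d) :
    ‖torusConvDeriv (mollifier N) (timeIntegral b S) x‖ ≤ volume.real S * R := by
  rw [H.torusConvDeriv_timeIntegral hS, mul_comm]
  exact norm_setIntegral_le_of_norm_le_const ((measure_mono hS).trans_lt measure_Icc_lt_top)
    fun s hs => hR s (hS hs) x

theorem ExpField.abs_trace_torusConvDeriv_timeIntegral_le (H : ExpField T L C b D)
    (hS : S ⊆ Icc 0 T) (N : ℕ) (x : 𝕋 d) :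
    |LinearMap.trace ℝ (Euc d) (torusConvDeriv (mollifier N) (timeIntegral b S) x)| ≤
      volume.real S * L := by
  set trace : (Euc d →L[ℝ] Euc d) →L[ℝ] ℝ :=
    LinearMap.toContinuousLinearMap (LinearMap.trace ℝ (Euc d) ∘ₗ ContinuousLinearMap.coeLM ℝ)
  have hbound : ∀ᵐ s ∂volume.restrict S,
      ‖trace (torusConvDeriv (mollifier N) (b s) x)‖ ≤ L := by
    filter_upwards [ae_restrict_of_ae_restrict_of_subset hS H.abs_trace_le,
      ae_restrict_of_ae_restrict_of_subset hS (ae_restrict_mem measurableSet_Icc)] with s hs hsT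
    exact (H.isWeakGradient s hsT).abs_trace_torusConvDeriv_le (torusDensity_mollifier N)
      (torusSmooth_mollifier N) hs x
  have : IsFiniteMeasure (volume.restrict S) :=
    isFiniteMeasure_restrict.2 ((measure_mono hS).trans_lt measure_Icc_lt_top).ne
  calc ‖trace (torusConvDeriv (mollifier N) (timeIntegral b S) x)‖
      = ‖∫ s in S, trace (torusConvDeriv (mollifier N) (b s) x)‖ := by
        rw [trace.integral_comp_comm (H.integrableOn_torusConvDeriv hS N x),
          H.torusConvDeriv_timeIntegral hS]
    _ ≤ volume.real S * L := by
        simpa [mul_comm] using norm_integral_le_of_norm_le_const hbound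

theorem ExpField.aestronglyMeasurable_torusConvDeriv (H : ExpField T L C b D) (hS : S ⊆ Icc 0 T)
    (N : ℕ) : AEStronglyMeasurable (fun z : ℝ × 𝕋 d => torusConvDeriv (mollifier N) (b z.1) z.2)
      ((volume.restrict S).prod volume) := by
  have hK' := (torusSmooth_mollifier (d := d) N).torusC1.continuous_deriv
  have hb : AEStronglyMeasurable (fun z : (ℝ × 𝕋 d) × 𝕋 d => b z.1.1 z.2)
      (((volume.restrict S).prod volume).prod volume) :=
    (H.integrable_restrict hS).1.comp_quasiMeasurePreserving
      (QuasiMeasurePreserving.prodMap Measure.quasiMeasurePreserving_fst (.id _))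
  have hkernel : Continuous fun z : (ℝ × 𝕋 d) × 𝕋 d => torusFDeriv (mollifier N) (z.1.2 - z.2) :=
    hK'.comp (by fun_prop)
  exact ((ContinuousLinearMap.smulRightL ℝ (Euc d) (Euc d)).aestronglyMeasurable_comp₂
    hkernel.aestronglyMeasurable hb).integral_prod_right'

theorem ExpField.lintegral_exp_norm_torusConvDeriv_timeIntegral_le (H : ExpField T L C b D)
    (hS : S ⊆ Icc 0 T) (hS₀ : volume S ≠ 0) (N : ℕ) {β : ℝ} (hβ : 0 ≤ β) :
    ∫⁻ x, ENNReal.ofReal (Real.exp (β *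
      ‖torusConvDeriv (mollifier N) (timeIntegral b S) x‖)) ≤
        C (β * volume.real S * (d : ℝ) ^ 2) := by
  have hS_fin : volume S ≠ ⊤ := ((measure_mono hS).trans_lt measure_Icc_lt_top).ne
  have : IsFiniteMeasure (volume.restrict S) := isFiniteMeasure_restrict.2 hS_fin
  have : NeZero (volume.restrict S) := ⟨mt Measure.restrict_eq_zero.1 hS₀⟩
  set m := volume.real S
  set φ : ℝ → 𝕋 d → ℝ≥0∞ := fun s x =>
    ENNReal.ofReal (Real.exp (β * m * ‖torusConvDeriv (mollifier N) (b s) x‖))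
  have hφ : AEMeasurable (Function.uncurry fun x s => φ s x)
      (volume.prod (volume.restrict S)) :=
    ((((H.aestronglyMeasurable_torusConvDeriv hS N).norm.const_mul
      (β * m)).aemeasurable.exp).ennreal_ofReal).prod_swap
  have hjensen (x : 𝕋 d) : ENNReal.ofReal (Real.exp (β *
      ‖torusConvDeriv (mollifier N) (timeIntegral b S) x‖)) ≤ ⨍⁻ s in S, φ s x ∂volume := by
    refine le_of_eq_of_le ?_ (exp_norm_average_le_laverage
      (H.integrableOn_torusConvDeriv hS N x) (by positivity : 0 ≤ β * m))
    rw [H.torusConvDeriv_timeIntegral hS, mul_assoc, ← measure_smul_setAverage _ hS_fin,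
      norm_smul, Real.norm_of_nonneg measureReal_nonneg]
  calc ∫⁻ x, ENNReal.ofReal (Real.exp (β * ‖torusConvDeriv (mollifier N) (timeIntegral b S) x‖))
      ≤ ∫⁻ x, (⨍⁻ s in S, φ s x ∂volume) := lintegral_mono hjensen
    _ = ⨍⁻ s in S, (∫⁻ x, φ s x) ∂volume := by
        simp only [setLAverage_eq, ENNReal.div_eq_inv_mul]
        rw [lintegral_const_mul' _ _ (ENNReal.inv_ne_top.2 hS₀), lintegral_lintegral_swap hφ]
    _ ≤ C (β * m * (d : ℝ) ^ 2) := by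
        rw [setLAverage_eq, ENNReal.div_le_iff hS₀ hS_fin, ← setLIntegral_const]
        refine lintegral_mono_ae ((ae_restrict_of_ae_restrict_of_subset hS
          (ae_restrict_mem measurableSet_Icc)).mono fun s hs => ?_)
        exact H.lintegral_exp_norm_torusConvDeriv_le hs N (by positivity)

end TimeIntegral

/-! ### Sobolev regularity of uniform limits -/

section WeakLimit

variable {E : Type*} [NormedAddCommGroup E] [InnerProductSpace ℝ E] [CompleteSpace E]

theorem exists_tendsto_inner_of_norm_le {g : ℕ → E} {R : ℝ} (hg : ∀ j, ‖g j‖ ≤ R) :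
    ∃ G : E, ∀ φ, Tendsto (fun j => inner ℝ (g j) φ) (hyperfilter ℕ : Filter ℕ)
      (𝓝 (inner ℝ G φ)) := by
  let J (f : E) : WeakDual ℝ E := StrongDual.toWeakDual (InnerProductSpace.toDual ℝ E f)
  obtain ⟨ℓ, -, hℓ⟩ := (WeakDual.isCompact_closedBall (𝕜 := ℝ) (E := E) 0 R).ultrafilter_le_nhds
    ((hyperfilter ℕ).map fun j => J (g j)) <| le_principal_iff.2 <| Ultrafilter.mem_map.2 <|
      univ_mem' fun j => by
        change InnerProductSpace.toDual ℝ E (g j) ∈ Metric.closedBall 0 R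
        simpa using hg j
  refine ⟨(InnerProductSpace.toDual ℝ E).symm (WeakDual.toStrongDual ℓ), fun φ => ?_⟩
  rw [InnerProductSpace.toDual_symm_apply]
  exact ((WeakDual.eval_continuous φ).tendsto ℓ).comp hℓ

theorem mem_of_tendsto_inner {s : Set E} (hs : Convex ℝ s) (hs' : IsClosed s) {ι : Type*}
    {l : Filter ι} [l.NeBot] {g : ι → E} {G : E} (hg : ∀ j, g j ∈ s)
    (hlim : ∀ φ, Tendsto (fun j => inner ℝ (g j) φ) l (𝓝 (inner ℝ G φ))) : G ∈ s := by
  by_contra hG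
  obtain ⟨f, c, hfs, hfG⟩ := geometric_hahn_banach_closed_point hs hs' hG
  have hf (y : E) : inner ℝ y ((InnerProductSpace.toDual ℝ E).symm f) = f y := by
    rw [real_inner_comm, InnerProductSpace.toDual_symm_apply]
  have hflim : Tendsto (fun j => f (g j)) l (𝓝 (f G)) := by
    simpa only [hf] using hlim ((InnerProductSpace.toDual ℝ E).symm f)
  exact hfG.not_ge (le_of_tendsto' hflim fun j => (hfs (g j) (hg j)).le)

variable {α : Type*} [MeasurableSpace α] {μ : Measure α}

theorem convex_setOf_eLpNorm_le {p : ℝ≥0∞} (hp : 1 ≤ p) (C : ℝ≥0∞) :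
    Convex ℝ {f : Lp ℝ 2 μ | eLpNorm f p μ ≤ C} := by
  intro f hf g hg a b ha hb hab
  have hcoe : ⇑(a • f + b • g) =ᵐ[μ] a • ⇑f + b • ⇑g :=
    (Lp.coeFn_add _ _).trans ((Lp.coeFn_smul a f).add (Lp.coeFn_smul b g))
  calc eLpNorm (a • f + b • g : Lp ℝ 2 μ) p μ = eLpNorm (a • ⇑f + b • ⇑g) p μ :=
        eLpNorm_congr_ae hcoe
    _ ≤ eLpNorm (a • ⇑f) p μ + eLpNorm (b • ⇑g) p μ :=
        eLpNorm_add_le ((Lp.aestronglyMeasurable f).const_smul a)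
          ((Lp.aestronglyMeasurable g).const_smul b) hp
    _ ≤ ENNReal.ofReal a * C + ENNReal.ofReal b * C := by
        rw [eLpNorm_const_smul, eLpNorm_const_smul, Real.enorm_of_nonneg ha,
          Real.enorm_of_nonneg hb]
        gcongr
        exacts [hf, hg]
    _ = C := by rw [← add_mul, ← ENNReal.ofReal_add ha hb, hab, ENNReal.ofReal_one, one_mul]

theorem isClosed_setOf_eLpNorm_le (p C : ℝ≥0∞) :
    IsClosed {f : Lp ℝ 2 μ | eLpNorm f p μ ≤ C} := by
  refine IsSeqClosed.isClosed fun f g hf hfg => ?_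
  exact eLpNorm_le_of_tendstoInMeasure (Eventually.of_forall hf)
    (tendstoInMeasure_of_tendsto_Lp hfg) fun j => Lp.aestronglyMeasurable (f j)

theorem exists_tendsto_integral_mul_of_eLpNorm_le [IsFiniteMeasure μ] {g : ℕ → α → ℝ}
    (hg : ∀ j, AEStronglyMeasurable (g j) μ)
    (hC : ∀ p : ℕ, p ≠ 0 → ∃ C : NNReal, ∀ j, eLpNorm (g j) p μ ≤ C) :
    ∃ G : α → ℝ, (∀ p : ℝ≥0∞, p ≠ ⊤ → MemLp G p μ) ∧ ∀ φ : α → ℝ, MemLp φ 2 μ →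
      Tendsto (fun j => ∫ x, g j x * φ x ∂μ) (hyperfilter ℕ : Filter ℕ)
        (𝓝 (∫ x, G x * φ x ∂μ)) := by
  obtain ⟨C₂, hC₂⟩ := hC 2 two_ne_zero
  have hgL (j : ℕ) : MemLp (g j) 2 μ := ⟨hg j, (hC₂ j).trans_lt ENNReal.coe_lt_top⟩
  have hnorm (j : ℕ) : ‖(hgL j).toLp (g j)‖ ≤ C₂ := by
    rw [Lp.norm_toLp]
    exact ENNReal.toReal_le_coe_of_le_coe (hC₂ j)
  obtain ⟨G, hG⟩ := exists_tendsto_inner_of_norm_le hnorm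
  refine ⟨G, fun p hp => ?_, fun φ hφ => ?_⟩
  · obtain ⟨n, hn⟩ := ENNReal.exists_nat_gt hp
    obtain ⟨C, hCn⟩ := hC (n + 1) n.succ_ne_zero
    have hmem : eLpNorm G (n + 1 : ℕ) μ ≤ C :=
      mem_of_tendsto_inner (convex_setOf_eLpNorm_le (by norm_cast; omega) C)
        (isClosed_setOf_eLpNorm_le _ _)
        (fun j => (eLpNorm_congr_ae (hgL j).coeFn_toLp).trans_le (hCn j)) hG
    exact MemLp.mono_exponent ⟨Lp.aestronglyMeasurable G, hmem.trans_lt ENNReal.coe_lt_top⟩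
      (hn.le.trans (by exact_mod_cast n.le_succ))
  · have hinner {f : α → ℝ} {f₂ : Lp ℝ 2 μ} (hf : f₂ =ᵐ[μ] f) :
        inner ℝ f₂ (hφ.toLp φ) = ∫ x, f x * φ x ∂μ := by
      rw [L2.inner_def]
      refine integral_congr_ae ?_
      filter_upwards [hf, hφ.coeFn_toLp] with x hfx hφx
      rw [hfx, hφx, real_inner_eq_re_inner, RCLike.inner_apply', RCLike.re_to_real]
      simp
    rw [← hinner EventuallyEq.rfl]
    exact (hG (hφ.toLp φ)).congr fun j => hinner (hgL j).coeFn_toLp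

end WeakLimit

section Sobolev

variable {d : ℕ}

theorem TorusC1.mul {f g : 𝕋 d → ℝ} {f' g' : 𝕋 d → Euc d →L[ℝ] ℝ} (hf : TorusC1 f f')
    (hg : TorusC1 g g') : TorusC1 (fun y => f y * g y) (fun y => f y • g' y + g y • f' y) where
  continuous_deriv :=
    (hf.continuous.smul hg.continuous_deriv).add (hg.continuous.smul hf.continuous_deriv)
  hasFDerivAt_zero y := by simpa using! (hf.hasFDerivAt_zero y).mul (hg.hasFDerivAt_zero y)

theorem TorusC1.apply {f : 𝕋 d → Euc d} {f' : 𝕋 d → Euc d →L[ℝ] Euc d} (hf : TorusC1 f f')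
    (i : Fin d) :
    TorusC1 (fun y => f y i) fun y => (EuclideanSpace.proj i : Euc d →L[ℝ] ℝ).comp (f' y) where
  continuous_deriv := continuous_const.clm_comp hf.continuous_deriv
  hasFDerivAt_zero y :=
    (EuclideanSpace.proj i : Euc d →L[ℝ] ℝ).hasFDerivAt.comp 0 (hf.hasFDerivAt_zero y)

theorem TorusC1.integral_deriv_eq_zero {f : 𝕋 d → ℝ} {f' : 𝕋 d → Euc d →L[ℝ] ℝ}
    (hf : TorusC1 f f') (j : Fin d) : ∫ y, f' y (EuclideanSpace.single j 1) = 0 := by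
  let shift (s : ℝ) : 𝕋 d := Pi.single j (s : UnitAddCircle)
  have hcont := hf.continuous
  have hcont' : Continuous fun y => f' y (EuclideanSpace.single j 1) :=
    hf.continuous_deriv.clm_apply continuous_const
  obtain ⟨C, hC⟩ := exists_forall_norm_le_of_continuous hcont'
  have hderiv := (hasDerivAt_integral_of_dominated_loc_of_deriv_le (μ := volume) (x₀ := 0)
    (F := fun s y => f (y + shift s))
    (F' := fun s y => f' (y + shift s) (EuclideanSpace.single j 1)) univ_mem
    (Eventually.of_forall fun s => (hcont.comp (continuous_add_const _)).aestronglyMeasurable)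
    (integrable_of_continuous (hcont.comp (continuous_add_const _)))
    (hcont'.comp (continuous_add_const _)).aestronglyMeasurable
    (ae_of_all _ fun y s _ => hC (y + shift s)) (integrable_const C)
    (ae_of_all _ fun y s _ => hf.hasDerivAt_add_single j y s)).2
  simp only [integral_add_right_eq_self f] at hderiv
  simpa [shift] using hderiv.unique (hasDerivAt_const _ _)

theorem TorusC1.integral_mul_deriv {f g : 𝕋 d → ℝ} {f' g' : 𝕋 d → Euc d →L[ℝ] ℝ}
    (hf : TorusC1 f f') (hg : TorusC1 g g') (j : Fin d) :
    ∫ y, f y * g' y (EuclideanSpace.single j 1) =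
      -∫ y, f' y (EuclideanSpace.single j 1) * g y := by
  have hprod := (hf.mul hg).integral_deriv_eq_zero j
  simp only [add_apply, smul_apply, smul_eq_mul] at hprod
  have hfg' : Integrable fun y => f y * g' y (EuclideanSpace.single j 1) :=
    integrable_of_continuous
      (hf.continuous.mul (hg.continuous_deriv.clm_apply continuous_const))
  have hgf' : Integrable fun y => g y * f' y (EuclideanSpace.single j 1) :=
    integrable_of_continuous
      (hg.continuous.mul (hf.continuous_deriv.clm_apply continuous_const))
  rw [integral_add hfg' hgf'] at hprod
  simp only [mul_comm (g _)] at hprod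
  exact eq_neg_of_add_eq_zero_left hprod

theorem tendsto_integral_mul_of_tendstoUniformly {u : ℕ → 𝕋 d → ℝ} (hu : ∀ j, Continuous (u j))
    {v : 𝕋 d → ℝ} (hlim : TendstoUniformly u v atTop) {φ : 𝕋 d → ℝ} (hφ : Continuous φ) :
    Tendsto (fun j => ∫ x, u j x * φ x) atTop (𝓝 (∫ x, v x * φ x)) := by
  obtain ⟨C, hC⟩ := exists_forall_norm_le_of_continuous
    (hlim.continuous (Frequently.of_forall hu))
  refine tendsto_integral_filter_of_dominated_convergence (fun x => (C + 1) * ‖φ x‖)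
    (Eventually.of_forall fun j => ((hu j).mul hφ).aestronglyMeasurable) ?_
    (integrable_of_continuous (continuous_const.mul hφ.norm))
    (ae_of_all _ fun x => (hlim.tendsto_at x).mul_const (φ x))
  filter_upwards [Metric.tendstoUniformly_iff.1 hlim 1 one_pos] with j hj
  refine ae_of_all _ fun x => ?_
  rw [norm_mul]
  gcongr
  calc ‖u j x‖ ≤ ‖v x‖ + ‖v x - u j x‖ := norm_le_norm_add_norm_sub _ _
    _ ≤ C + 1 := add_le_add (hC x) (by simpa [dist_eq_norm] using (hj x).le)

theorem hasWeakPartial_of_tendsto {u : ℕ → 𝕋 d → ℝ} {u' : ℕ → 𝕋 d → Euc d →L[ℝ] ℝ}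
    (hu : ∀ j, TorusC1 (u j) (u' j)) {v G : 𝕋 d → ℝ} (hlim : TendstoUniformly u v atTop)
    (hG : Integrable G) {i : Fin d}
    (hG_lim : ∀ φ : 𝕋 d → ℝ, Continuous φ →
      Tendsto (fun j => ∫ x, u' j x (EuclideanSpace.single i 1) * φ x)
        (hyperfilter ℕ : Filter ℕ) (𝓝 (∫ x, G x * φ x))) :
    HasWeakPartial i v G := by
  have hv : Continuous v := hlim.continuous (Frequently.of_forall fun j => (hu j).continuous)
  refine ⟨integrable_of_continuous hv, hG, fun φ hφ => ?_⟩
  have hφ' : Continuous fun y => torusFDeriv φ y (EuclideanSpace.single i 1) :=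
    hφ.torusC1.continuous_deriv.clm_apply continuous_const
  have hleft : Tendsto (fun j => ∫ y, u j y * torusFDeriv φ y (EuclideanSpace.single i 1)) atTop
      (𝓝 (∫ y, v y * torusFDeriv φ y (EuclideanSpace.single i 1))) :=
    tendsto_integral_mul_of_tendstoUniformly (fun j => (hu j).continuous) hlim hφ'
  simp only [hφ.torusC1.torusPartial_eq]
  refine tendsto_nhds_unique (hleft.mono_left Nat.hyperfilter_le_atTop)
    ((hG_lim φ hφ.torusC1.continuous).neg.congr fun j => ?_)
  exact ((hu j).integral_mul_deriv hφ.torusC1 i).symm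

theorem memW1p_of_tendsto {u : ℕ → 𝕋 d → Euc d} {u' : ℕ → 𝕋 d → Euc d →L[ℝ] Euc d}
    (hu : ∀ j, TorusC1 (u j) (u' j)) {v : 𝕋 d → Euc d} (hlim : TendstoUniformly u v atTop)
    (hC : ∀ p : ℕ, p ≠ 0 → ∃ C : NNReal, ∀ j, eLpNorm (u' j) p volume ≤ C) {p : ℝ≥0∞}
    (hp : p ≠ ⊤) : MemW1p p v := by
  have hv : Continuous v := hlim.continuous (Frequently.of_forall fun j => (hu j).continuous)
  have hentry (a c : Fin d) := exists_tendsto_integral_mul_of_eLpNorm_le (μ := volume)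
    (g := fun j y => (EuclideanSpace.proj a : Euc d →L[ℝ] ℝ).comp (u' j y)
      (EuclideanSpace.single c 1))
    (fun j => (((hu j).apply a).continuous_deriv.clm_apply
      continuous_const).aestronglyMeasurable)
    fun n hn => (hC n hn).imp fun C hCn j => (eLpNorm_mono fun y => ?_).trans (hCn j)
  · choose G hG hG_lim using hentry
    refine ⟨hv.memLp_of_hasCompactSupport (HasCompactSupport.of_compactSpace _),
      fun y => Matrix.of fun a c => G a c y, fun a c => ?_, fun a c => hG a c p hp⟩
    refine hasWeakPartial_of_tendsto (fun j => (hu j).apply a) ?_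
      (memLp_one_iff_integrable.1 (hG a c 1 ENNReal.one_ne_top)) fun φ hφ => hG_lim a c φ
        (hφ.memLp_of_hasCompactSupport (HasCompactSupport.of_compactSpace _))
    exact (EuclideanSpace.proj a : Euc d →L[ℝ] ℝ).uniformContinuous.comp_tendstoUniformly hlim
  · calc ‖(u' j y (EuclideanSpace.single c 1)) a‖ ≤ ‖u' j y (EuclideanSpace.single c 1)‖ :=
          PiLp.norm_apply_le _ a
      _ ≤ ‖u' j y‖ := by simpa using (u' j y).le_opNorm (EuclideanSpace.single c 1)

end Sobolev

/-! ### The Euler scheme -/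

section Euler

variable {d : ℕ} {T L : ℝ} {C : ℝ → NNReal} {b : ℝ → 𝕋 d → Euc d}
  {D : ℝ → 𝕋 d → Matrix (Fin d) (Fin d) ℝ} {h : ℝ}

/-- The `k`-th interval of the partition of the half-line into steps of length `h`. -/
def timeStep (h : ℝ) (k : ℕ) : Set ℝ := Ioc (k * h) ((k + 1 : ℕ) * h)

theorem timeStep_subset_Icc (hh : 0 ≤ h) {k : ℕ} (hk : (k + 1 : ℕ) * h ≤ T) :
    timeStep h k ⊆ Icc 0 T :=
  Ioc_subset_Icc_self.trans (Icc_subset_Icc (by positivity) hk)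

theorem volume_timeStep (h : ℝ) (k : ℕ) : volume (timeStep h k) = ENNReal.ofReal h := by
  rw [timeStep, Real.volume_Ioc]
  congr 1
  push_cast
  ring

theorem natCeil_div_eq_of_mem_timeStep (hh : 0 < h) {k : ℕ} {s : ℝ} (hs : s ∈ timeStep h k) :
    ⌈s / h⌉₊ = k + 1 := by
  rw [Nat.ceil_eq_iff k.succ_ne_zero, lt_div_iff₀ hh, div_le_iff₀ hh]
  exact hs

theorem natCeil_div_sub_one_mul_mem_Icc (hh : 0 < h) {s : ℝ} (hs : 0 ≤ s) :
    ((⌈s / h⌉₊ - 1 : ℕ) : ℝ) * h ∈ Icc (s - h) s := by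
  have hle : s ≤ ⌈s / h⌉₊ * h := (div_le_iff₀ hh).1 (Nat.le_ceil _)
  have hlt : ⌈s / h⌉₊ * h < s + h := by
    rw [← lt_div_iff₀ hh, add_div, div_self hh.ne']
    exact Nat.ceil_lt_add_one (by positivity)
  rcases Nat.eq_zero_or_pos ⌈s / h⌉₊ with hzero | hpos
  · rw [hzero] at hle ⊢
    norm_num at hle ⊢
    exact ⟨by linarith, hs⟩
  · rw [Nat.cast_sub hpos, Nat.cast_one, sub_one_mul]
    exact ⟨by linarith, by linarith⟩

/-- The displacement of the `k`-th step of the Euler scheme with time step `h`, for the field `b`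
mollified in space at scale `N`. -/
noncomputable def eulerStep (b : ℝ → 𝕋 d → Euc d) (N : ℕ) (h : ℝ) (k : ℕ) : 𝕋 d → Euc d :=
  torusConv (mollifier N) (timeIntegral b (timeStep h k))

/-- The derivative of `eulerStep`. -/
noncomputable def eulerStepDeriv (b : ℝ → 𝕋 d → Euc d) (N : ℕ) (h : ℝ) (k : ℕ) :
    𝕋 d → Euc d →L[ℝ] Euc d :=
  torusConvDeriv (mollifier N) (timeIntegral b (timeStep h k))

/-- The piecewise constant curve through the nodes of the Euler scheme. On the time step `k` it
takes the value of the node `k`, since there `⌈s / h⌉₊ = k + 1`. -/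
noncomputable def eulerNode (b : ℝ → 𝕋 d → Euc d) (N : ℕ) (h : ℝ) (x : 𝕋 d) (s : ℝ) : Euc d :=
  compDisp (eulerStep b N h) (⌈s / h⌉₊ - 1) x

/-- The continuous curve through the nodes of the Euler scheme. -/
noncomputable def eulerCurve (b : ℝ → 𝕋 d → Euc d) (N : ℕ) (h : ℝ) (x : 𝕋 d) (t : ℝ) : Euc d :=
  ∫ s in (0 : ℝ)..t, torusConv (mollifier N) (b s) (x + torusProj (eulerNode b N h x s))

theorem measurable_eulerNode (b : ℝ → 𝕋 d → Euc d) (N : ℕ) (h : ℝ) (x : 𝕋 d) :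
    Measurable (eulerNode b N h x) :=
  (measurable_from_top (f := fun k : ℕ => compDisp (eulerStep b N h) (k - 1) x)).comp
    (Nat.measurable_ceil.comp (measurable_id.div_const h))

theorem ExpField.integrableOn_euler (H : ExpField T L C b D) (N : ℕ) (h : ℝ) (x : 𝕋 d) :
    IntegrableOn (fun s => torusConv (mollifier N) (b s) (x + torusProj (eulerNode b N h x s)))
      (Icc 0 T) :=
  H.integrableOn_torusConv N x (measurable_eulerNode b N h x).aestronglyMeasurable

theorem ExpField.continuousOn_eulerCurve (H : ExpField T L C b D) (N : ℕ) (h : ℝ) (x : 𝕋 d) :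
    ContinuousOn (eulerCurve b N h x) (Icc 0 T) :=
  continuousOn_integral_of_integrableOn_Icc (H.integrableOn_euler N h x)

theorem ExpField.eulerCurve_sub_eulerCurve (H : ExpField T L C b D) (N : ℕ) (h : ℝ) (x : 𝕋 d)
    {a t : ℝ} (ha : a ∈ Icc 0 T) (ht : t ∈ Icc 0 T) :
    eulerCurve b N h x t - eulerCurve b N h x a =
      ∫ s in a..t, torusConv (mollifier N) (b s) (x + torusProj (eulerNode b N h x s)) :=
  have h0 : (0 : ℝ) ∈ Icc 0 T := ⟨le_rfl, ha.1.trans ha.2⟩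
  intervalIntegral.integral_interval_sub_left
    (intervalIntegrable_of_integrableOn_Icc (H.integrableOn_euler N h x) h0 ht)
    (intervalIntegrable_of_integrableOn_Icc (H.integrableOn_euler N h x) h0 ha)

theorem ExpField.eulerCurve_natCast_mul (H : ExpField T L C b D) (hh : 0 < h) (N : ℕ) (x : 𝕋 d)
    (k : ℕ) (hk : k * h ≤ T) : eulerCurve b N h x (k * h) = compDisp (eulerStep b N h) k x := by
  induction k with
  | zero => simp [eulerCurve, compDisp]
  | succ k ih =>
    have hstep : (k : ℝ) * h ≤ (k + 1 : ℕ) * h := by gcongr; simp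
    have hk_mem : (k : ℝ) * h ∈ Icc 0 T := ⟨by positivity, hstep.trans hk⟩
    rw [← sub_add_cancel (eulerCurve b N h x _) (eulerCurve b N h x (k * h)),
      H.eulerCurve_sub_eulerCurve N h x hk_mem ⟨by positivity, hk⟩, ih hk_mem.2, add_comm,
      intervalIntegral.integral_of_le hstep]
    simp only [compDisp, eulerStep, H.torusConv_timeIntegral (timeStep_subset_Icc hh.le hk)]
    congr 1
    refine setIntegral_congr_fun measurableSet_Ioc fun s hs => ?_
    simp only [eulerNode, natCeil_div_eq_of_mem_timeStep hh hs, Nat.add_sub_cancel]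

theorem ExpField.exists_norm_eulerNode_sub_eulerCurve_le (H : ExpField T L C b D) (N : ℕ) {η : ℝ}
    (hη : 0 < η) : ∃ δ > 0, ∀ h, 0 < h → h ≤ δ → ∀ x, ∀ s ∈ Icc 0 T,
      ‖eulerNode b N h x s - eulerCurve b N h x s‖ ≤ η := by
  obtain ⟨M, hM⟩ := exists_forall_norm_le_of_continuous (continuous_mollifier (d := d) N)
  have hbound := H.integrableOn_integral_norm.const_mul M
  obtain ⟨δ, hδ, hsmall⟩ := exists_norm_integral_le_of_abs_sub_le hbound hη
  refine ⟨δ, hδ, fun h hh hhδ x s hs => ?_⟩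
  obtain ⟨hsub, hle⟩ := natCeil_div_sub_one_mul_mem_Icc hh hs.1
  set a : ℝ := (⌈s / h⌉₊ - 1 : ℕ) * h
  have ha_mem : a ∈ Icc 0 T := ⟨by positivity, hle.trans hs.2⟩
  calc ‖eulerNode b N h x s - eulerCurve b N h x s‖
      = ‖∫ r in a..s, torusConv (mollifier N) (b r) (x + torusProj (eulerNode b N h x r))‖ := by
        rw [← H.eulerCurve_sub_eulerCurve N h x ha_mem hs, norm_sub_rev, eulerNode,
          H.eulerCurve_natCast_mul hh N x _ ha_mem.2]
    _ ≤ ∫ r in a..s, M * ∫ y, ‖b r y‖ :=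
        intervalIntegral.norm_integral_le_of_norm_le hle (ae_of_all _ fun r hr =>
          norm_torusConv_le hM (H.integrable_apply ⟨ha_mem.1.trans hr.1.le, hr.2.trans hs.2⟩) _)
          (intervalIntegrable_of_integrableOn_Icc hbound ha_mem hs)
    _ ≤ η := (Real.le_norm_self _).trans
        (hsmall a ha_mem s hs (by rw [abs_of_nonneg (by linarith)]; linarith))

theorem ExpField.exists_norm_torusConv_sub_contRep_add_le (H : ExpField T L C b D) {ε : ℝ}
    (hε : 0 < ε) : ∃ N, ∃ η > 0, ∀ t ∈ Icc 0 T, ∀ x v w, ‖v - w‖ ≤ η →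
      ‖torusConv (mollifier N) (b t) (x + torusProj v) - contRep (b t) (x + torusProj w)‖ ≤ ε := by
  obtain ⟨B, A₀, -, hA₀, hmodulus⟩ := H.exists_hasMollifiedModulus one_pos
  obtain ⟨A, hA, hAε⟩ := exists_ge_mul_exp_neg_mul_le one_pos B A₀ (show 0 < ε / 3 by positivity)
  have hA_nonneg := hA₀.trans hA
  obtain ⟨N, hN⟩ := H.exists_norm_torusConv_sub_contRep_le (show 0 < ε / 3 by positivity)
  refine ⟨N, ε / 3 / (A + 1), by positivity, fun t ht x v w hvw => ?_⟩
  have hmod := (hmodulus t ht).hasAffineModulus_contRep hA (x + torusProj w) (v - w)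
  rw [add_assoc, ← torusProj_add, add_sub_cancel] at hmod
  have hlip : A * ‖v - w‖ ≤ ε / 3 := by
    rw [le_div_iff₀ (by positivity)] at hvw
    nlinarith [norm_nonneg (v - w)]
  linarith [hN N le_rfl t ht (x + torusProj v), norm_sub_le_norm_sub_add_norm_sub
    (torusConv (mollifier N) (b t) (x + torusProj v)) (contRep (b t) (x + torusProj v))
    (contRep (b t) (x + torusProj w))]

theorem ExpField.exists_isApproxSol_eulerCurve (H : ExpField T L C b D) (hT : 0 ≤ T) {e : ℝ}
    (he : 0 < e) : ∃ N, ∃ δ > 0, ∀ h, 0 < h → h ≤ δ → ∀ x,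
      IsApproxSol T (fun s => contRep (b s)) e x (eulerCurve b N h x) := by
  obtain ⟨N, η, hη, hfield⟩ :=
    H.exists_norm_torusConv_sub_contRep_add_le (show 0 < e / (T + 1) by positivity)
  obtain ⟨δ, hδ, hnode⟩ := H.exists_norm_eulerNode_sub_eulerCurve_le N hη
  refine ⟨N, δ, hδ, fun h hh hhδ x => ⟨H.continuousOn_eulerCurve N h x, fun t ht => ?_⟩⟩
  have h0 : (0 : ℝ) ∈ Icc 0 T := ⟨le_rfl, hT⟩
  have hsub := intervalIntegral.integral_sub
    (intervalIntegrable_of_integrableOn_Icc (H.integrableOn_euler N h x) h0 ht)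
    (H.intervalIntegrable_contRep x (H.continuousOn_eulerCurve N h x) h0 ht)
  calc ‖eulerCurve b N h x t - ∫ s in (0 : ℝ)..t, contRep (b s)
        (x + torusProj (eulerCurve b N h x s))‖
      ≤ e / (T + 1) * |t - 0| := by
        rw [eulerCurve, ← hsub]
        refine intervalIntegral.norm_integral_le_of_norm_le_const fun s hs => ?_
        rw [uIoc_of_le ht.1] at hs
        have hs_mem : s ∈ Icc 0 T := ⟨hs.1.le, hs.2.trans ht.2⟩
        exact hfield s hs_mem x _ _ (hnode h hh hhδ x s hs_mem)
    _ ≤ e := by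
        rw [sub_zero, abs_of_nonneg ht.1, div_mul_eq_mul_div, div_le_iff₀ (by positivity)]
        exact mul_le_mul_of_nonneg_left (by linarith [ht.2]) he.le

theorem TorusC1.lintegral_comp_add_torusProj_le_exp {W : 𝕋 d → Euc d}
    {W' : 𝕋 d → Euc d →L[ℝ] Euc d} (hW : TorusC1 W W') {r s : ℝ} (hr1 : r < 1)
    (hr : ∀ y, ‖W' y‖ ≤ r) (hs0 : 0 ≤ s) (hs : s ≤ 1 / 2)
    (hdet : ∀ y, 1 - s ≤ (ContinuousLinearMap.id ℝ (Euc d) + W' y).det) {g : 𝕋 d → ℝ≥0∞}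
    (hg : Measurable g) :
    ∫⁻ y, g (y + torusProj (W y)) ≤ ENNReal.ofReal (Real.exp (2 * s)) * ∫⁻ y, g y := by
  have hs_pos : 0 < 1 - s := by linarith
  refine (hW.lintegral_comp_add_torusProj_le hr1 hr hs_pos hdet hg).trans ?_
  gcongr
  calc (1 - s)⁻¹ ≤ 2 * s + 1 := by
        rw [inv_le_iff_one_le_mul₀ hs_pos]
        nlinarith
    _ ≤ Real.exp (2 * s) := Real.add_one_le_exp _

/- `det (1 + A) ≥ 1 + tr A - ε ‖A‖`: the trace of the gradient of the step is controlled by the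
divergence, uniformly in the mollification, and the error is absorbed by the short time. -/
theorem ExpField.exists_lintegral_comp_add_torusConv_timeIntegral_le (H : ExpField T L C b D)
    (N : ℕ) : ∃ δ > 0, ∀ S ⊆ Icc 0 T, volume.real S ≤ δ → ∀ g : 𝕋 d → ℝ≥0∞, Measurable g →
      ∫⁻ x, g (x + torusProj (torusConv (mollifier N) (timeIntegral b S) x)) ≤
        ENNReal.ofReal (Real.exp (2 * (volume.real S * (|L| + 1)))) * ∫⁻ x, g x := by
  obtain ⟨R, hR_nonneg, hR⟩ := H.exists_norm_torusConvDeriv_le N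
  obtain ⟨δ, hδ, hdet⟩ :=
    exists_one_add_trace_sub_le_det_id_add (E := Euc d) (show 0 < 1 / (R + 1) by positivity)
  refine ⟨min δ (1 / 2) / (R + |L| + 1), by positivity, fun S hS hSδ g hg => ?_⟩
  have hm := measureReal_nonneg (μ := volume) (s := S)
  set m := volume.real S
  rw [le_div_iff₀ (by positivity), le_min_iff] at hSδ
  have hmR : m * R ≤ m * (R + |L| + 1) := by gcongr; linarith [abs_nonneg L]
  have hmL : m * (|L| + 1) ≤ m * (R + |L| + 1) := by gcongr; linarith
  have hnorm := H.norm_torusConvDeriv_timeIntegral_le hS hR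
  refine (torusC1_torusConv (torusSmooth_mollifier N).torusC1
    (H.integrable_timeIntegral hS)).lintegral_comp_add_torusProj_le_exp (by linarith) hnorm
    (by positivity) (by linarith) (fun x => ?_) hg
  set A := torusConvDeriv (mollifier N) (timeIntegral b S) x
  have htrace := (abs_le.1 (H.abs_trace_torusConvDeriv_timeIntegral_le hS N x)).1
  have hL : m * L ≤ m * |L| := mul_le_mul_of_nonneg_left (le_abs_self L) hm
  have herror : 1 / (R + 1) * ‖A‖ ≤ m := by
    rw [one_div_mul_eq_div, div_le_iff₀ (by positivity)]
    linarith [hnorm x]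
  linarith [hdet A ((hnorm x).trans (hmR.trans hSδ.1))]

theorem natCast_succ_mul_le (hh : 0 ≤ h) {k n : ℕ} (hk : k < n) (hn : n * h = T) :
    (k + 1 : ℕ) * h ≤ T := by
  rw [← hn]
  gcongr
  exact hk

theorem ExpField.torusC1_eulerStep (H : ExpField T L C b D) (hh : 0 ≤ h) (N : ℕ) {k : ℕ}
    (hk : (k + 1 : ℕ) * h ≤ T) : TorusC1 (eulerStep b N h k) (eulerStepDeriv b N h k) :=
  torusC1_torusConv (torusSmooth_mollifier N).torusC1
    (H.integrable_timeIntegral (timeStep_subset_Icc hh hk))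

theorem ExpField.lintegral_exp_norm_eulerStepDeriv_le (H : ExpField T L C b D) (hh : 0 < h)
    (N : ℕ) {k : ℕ} (hk : (k + 1 : ℕ) * h ≤ T) {β : ℝ} (hβ : 0 ≤ β) :
    ∫⁻ x, ENNReal.ofReal (Real.exp (β * ‖eulerStepDeriv b N h k x‖)) ≤
      C (β * h * (d : ℝ) ^ 2) := by
  have hvol := volume_timeStep h k
  have hmoment := H.lintegral_exp_norm_torusConvDeriv_timeIntegral_le
    (timeStep_subset_Icc hh.le hk) (by simp [hvol, hh]) N hβ
  rwa [measureReal_def, hvol, ENNReal.toReal_ofReal hh.le] at hmoment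

/- A step compresses volume by at most `exp (O(h))` and its derivative has exponential moments of
order `O(1 / h)`, so that the bounds over `T / h` steps do not depend on `N` and `h`. -/
theorem ExpField.exists_lintegral_norm_compDispDeriv_euler_pow_le (H : ExpField T L C b D)
    (N : ℕ) : ∃ δ > 0, ∀ (n p : ℕ) (h : ℝ), 0 < n → 0 < h → h ≤ δ → n * h = T →
      ∫⁻ x, ENNReal.ofReal (‖compDispDeriv (eulerStep b N h) (eulerStepDeriv b N h) n x‖ ^ p) ≤
        ENNReal.ofReal (Real.exp (2 * (T * (|L| + 1)))) * C (p * T * (d : ℝ) ^ 2) := by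
  obtain ⟨δ, hδ, hcompress⟩ := H.exists_lintegral_comp_add_torusConv_timeIntegral_le N
  refine ⟨δ, hδ, fun n p h hn hh hhδ hnh => ?_⟩
  have hk {k : ℕ} (hk : k < n) := natCast_succ_mul_le hh.le hk hnh
  have hvol (k : ℕ) : volume.real (timeStep h k) = h := by
    rw [measureReal_def, volume_timeStep, ENNReal.toReal_ofReal hh.le]
  set q := ENNReal.ofReal (Real.exp (2 * (h * (|L| + 1)))) with hq
  have hstep (k : ℕ) (hkn : k < n) (g : 𝕋 d → ℝ≥0∞) (hg : Measurable g) :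
      ∫⁻ x, g (x + torusProj (eulerStep b N h k x)) ≤ q * ∫⁻ x, g x := by
    have hbound := hcompress (timeStep h k) (timeStep_subset_Icc hh.le (hk hkn))
      ((hvol k).trans_le hhδ) g hg
    rwa [hvol] at hbound
  have hmoment (k : ℕ) (hkn : k < n) :
      ∫⁻ x, ENNReal.ofReal (Real.exp (n * p * ‖eulerStepDeriv b N h k x‖)) ≤
        C (p * T * (d : ℝ) ^ 2) := by
    have hexp := H.lintegral_exp_norm_eulerStepDeriv_le hh N (hk hkn)
      (by positivity : (0 : ℝ) ≤ n * p)
    rwa [mul_comm (n : ℝ), mul_assoc (p : ℝ), hnh, mul_comm (p : ℝ) n] at hexp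
  have hq_one : 1 ≤ q := ENNReal.one_le_ofReal.2 (Real.one_le_exp (by positivity))
  have hq_pow : q ^ n = ENNReal.ofReal (Real.exp (2 * (T * (|L| + 1)))) := by
    rw [hq, ← ENNReal.ofReal_pow (Real.exp_pos _).le, ← Real.exp_nat_mul, ← hnh]
    congr 2
    ring
  rw [← hq_pow]
  exact lintegral_norm_compDispDeriv_pow_le hn
    (fun k hkn => H.torusC1_eulerStep hh.le N (hk hkn)) hq_one hstep hmoment

theorem ExpField.exists_isApproxSol_torusC1 (H : ExpField T L C b D) (hT : 0 < T) {e : ℝ}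
    (he : 0 < e) : ∃ (w : 𝕋 d → ℝ → Euc d) (u' : 𝕋 d → Euc d →L[ℝ] Euc d),
      (∀ x, IsApproxSol T (fun s => contRep (b s)) e x (w x)) ∧ TorusC1 (w · T) u' ∧
        ∀ p : ℕ, ∫⁻ x, ENNReal.ofReal (‖u' x‖ ^ p) ≤
          ENNReal.ofReal (Real.exp (2 * (T * (|L| + 1)))) * C (p * T * (d : ℝ) ^ 2) := by
  obtain ⟨N, δ₁, hδ₁, happrox⟩ := H.exists_isApproxSol_eulerCurve hT.le he
  obtain ⟨δ₂, hδ₂, hpow⟩ := H.exists_lintegral_norm_compDispDeriv_euler_pow_le N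
  obtain ⟨n, hnδ, hn⟩ := (((tendsto_const_div_atTop_nhds_zero_nat T).eventually
    (ge_mem_nhds (lt_min hδ₁ hδ₂))).and (eventually_gt_atTop 0)).exists
  have hh : 0 < T / n := by positivity
  have hnh : n * (T / n) = T := by field_simp
  refine ⟨eulerCurve b N (T / n), _, happrox _ hh (hnδ.trans (min_le_left _ _)), ?_,
    fun p => hpow n p _ hn hh (hnδ.trans (min_le_right _ _)) hnh⟩
  have hnode : (eulerCurve b N (T / n) · T) = compDisp (eulerStep b N (T / n)) n := by
    funext x
    rw [← H.eulerCurve_natCast_mul hh N x n hnh.le, hnh]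
  rw [hnode]
  exact torusC1_compDisp
    (fun k hk => H.torusC1_eulerStep hh.le N (natCast_succ_mul_le hh.le hk hnh)) le_rfl

theorem eLpNorm_natCast_le_of_lintegral_pow_le {α E : Type*} [MeasurableSpace α] {μ : Measure α}
    [NormedAddCommGroup E] {f : α → E} {p : ℕ} (hp : p ≠ 0) {M : NNReal}
    (hM : ∫⁻ x, ENNReal.ofReal (‖f x‖ ^ p) ∂μ ≤ M) :
    eLpNorm f p μ ≤ (M ^ (1 / p : ℝ) : NNReal) := by
  rw [eLpNorm_eq_lintegral_rpow_enorm_toReal (by exact_mod_cast hp) (ENNReal.natCast_ne_top p),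
    ENNReal.toReal_natCast, ENNReal.coe_rpow_of_nonneg _ (by positivity)]
  gcongr
  simpa only [ENNReal.ofReal_pow (norm_nonneg _), ofReal_norm, ENNReal.rpow_natCast] using hM

theorem MemW1p.zero (p : ℝ≥0∞) : MemW1p p (fun _ : 𝕋 d => (0 : Euc d)) :=
  ⟨MemLp.zero, fun _ => 0, fun _ _ => ⟨by simp, by simp, by simp⟩, fun _ _ => by simp⟩

theorem ExpField.exists_flow (H : ExpField T L C b D) (hT : 0 ≤ T) :
    ∃ v : 𝕋 d → ℝ → Euc d, (∀ x, IsApproxSol T (fun s => contRep (b s)) 0 x (v x)) ∧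
      Continuous (v · T) ∧ ∀ p : ℝ≥0∞, p ≠ ⊤ → MemW1p p (v · T) := by
  rcases hT.eq_or_lt with rfl | hT_pos
  · refine ⟨fun _ _ => 0, fun x => ⟨continuousOn_const, fun t ht => ?_⟩, continuous_const,
      fun p _ => MemW1p.zero p⟩
    simp [le_antisymm ht.2 ht.1]
  choose w u' happrox hC1 hpow using fun j : ℕ =>
    H.exists_isApproxSol_torusC1 hT_pos (show (0 : ℝ) < 1 / (j + 1) by positivity)
  obtain ⟨v, hv, hlim⟩ := H.exists_tendstoUniformlyOn hT (w := w) fun e he =>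
    (tendsto_one_div_add_atTop_nhds_zero_nat.eventually (ge_mem_nhds he)).mono
      fun j hj x => (happrox j x).mono hj
  have hlimT : TendstoUniformly (fun j => (w j · T)) (v · T) atTop :=
    tendstoUniformlyOn_univ.1 ((hlim.comp fun x => (x, T)).mono fun x _ => ⟨trivial, hT, le_rfl⟩)
  refine ⟨v, hv, hlimT.continuous (Frequently.of_forall fun j => (hC1 j).continuous),
    fun p => memW1p_of_tendsto hC1 hlimT fun m hm => ?_⟩
  refine ⟨_, fun j => eLpNorm_natCast_le_of_lintegral_pow_le hm
    (M := (Real.exp (2 * (T * (|L| + 1)))).toNNReal * C (m * T * (d : ℝ) ^ 2)) ?_⟩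
  rw [ENNReal.coe_mul]
  exact hpow j m

end Euler

/-! ### Time reversal and the flow -/

section Flow

variable {d : ℕ}

theorem sub_mem_Icc_zero {t s : ℝ} (hs : s ∈ Icc 0 t) : t - s ∈ Icc 0 t :=
  ⟨sub_nonneg.2 hs.2, sub_le_self t hs.1⟩

theorem measurePreserving_sub_left_restrict_Icc (t : ℝ) :
    MeasurePreserving (fun s => t - s) (volume.restrict (Icc 0 t)) (volume.restrict (Icc 0 t)) := by
  simpa using (Measure.measurePreserving_sub_left volume t).restrict_preimage
    (measurableSet_Icc (a := 0) (b := t))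

theorem IsWeakGradient.neg {f : 𝕋 d → Euc d} {G : 𝕋 d → Matrix (Fin d) (Fin d) ℝ}
    (h : IsWeakGradient f G) : IsWeakGradient (fun y => -f y) fun y => -G y := by
  intro i j
  obtain ⟨hf, hG, hpartial⟩ := h i j
  refine ⟨hf.neg, hG.neg, fun φ hφ => ?_⟩
  simp only [PiLp.neg_apply, Matrix.neg_apply, neg_mul, integral_neg]
  rw [hpartial φ hφ]

section Solution

variable {T : ℝ} {c : ℝ → 𝕋 d → Euc d} {x : 𝕋 d} {w : ℝ → Euc d} {t : ℝ}

theorem IsApproxSol.restrict {e : ℝ} (h : IsApproxSol T c e x w) (ht : t ≤ T) :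
    IsApproxSol t c e x w :=
  ⟨h.continuousOn.mono (Icc_subset_Icc_right ht),
    fun s hs => h.norm_sub_integral_le s ⟨hs.1, hs.2.trans ht⟩⟩

theorem IsApproxSol.eq_integral (h : IsApproxSol T c 0 x w) (ht : t ∈ Icc 0 T) :
    w t = ∫ s in (0 : ℝ)..t, c s (x + torusProj (w s)) :=
  sub_eq_zero.1 (norm_le_zero_iff.1 (h.norm_sub_integral_le t ht))

theorem IsApproxSol.reverse {c' : ℝ → 𝕋 d → Euc d} (h : IsApproxSol T c 0 x w)
    (hint : IntegrableOn (fun s => c s (x + torusProj (w s))) (Icc 0 T))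
    (hc : ∀ s ∈ Icc 0 T, ∀ y, c' s y = -c (T - s) y) :
    IsApproxSol T c' 0 (x + torusProj (w T)) fun s => w (T - s) - w T := by
  refine ⟨(h.continuousOn.comp (by fun_prop) fun _ => sub_mem_Icc_zero).sub continuousOn_const,
    fun t ht => ?_⟩
  have h0 : (0 : ℝ) ∈ Icc 0 T := ⟨le_rfl, ht.1.trans ht.2⟩
  have hT : T ∈ Icc 0 T := ⟨h0.2, le_rfl⟩
  have ht' := sub_mem_Icc_zero ht
  have hcongr : ∫ s in (0 : ℝ)..t, c' s (x + torusProj (w T) + torusProj (w (T - s) - w T)) =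
      ∫ s in (0 : ℝ)..t, -c (T - s) (x + torusProj (w (T - s))) := by
    refine intervalIntegral.integral_congr fun s hs => ?_
    rw [uIcc_of_le ht.1] at hs
    simp only [hc s ⟨hs.1, hs.2.trans ht.2⟩, torusProj_sub, add_assoc, add_sub_cancel]
  rw [hcongr, intervalIntegral.integral_neg,
    intervalIntegral.integral_comp_sub_left (fun s => c s (x + torusProj (w s))) T, sub_zero,
    h.eq_integral ht', h.eq_integral hT, ← intervalIntegral.integral_interval_sub_left
      (intervalIntegrable_of_integrableOn_Icc hint h0 hT)
      (intervalIntegrable_of_integrableOn_Icc hint h0 ht')]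
  simp

end Solution

variable {T L : ℝ} {C : ℝ → NNReal} {b : ℝ → 𝕋 d → Euc d}
  {D : ℝ → 𝕋 d → Matrix (Fin d) (Fin d) ℝ} {t : ℝ}

theorem ExpField.restrict (H : ExpField T L C b D) (ht : t ≤ T) : ExpField t L C b D := by
  have hsub : Icc 0 t ⊆ Icc 0 T := Icc_subset_Icc_right ht
  exact ⟨H.integrable_restrict hsub, fun s hs => H.isWeakGradient s (hsub hs),
    fun β hβ s hs => H.lintegral_exp_le β hβ s (hsub hs),
    ae_restrict_of_ae_restrict_of_subset hsub H.abs_trace_le⟩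

theorem ExpField.reverse (H : ExpField T L C b D) :
    ExpField T L C (fun s y => -b (T - s) y) fun s y => -D (T - s) y where
  integrable := (((measurePreserving_sub_left_restrict_Icc T).prod
    (.id volume)).integrable_comp_of_integrable H.integrable).neg
  isWeakGradient t ht := (H.isWeakGradient _ (sub_mem_Icc_zero ht)).neg
  lintegral_exp_le β hβ t ht := by
    simpa only [matrixAbs_neg] using H.lintegral_exp_le β hβ _ (sub_mem_Icc_zero ht)
  abs_trace_le := by
    simpa only [Matrix.trace_neg, abs_neg] using
      (measurePreserving_sub_left_restrict_Icc T).quasiMeasurePreserving.ae H.abs_trace_le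

theorem ExpField.eq_neg_of_isApproxSol_reverse (H : ExpField T L C b D) (hT : 0 ≤ T) {x : 𝕋 d}
    {w w' : ℝ → Euc d} (hw : IsApproxSol T (fun s => contRep (b s)) 0 x w)
    (hw' : IsApproxSol T (fun s => contRep fun y => -b (T - s) y) 0 (x + torusProj (w T)) w') :
    w' T = -w T := by
  have hw0 : w 0 = 0 := by simpa using hw.eq_integral ⟨le_rfl, hT⟩
  have hreverse := hw.reverse
    (H.integrableOn_contRep x (hw.continuousOn.aestronglyMeasurable measurableSet_Icc))
    fun s hs => H.contRep_neg (sub_mem_Icc_zero hs)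
  simpa [hw0] using H.reverse.eq_of_isApproxSol_zero hw' hreverse ⟨hT, le_rfl⟩

variable {v : 𝕋 d → ℝ → Euc d}

theorem ExpField.isFlow (H : ExpField T L C b D)
    (hv : ∀ x, IsApproxSol T (fun s => contRep (b s)) 0 x (v x)) :
    IsFlow T (fun s => contRep (b s)) fun t x => x + torusProj (v x t) := fun x =>
  ⟨H.integrableOn_contRep x ((hv x).continuousOn.aestronglyMeasurable measurableSet_Icc),
    fun _ ht => by rw [← (hv x).eq_integral ht]⟩

theorem ExpField.flow_unique (H : ExpField T L C b D)
    (hv : ∀ x, IsApproxSol T (fun s => contRep (b s)) 0 x (v x)) {Z : ℝ → 𝕋 d → 𝕋 d}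
    (hZ : IsFlow T (fun s => contRep (b s)) Z) (ht : t ∈ Icc 0 T) :
    Z t = fun x => x + torusProj (v x t) := by
  funext x
  obtain ⟨hint, heq⟩ := hZ x
  have hlift : IsApproxSol T (fun s => contRep (b s)) 0 x
      fun t => ∫ s in (0 : ℝ)..t, contRep (b s) (Z s x) := by
    refine ⟨continuousOn_integral_of_integrableOn_Icc hint, fun t ht => ?_⟩
    rw [norm_le_zero_iff, sub_eq_zero]
    refine intervalIntegral.integral_congr fun s hs => ?_
    rw [uIcc_of_le ht.1] at hs
    simp only [← heq s ⟨hs.1, hs.2.trans ht.2⟩]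
  rw [heq t ht, H.eq_of_isApproxSol_zero (hv x) hlift ht]

theorem ExpField.torusMapMemW1p (H : ExpField T L C b D) (hT : 0 ≤ T)
    (hv : ∀ x, IsApproxSol T (fun s => contRep (b s)) 0 x (v x)) {p : ℝ≥0∞} (hp : p ≠ ⊤) :
    TorusMapMemW1p p fun x => x + torusProj (v x T) := by
  obtain ⟨v', hv', hcont, hmem⟩ := H.exists_flow hT
  refine ⟨_, hcont, fun x => ?_, hmem p hp⟩
  simp only [H.eq_of_isApproxSol_zero (hv x) (hv' x) ⟨hT, le_rfl⟩]

theorem ExpField.exists_inverse (H : ExpField T L C b D)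
    (hv : ∀ x, IsApproxSol T (fun s => contRep (b s)) 0 x (v x)) (ht : t ∈ Icc 0 T) :
    ∃ Y : 𝕋 d → 𝕋 d, Function.LeftInverse Y (fun x => x + torusProj (v x t)) ∧
      Function.RightInverse Y (fun x => x + torusProj (v x t)) ∧ ∀ p : ℝ≥0∞, p ≠ ⊤ →
        TorusMapMemW1p p (fun x => x + torusProj (v x t)) ∧ TorusMapMemW1p p Y := by
  have H_fwd := H.restrict ht.2
  have hv_fwd (x : 𝕋 d) := (hv x).restrict ht.2
  obtain ⟨v', hv', -⟩ := H_fwd.reverse.exists_flow ht.1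
  refine ⟨fun y => y + torusProj (v' y t), fun x => ?_, fun y => ?_, fun p hp =>
    ⟨H_fwd.torusMapMemW1p ht.1 hv_fwd hp, H_fwd.reverse.torusMapMemW1p ht.1 hv' hp⟩⟩
  · simp only [H_fwd.eq_neg_of_isApproxSol_reverse ht.1 (hv_fwd x) (hv' _), torusProj_neg,
      add_neg_cancel_right]
  · have hv_double := hv_fwd (y + torusProj (v' y t))
    simp only [H_fwd.reverse.eq_neg_of_isApproxSol_reverse ht.1 (hv' y)
      (by simpa only [neg_neg, sub_sub_cancel] using hv_double), torusProj_neg,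
      add_neg_cancel_right]

theorem exists_expField
    (hb : Integrable (fun z : ℝ × 𝕋 d => b z.1 z.2) ((volume.restrict (Icc 0 T)).prod volume))
    (hD : ∀ t ∈ Icc 0 T, IsWeakGradient (b t) (D t))
    (hexp : ∀ β : ℝ, 0 < β →
      (⨆ t ∈ Icc 0 T, ∫⁻ x, ENNReal.ofReal (Real.exp (β * matrixAbs (D t x)))) < (⊤ : ℝ≥0∞))
    (hdiv : ∀ᵐ t ∂volume.restrict (Icc 0 T), ∀ᵐ x, |(D t x).trace| ≤ L) :
    ∃ C, ExpField T L C b D := by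
  set M : ℝ → ℝ≥0∞ := fun β =>
    ⨆ t ∈ Icc 0 T, ∫⁻ x, ENNReal.ofReal (Real.exp (β * matrixAbs (D t x)))
  refine ⟨fun β => (M (β + 1)).toNNReal, hb, hD, fun β hβ t ht => ?_, hdiv⟩
  rw [ENNReal.coe_toNNReal (hexp (β + 1) (by positivity)).ne]
  calc ∫⁻ x, ENNReal.ofReal (Real.exp (β * matrixAbs (D t x)))
      ≤ ∫⁻ x, ENNReal.ofReal (Real.exp ((β + 1) * matrixAbs (D t x))) := by
        gcongr with x
        · exact matrixAbs_nonneg _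
        · linarith
    _ ≤ M (β + 1) := le_iSup₂ (f := fun t (_ : t ∈ Icc 0 T) =>
        ∫⁻ x, ENNReal.ofReal (Real.exp ((β + 1) * matrixAbs (D t x)))) t ht

end Flow

theorem corollary1p5 (d : ℕ) (hd : 1 ≤ d) (T : ℝ) (hT : 0 < T)
    (b : ℝ → UnitAddTorus (Fin d) → Euc d)
    (D : ℝ → UnitAddTorus (Fin d) → Matrix (Fin d) (Fin d) ℝ)
    (hb : Integrable (fun z : ℝ × UnitAddTorus (Fin d) => b z.1 z.2)
      ((volume.restrict (Icc 0 T)).prod volume))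
    (hD : ∀ t ∈ Icc 0 T, IsWeakGradient (b t) (D t))
    (hexp : ∀ β : ℝ, 0 < β →
      (⨆ t ∈ Icc 0 T, ∫⁻ x, ENNReal.ofReal (Real.exp (β * matrixAbs (D t x)))) < (⊤ : ℝ≥0∞))
    (hdiv : ∃ L : ℝ, ∀ᵐ t ∂(volume.restrict (Icc 0 T)),
      ∀ᵐ x : UnitAddTorus (Fin d), |(D t x).trace| ≤ L) :
    -- the continuous representative of `b`
    ∃ b' : ℝ → UnitAddTorus (Fin d) → Euc d,
      (∀ t ∈ Icc 0 T, Continuous (b' t) ∧ b' t =ᵐ[volume] b t) ∧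
      -- its flow, which exists and is unique
      ∃ X : ℝ → UnitAddTorus (Fin d) → UnitAddTorus (Fin d),
        IsFlow T b' X ∧
        (∀ Z, IsFlow T b' Z → ∀ t ∈ Icc 0 T, Z t = X t) ∧
        ∀ t ∈ Icc 0 T, ∃ Y : UnitAddTorus (Fin d) → UnitAddTorus (Fin d),
          Function.LeftInverse Y (X t) ∧ Function.RightInverse Y (X t) ∧
          ∀ p : ℝ≥0∞, 1 ≤ p → p ≠ ⊤ →
            TorusMapMemW1p p (X t) ∧ TorusMapMemW1p p Y := by
  obtain ⟨L, hL⟩ := hdiv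
  obtain ⟨C, H⟩ := exists_expField hb hD hexp hL
  obtain ⟨v, hv, -⟩ := H.exists_flow hT.le
  refine ⟨fun t => contRep (b t), fun t ht => ⟨H.continuous_contRep ht, H.contRep_ae_eq ht⟩,
    fun t x => x + torusProj (v x t), H.isFlow hv, fun Z hZ t => H.flow_unique hv hZ,
    fun t ht => ?_⟩
  obtain ⟨Y, hleft, hright, hmem⟩ := H.exists_inverse hv ht
  exact ⟨Y, hleft, hright, fun p _ => hmem p⟩
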